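/- **Setting.** Let $\mathbf T^2=(\mathbf R/\mathbf Z)^2$ with its Lebesgue probability measure and $M(v)=\frac1{2\pi}e^{-|v|^2/2}$ on $\mathbf R^2$. For $\rho_*$ with $\int_{\mathbf T^2}\rho_*=1$ and $\delta>0$, let $\phi_\infty\in H^1(\mathbf T^2)$ be the weak solution of $-\delta^2\Delta\phi_\infty=e^{-\phi_\infty}-\rho_*$, put $f_\infty(x,v)=M(v)e^{-\phi_\infty(x)}$, $d\mu=f_\infty\,dx\,dv$, $\mathcal H=L^2(\mathbf T^2\times\mathbf R^2,\mu)$ with norm $\|\cdot\|$ and scalar product $\langle\cdot,\cdot\rangle$, and $\mathcal H_0=\{h\in\mathcal H:\int h\,d\mu=0\}$. Let $A=\nabla_v$, $C=\nabla_x$ (weak derivatives) and $A^*=v-\nabla_v$, so that $A^*\cdot Ah=v\cdot\nabla_vh-\Delta_vh$; $A^2h$ and $ACh$ denote the matrices $(\partial_{v_i}\partial_{v_j}h)$ and $(\partial_{v_i}\partial_{x_j}h)$. A norm of a derivative of $h$ is $+\infty$ if that derivative does not exist in $L^2(\mu)$ (and $\|A^*\cdot Ah\|=+\infty$ if $Ah$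 or $A^2h$ is not in $L^2(\mu)$); all functionals below take values in $[0,\infty]$, with $0\cdot\infty=0$. For $h\in\mathcal H_0$ the electric field is $E=\delta^{-2}\nabla\Delta^{-1}n$ with $n=\int_{\mathbf R^2}hf_\infty\,dv$. For $\beta\in\mathbf R^3$, $\gamma\in(0,\infty)^3$, $\tau>0$, $t\ge0$, write $m=\min(1,t/\tau)$ and $$|||h|||_t^2=\|h\|^2+\gamma_1\tau^{\beta_1}m\|Ah\|^2+\gamma_2\tau^{\beta_2}m^3\|Ch\|^2+2\gamma_3\tau^{\beta_3}m^2\langle Ah,Ch\rangle$$ (equal to $\|h\|^2$ at $t=0$, and to $+\infty$ if $t>0$ and $Ah$ or $Ch$ is not in $L^2(\mu)$), $$\mathcal E_t(h)=|||h|||_t^2+\delta^2(1+\gamma_1\tau^{\beta_1}m)\|E\|_{L^2(\mathbf T^2)}^2,$$ $$D_t(h)=\tau^{-1}\|Ah\|^2+\gamma_1\tau^{\beta_1-1}m\|A^*\cdot Ah\|^2+\gamma_2\tau^{\beta_2-1}m^3\|ACh\|^2+\gamma_3\tau^{\beta_3}m^2\|Ch\|^2.$$ The quadratic remainder is $$Q^\delta_t(h)=\tfrac1{\delta^2}\Big(\tau^{\beta_2}m^3\big(\|Ah\|+\|h\|\big)\|Ch\|+\tau^{\beta_3}m^2\big(\|Ah\|^2+\|h\|\|Ch\|+\|h\|\|Ah\|\big)\Big).$$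 With $[g]_s=\|g\|^{1-s}\|Cg\|^s$, $\eta\in(0,1)^9$ and $\tilde\eta_1\in(0,1)$, the trilinear remainder is $$\mathcal R^\delta_t(h,g,\tilde g)=\tfrac1{\delta^2}\big(T_1\chi_{t\ge\tau}+\tilde T_1\chi_{t\le\tau}\big)+\tfrac1{\delta^2}\sum_{i=2}^9T_i,$$ where $T_1=\|Ah\|[g]_{\eta_1}\|\tilde g\|$, $\tilde T_1=\|Ah\|\|g\|[\tilde g]_{\tilde\eta_1}$, $T_2=\tau^{\beta_1}m\|Ah\|[g]_{\eta_2}\|\tilde g\|$, $T_3=\tau^{\beta_1}m\|A^2h\|[\tilde g]_{\eta_3}\|Ag\|$, $T_4=\tau^{\beta_2}m^3\|ACh\|\|Cg\|[\tilde g]_{\eta_4}$, $T_5=\tau^{\beta_2}m^3\|ACh\|[\tilde g]_{\eta_5}[g]_{1-\eta_5}$, $T_6=\tau^{\beta_3}m^2\|A^2h\|[\tilde g]_{\eta_6}\|Cg\|$, $T_7=\tau^{\beta_3}m^2\|A^2h\|[\tilde g]_{\eta_7}[g]_{1-\eta_7}$, $T_8=\tau^{\beta_3}m^2\|Ch\|[g]_{\eta_8}\|\tilde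 g\|$, $T_9=\tau^{\beta_3}m^2\|ACh\|[\tilde g]_{\eta_9}\|Ag\|$. **Proposition 8.2.** Set $\beta=(-\tfrac8{15},\tfrac25,-\tfrac1{15})$. Let $\varepsilon>0$, $\tau_0>0$, and let $\gamma\in(0,\infty)^3$ be such that, for some $c_0,C_0>0$, $$c_0\,N_t(h)\le|||h|||_t^2\le C_0\,N_t(h),\qquad N_t(h)=\|h\|^2+\tau^{\beta_1}m\|Ah\|^2+\tau^{\beta_2}m^3\|Ch\|^2,$$ for all $\rho_*$ of integral $1$ lying in $W^{1,q}(\mathbf T^2)$ for some $q>2$, all $\delta>0$, $\tau>\tau_0$, $t\ge0$ and $h\in\mathcal H$. Let $\rho_*\in W^{1,p}(\mathbf T^2)$, $p>2$, with $\int_{\mathbf T^2}\rho_*=1$, and let $\delta_0>0$. Then there exist $\eta\in(0,1)^9$, $\tilde\eta_1\in(0,1)$ and $K>0$ such that for all $t\ge0$, $\tau>\tau_0$, $\delta>\delta_0$ and $(h,g,\tilde g)\in(\mathcal H_0)^3$, $$Q^\delta_t(h)\le\frac{K\tau^{14/15}}{\delta^2}D_t(h),$$ $$\mathcal R^\delta_t(h,g,\tilde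 g)\le\frac{K\tau^{14/15+\varepsilon}}{\delta^2}D_t(h)^{1/2}\Big[D_t(g)^{1/2}+\tau^{-1/2}\big(\tfrac t\tau\big)^{-3\tilde\eta_1/2}\chi_{t\le\tau}\|g\|\Big]\mathcal E_t(\tilde g)^{1/2}.$$ (At $t=0$ the factor $(t/\tau)^{-3\tilde\eta_1/2}$ is $+\infty$.) -/

import Mathlib

open MeasureTheory Set
open scoped ENNReal ContDiff

noncomputable section

namespace VPFP

/-- The position space: the unit torus `𝐓² = (ℝ/ℤ)²`, with its Lebesgue probability measure. -/
abbrev Torus : Type := UnitAddTorus (Fin 2)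

/-- The velocity space `ℝ²` with its Euclidean structure. -/
abbrev Vel : Type := EuclideanSpace ℝ (Fin 2)

/-- The phase space `𝐓² × ℝ²`, with Lebesgue measure `dx dv`. -/
abbrev Phase : Type := Torus × Vel

/-- `2 × 2` matrices with the Frobenius norm. -/
abbrev Mat : Type := EuclideanSpace ℝ (Fin 2 × Fin 2)

/-- The covering map `ℝ² → 𝐓²`. -/
def proj (y : Vel) : Torus := fun i => (y i : UnitAddCircle)

/-! ### Sobolev spaces on the torus -/

/-- `∂_{x_i} χ` for a function on the torus. -/
def partialT (i : Fin 2) (χ : Torus → ℝ) (x : Torus) : ℝ :=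
  deriv (fun s : ℝ => χ (x + Pi.single i (s : UnitAddCircle))) 0

/-- Smooth functions on the torus. -/
def IsTestT (χ : Torus → ℝ) : Prop :=
  ContDiff ℝ ∞ (fun y : Vel => χ (proj y))

/-- `G` is the weak gradient of `u` on the torus. -/
def IsGradT (u : Torus → ℝ) (G : Torus → Vel) : Prop :=
  Integrable u ∧ ∀ i, Integrable (fun x => G x i) ∧
    ∀ χ, IsTestT χ → ∫ x, u x * partialT i χ x = -∫ x, G x i * χ x

/-- `u ∈ W^{1,p}(𝐓²)`. -/
def MemW1 (p : ℝ≥0∞) (u : Torus → ℝ) : Prop :=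
  MemLp u p ∧ ∃ G, IsGradT u G ∧ MemLp G p

/-- `φ ∈ H¹(𝐓²)` is a weak solution of the Poisson-Boltzmann equation
`-δ² Δφ = e^{-φ} - ρ` on the torus. -/
def IsPoissonBoltzmann (δ : ℝ) (ρ φ : Torus → ℝ) : Prop :=
  MemLp φ 2 ∧ Integrable (fun x => Real.exp (-φ x)) ∧ ∃ G, IsGradT φ G ∧ MemLp G 2 ∧
    ∀ χ, IsTestT χ →
      δ ^ 2 * ∫ x, ∑ i, G x i * partialT i χ x = ∫ x, (Real.exp (-φ x) - ρ x) * χ x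

/-! ### The equilibrium and the weighted space `𝓗 = L²(μ)` -/

/-- The Maxwellian `M(v) = (2π)⁻¹ e^{-|v|²/2}`. -/
def maxwellian (v : Vel) : ℝ := (2 * Real.pi)⁻¹ * Real.exp (-‖v‖ ^ 2 / 2)

/-- The equilibrium `f_∞(x,v) = M(v) e^{-φ(x)}` with potential `φ`. -/
def finf (φ : Torus → ℝ) (z : Phase) : ℝ := maxwellian z.2 * Real.exp (-φ z.1)

/-- The measure `dμ = f_∞ dx dv`. -/
def mu (φ : Torus → ℝ) : Measure Phase :=
  (volume : Measure Phase).withDensity (fun z => ENNReal.ofReal (finf φ z))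

/-- `h ∈ 𝓗 = L²(μ)`. -/
def MemH (φ : Torus → ℝ) (h : Phase → ℝ) : Prop := MemLp h 2 (mu φ)

/-- `h ∈ 𝓗₀`: `h ∈ 𝓗` and `⟨1, h⟩ = 0`. -/
def MemH0 (φ : Torus → ℝ) (h : Phase → ℝ) : Prop := MemH φ h ∧ ∫ z, h z ∂(mu φ) = 0

/-- `‖h‖`, the norm of `𝓗`. -/
def normH (φ : Torus → ℝ) (h : Phase → ℝ) : ℝ≥0∞ := eLpNorm h 2 (mu φ)

/-! ### The operators `A = ∇_v` and `C = ∇_x` in the weak sense -/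

/-- `∂_{x_i} ψ` on phase space. -/
def partialX (i : Fin 2) (ψ : Phase → ℝ) (z : Phase) : ℝ :=
  deriv (fun s : ℝ => ψ (z.1 + Pi.single i (s : UnitAddCircle), z.2)) 0

/-- `∂_{v_i} ψ` on phase space. -/
def partialV (i : Fin 2) (ψ : Phase → ℝ) (z : Phase) : ℝ :=
  deriv (fun s : ℝ => ψ (z.1, z.2 + s • EuclideanSpace.single i (1 : ℝ))) 0

/-- Smooth compactly supported functions on phase space. -/
def IsTest (ψ : Phase → ℝ) : Prop :=
  ContDiff ℝ ∞ (fun y : Vel × Vel => ψ (proj y.1, y.2)) ∧ HasCompactSupport ψ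

/-- `w` is the weak derivative of `u` for the partial derivative `d`
(one of the `partialX i`, `partialV i`). -/
def IsWeakDeriv (d : (Phase → ℝ) → Phase → ℝ) (u w : Phase → ℝ) : Prop :=
  LocallyIntegrable u ∧ LocallyIntegrable w ∧
    ∀ ψ, IsTest ψ → ∫ z, u z * d ψ z = -∫ z, w z * ψ z

/-- `G = Ah = ∇_v h` weakly. -/
def IsGradV (h : Phase → ℝ) (G : Phase → Vel) : Prop :=
  ∀ i, IsWeakDeriv (partialV i) h (fun z => G z i)

/-- `F = Ch = ∇_x h` weakly. -/
def IsGradX (h : Phase → ℝ) (F : Phase → Vel) : Prop :=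
  ∀ i, IsWeakDeriv (partialX i) h (fun z => F z i)

/-- `H = AG` weakly: `H_{ij} = ∂_{v_i} G_j`. -/
def IsJacV (G : Phase → Vel) (H : Phase → Mat) : Prop :=
  ∀ i j, IsWeakDeriv (partialV i) (fun z => G z j) (fun z => H z (i, j))

/-! Each of the following extended norms is the `L²(μ)`-norm of the (almost everywhere unique)
weak derivative if there is one, and `∞` if there is none. -/

/-- `‖Ah‖`. -/
def normA (φ : Torus → ℝ) (h : Phase → ℝ) : ℝ≥0∞ :=
  ⨅ (G : Phase → Vel) (_ : IsGradV h G), eLpNorm G 2 (mu φ)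

/-- `‖Ch‖`. -/
def normC (φ : Torus → ℝ) (h : Phase → ℝ) : ℝ≥0∞ :=
  ⨅ (F : Phase → Vel) (_ : IsGradX h F), eLpNorm F 2 (mu φ)

/-- `‖A²h‖`. -/
def normAA (φ : Torus → ℝ) (h : Phase → ℝ) : ℝ≥0∞ :=
  ⨅ (G : Phase → Vel) (H : Phase → Mat) (_ : IsGradV h G) (_ : IsJacV G H), eLpNorm H 2 (mu φ)

/-- `‖ACh‖`. -/
def normAC (φ : Torus → ℝ) (h : Phase → ℝ) : ℝ≥0∞ :=
  ⨅ (F : Phase → Vel) (H : Phase → Mat) (_ : IsGradX h F) (_ : IsJacV F H), eLpNorm H 2 (mu φ)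

/-- `‖A^*·Ah‖`, where `A^*_i = v_i - ∂_{v_i}`, so that `A^*·Ah = v·∇_v h - Δ_v h`. The operator
`A^*·A` is taken on its domain `{h : Ah ∈ L²(μ), A²h ∈ L²(μ)}`, and the value is `∞` outside. -/
def normAstarA (φ : Torus → ℝ) (h : Phase → ℝ) : ℝ≥0∞ :=
  ⨅ (G : Phase → Vel) (H : Phase → Mat) (_ : IsGradV h G) (_ : IsJacV G H)
    (_ : MemLp G 2 (mu φ)) (_ : MemLp H 2 (mu φ)),
    eLpNorm (fun z => ∑ i, (z.2 i * G z i - H z (i, i))) 2 (mu φ)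

/-! ### The electric field -/

/-- The macroscopic density `n(x) = ∫ h(x,v) f_∞(x,v) dv`. -/
def density (φ : Torus → ℝ) (h : Phase → ℝ) (x : Torus) : ℝ := ∫ v, h (x, v) * finf φ (x, v)

/-- `E = δ⁻² ∇Δ⁻¹ n`, i.e. `E = -∇ψ` where `ψ ∈ H¹(𝐓²)` solves `-δ² Δψ = n` weakly. -/
def IsElectricField (δ : ℝ) (φ : Torus → ℝ) (h : Phase → ℝ) (E : Torus → Vel) : Prop :=
  MemLp E 2 ∧ ∃ ψ : Torus → ℝ, MemLp ψ 2 ∧ IsGradT ψ (fun x => -E x) ∧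
    ∀ χ, IsTestT χ →
      δ ^ 2 * ∫ x, ∑ i, (-E x i) * partialT i χ x = ∫ x, density φ h x * χ x

/-- `‖E‖_{L²(𝐓²)}` for the (almost everywhere unique) electric field `E` created by `h`. -/
def normE (δ : ℝ) (φ : Torus → ℝ) (h : Phase → ℝ) : ℝ≥0∞ :=
  ⨅ (E : Torus → Vel) (_ : IsElectricField δ φ h E), eLpNorm E 2 volume

/-! ### Energy and dissipation functionals

The indices `0, 1, 2` of `β` and `γ` stand for the usual indices `1, 2, 3`. All functionals take
values in `[0,∞]`, with `0 · ∞ = 0`. -/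

/-- The time weight `min(1, t/τ)`. -/
def wt (τ t : ℝ) : ℝ := min 1 (t / τ)

/-- The squared twisted norm
`‖h‖² + γ₁τ^{β₁} m ‖Ah‖² + γ₂τ^{β₂} m³ ‖Ch‖² + 2γ₃τ^{β₃} m² ⟨Ah, Ch⟩` with `m = min(1, t/τ)`.
At `t = 0` it is `‖h‖²`; for `t > 0` it is infinite unless `Ah` and `Ch` are in `L²(μ)`. -/
def twistedSq (γ β : Fin 3 → ℝ) (τ t : ℝ) (φ : Torus → ℝ) (h : Phase → ℝ) : ℝ≥0∞ :=
  open scoped Classical in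
  if t = 0 then normH φ h ^ 2 else
    ⨅ (G : Phase → Vel) (F : Phase → Vel) (_ : IsGradV h G) (_ : IsGradX h F)
      (_ : MemLp G 2 (mu φ)) (_ : MemLp F 2 (mu φ)),
      ENNReal.ofReal (
        ∫ z, h z ^ 2 ∂(mu φ)
        + γ 0 * τ ^ β 0 * wt τ t * ∫ z, ‖G z‖ ^ 2 ∂(mu φ)
        + γ 1 * τ ^ β 1 * wt τ t ^ 3 * ∫ z, ‖F z‖ ^ 2 ∂(mu φ)
        + 2 * γ 2 * τ ^ β 2 * wt τ t ^ 2 * ∫ z, inner ℝ (G z) (F z) ∂(mu φ))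

/-- The untwisted weighted norm `‖h‖² + τ^{β₁} m ‖Ah‖² + τ^{β₂} m³ ‖Ch‖²`. -/
def plainSq (β : Fin 3 → ℝ) (τ t : ℝ) (φ : Torus → ℝ) (h : Phase → ℝ) : ℝ≥0∞ :=
  normH φ h ^ 2
    + ENNReal.ofReal (τ ^ β 0 * wt τ t) * normA φ h ^ 2
    + ENNReal.ofReal (τ ^ β 1 * wt τ t ^ 3) * normC φ h ^ 2

/-- The condition on `γ`: the twisted norm is equivalent to the untwisted one, uniformly in
`ρ_*`, `δ > 0`, `τ > τ₀`, `t ≥ 0` and `h`. -/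
def NormEquivalence (γ β : Fin 3 → ℝ) (τ₀ : ℝ) : Prop :=
  ∃ c₀ C₀ : ℝ, 0 < c₀ ∧ 0 < C₀ ∧
    ∀ (p : ℝ≥0∞) (ρ : Torus → ℝ), 2 < p → MemW1 p ρ → ∫ x, ρ x = 1 →
    ∀ δ > 0, ∀ φ, IsPoissonBoltzmann δ ρ φ →
    ∀ τ > τ₀, ∀ t ≥ 0, ∀ h, MemH φ h →
      ENNReal.ofReal c₀ * plainSq β τ t φ h ≤ twistedSq γ β τ t φ h ∧
      twistedSq γ β τ t φ h ≤ ENNReal.ofReal C₀ * plainSq β τ t φ h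

/-- The energy `𝓔_t(h)`, i.e. the squared twisted norm plus
`δ² (1 + γ₁τ^{β₁} m) ‖E‖²_{L²}`. -/
def energy (γ β : Fin 3 → ℝ) (τ δ t : ℝ) (φ : Torus → ℝ) (h : Phase → ℝ) : ℝ≥0∞ :=
  twistedSq γ β τ t φ h
    + ENNReal.ofReal (δ ^ 2 * (1 + γ 0 * τ ^ β 0 * wt τ t)) * normE δ φ h ^ 2

/-- The dissipation `D_t(h)`. -/
def dissipation (γ β : Fin 3 → ℝ) (τ t : ℝ) (φ : Torus → ℝ) (h : Phase → ℝ) : ℝ≥0∞ :=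
  ENNReal.ofReal τ⁻¹ * normA φ h ^ 2
    + ENNReal.ofReal (γ 0 * τ ^ (β 0 - 1) * wt τ t) * normAstarA φ h ^ 2
    + ENNReal.ofReal (γ 1 * τ ^ (β 1 - 1) * wt τ t ^ 3) * normAC φ h ^ 2
    + ENNReal.ofReal (γ 2 * τ ^ β 2 * wt τ t ^ 2) * normC φ h ^ 2

/-! ### Quadratic and trilinear remainders -/

/-- The quadratic remainder `Q^δ_t(h) = δ⁻² (S₁ + ⋯ + S₅)`. -/
def quadRem (β : Fin 3 → ℝ) (τ δ t : ℝ) (φ : Torus → ℝ) (h : Phase → ℝ) : ℝ≥0∞ :=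
  ENNReal.ofReal (1 / δ ^ 2) *
    (ENNReal.ofReal (τ ^ β 1 * wt τ t ^ 3) * normA φ h * normC φ h
    + ENNReal.ofReal (τ ^ β 1 * wt τ t ^ 3) * normH φ h * normC φ h
    + ENNReal.ofReal (τ ^ β 2 * wt τ t ^ 2) * normA φ h ^ 2
    + ENNReal.ofReal (τ ^ β 2 * wt τ t ^ 2) * normH φ h * normC φ h
    + ENNReal.ofReal (τ ^ β 2 * wt τ t ^ 2) * normH φ h * normA φ h)

/-- Geometric interpolation `‖g‖^{1-s} ‖Cg‖^s`. -/
def interp (φ : Torus → ℝ) (g : Phase → ℝ) (s : ℝ) : ℝ≥0∞ :=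
  normH φ g ^ (1 - s) * normC φ g ^ s

/-- The trilinear remainder
`𝓡^δ_t(h,g,k) = δ⁻² (T₁ χ_{t ≥ τ} + T₁' χ_{t ≤ τ}) + δ⁻² (T₂ + ⋯ + T₉)`,
with exponents `η = (η₁,…,η₉)` (indexed from `0`) and `η'`. -/
def triRem (β : Fin 3 → ℝ) (η : Fin 9 → ℝ) (η' τ δ t : ℝ) (φ : Torus → ℝ)
    (h g k : Phase → ℝ) : ℝ≥0∞ :=
  open scoped Classical in
  ENNReal.ofReal (1 / δ ^ 2) *
    ((if τ ≤ t then normA φ h * interp φ g (η 0) * normH φ k else 0)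
    + (if t ≤ τ then normA φ h * normH φ g * interp φ k η' else 0))
  + ENNReal.ofReal (1 / δ ^ 2) *
    (ENNReal.ofReal (τ ^ β 0 * wt τ t) * normA φ h * interp φ g (η 1) * normH φ k
    + ENNReal.ofReal (τ ^ β 0 * wt τ t) * normAA φ h * interp φ k (η 2) * normA φ g
    + ENNReal.ofReal (τ ^ β 1 * wt τ t ^ 3) * normAC φ h * normC φ g * interp φ k (η 3)
    + ENNReal.ofReal (τ ^ β 1 * wt τ t ^ 3) * normAC φ h * interp φ k (η 4)
        * interp φ g (1 - η 4)
    + ENNReal.ofReal (τ ^ β 2 * wt τ t ^ 2) * normAA φ h * interp φ k (η 5) * normC φ g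
    + ENNReal.ofReal (τ ^ β 2 * wt τ t ^ 2) * normAA φ h * interp φ k (η 6)
        * interp φ g (1 - η 6)
    + ENNReal.ofReal (τ ^ β 2 * wt τ t ^ 2) * normC φ h * interp φ g (η 7) * normH φ k
    + ENNReal.ofReal (τ ^ β 2 * wt τ t ^ 2) * normAC φ h * interp φ k (η 8) * normA φ g)

/-- The short-time term `τ^{-1/2} (t/τ)^{-3η'/2} χ_{t ≤ τ} ‖g‖` (equal to `∞` at `t = 0` if
`g ≠ 0`). -/
def shortTime (η' τ t : ℝ) (φ : Torus → ℝ) (g : Phase → ℝ) : ℝ≥0∞ :=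
  open scoped Classical in
  if t ≤ τ then
    ENNReal.ofReal (τ ^ (-(1 / 2) : ℝ)) * ENNReal.ofReal (t / τ) ^ (-(3 * η' / 2)) * normH φ g
  else 0

/-- The exponents `β = (-8/15, 2/5, -1/15)`. -/
def betaColl : Fin 3 → ℝ := ![-8 / 15, 2 / 5, -1 / 15]

end VPFP

end

/-!
Testing the Poisson-Boltzmann equation with (a regularization of) `e^{-φ}` gives
`‖e^{-φ}‖₂ ≤ ‖ρ‖₂`. The Fourier coefficients of `φ` at `k ≠ 0` are therefore `δ⁻² |k|⁻²` times an
`ℓ²` sequence bounded independently of `δ`, so that the oscillation of `φ` is bounded uniformly in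
`δ > δ₀`; conservation of mass then bounds `φ` itself, and `μ` is comparable to `M(v) dx dv`.

For `M(v) dx dv` the Fourier-Hermite basis turns `∂_{x_j}` and `∂_{v_i}` into a diagonal operator
and a lowering operator. Comparing coefficients gives the Poincaré inequality
`‖h‖ ≲ ‖A h‖ + ‖C h‖` on `𝓗₀` and the elliptic estimate `‖A² h‖ ≲ ‖A* · A h‖`.

Consequently every factor of the remainders is at most `τ^a m^b`, `m = min(1, t/τ)`, times the
square root of a dissipation or of an energy. With all `ηᵢ = 1/4` and `η̃₁ = 1/2` the powers of `τ`
in each product add up to at most `14/15` and those of `m` to at least `0`. The only exceptions are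
`T₁`, which is needed for `m = 1` alone, and `T̃₁`, which is what the short-time factor is for.
-/

noncomputable section

namespace VPFP

open scoped ComplexConjugate Topology
open Filter

/-! ### Complete orthonormal systems -/

section CompleteSystems

variable {ι κ X Y : Type*} [MeasurableSpace X] [MeasurableSpace Y]

/-- The coefficient `⟨b i, f⟩` of `f` in `L²(μ; ℂ)`. -/
def coef (μ : Measure X) (b : ι → X → ℂ) (f : X → ℂ) (i : ι) : ℂ :=
  ∫ x, conj (b i x) * f x ∂μ

/-- The partial sum over `S` of the expansion of `f` along `b`. -/
def partialSum (μ : Measure X) (b : ι → X → ℂ) (f : X → ℂ) (S : Finset ι) (x : X) : ℂ :=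
  ∑ i ∈ S, coef μ b f i * b i x

/-- The functions `b i` form a Hilbert basis of `L²(μ; ℂ)`. This is stated for functions rather than
for classes in `Lp`, so that bases can be differentiated and multiplied pointwise. -/
structure IsCompleteONS (μ : Measure X) (b : ι → X → ℂ) : Prop where
  memLp : ∀ i, MemLp (b i) 2 μ
  coef_self : ∀ i, coef μ b (b i) i = 1
  coef_ne : ∀ i j, i ≠ j → coef μ b (b j) i = 0
  complete : ∀ f, MemLp f 2 μ → (∀ i, coef μ b f i = 0) → f =ᵐ[μ] 0

/-- The tensor product of two families of functions. -/
def tensor (b : ι → X → ℂ) (c : κ → Y → ℂ) (i : ι × κ) (z : X × Y) : ℂ :=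
  b i.1 z.1 * c i.2 z.2

theorem inner_toLp_eq_integral {μ : Measure X} {f g : X → ℂ} (hf : MemLp f 2 μ)
    (hg : MemLp g 2 μ) : inner ℂ (hf.toLp f) (hg.toLp g) = ∫ x, conj (f x) * g x ∂μ := by
  rw [L2.inner_def]
  refine integral_congr_ae ?_
  filter_upwards [hf.coeFn_toLp, hg.coeFn_toLp] with x h1 h2
  rw [h1, h2, RCLike.inner_apply, mul_comm]

theorem integrable_conj_mul {μ : Measure X} {f g : X → ℂ} (hf : MemLp f 2 μ)
    (hg : MemLp g 2 μ) : Integrable (fun x => conj (f x) * g x) μ :=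
  MemLp.integrable_mul (p := 2) (q := 2) hf.star hg

theorem eLpNorm_two_sq_eq_ofReal {E : Type*} [NormedAddCommGroup E] {μ : Measure X} {f : X → E}
    (hf : MemLp f 2 μ) : eLpNorm f 2 μ ^ 2 = ENNReal.ofReal (∫ x, ‖f x‖ ^ 2 ∂μ) := by
  rw [hf.eLpNorm_eq_integral_rpow_norm (by norm_num) (by norm_num),
    ← ENNReal.ofReal_pow (by positivity)]
  congr 1
  simp only [ENNReal.toReal_ofNat, Real.rpow_two]
  rw [← Real.rpow_natCast, ← Real.rpow_mul (integral_nonneg fun x => by positivity)]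
  norm_num

theorem coef_tensor_tensor (μ : Measure X) (ν : Measure Y) [SFinite μ] [SFinite ν] (b : ι → X → ℂ)
    (c : κ → Y → ℂ) (i j : ι × κ) :
    coef (μ.prod ν) (tensor b c) (tensor b c j) i
      = coef μ b (b j.1) i.1 * coef ν c (c j.2) i.2 := by
  simp only [coef, tensor, ← integral_prod_mul, map_mul]
  congr 1 with z
  ring

theorem ae_memLp_slice {μ : Measure X} {ν : Measure Y} [SFinite μ] [SFinite ν] {f : X × Y → ℂ}
    (hf : MemLp f 2 (μ.prod ν)) : ∀ᵐ y ∂ν, MemLp (fun x => f (x, y)) 2 μ := by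
  have hswap := hf.comp_measurePreserving (Measure.measurePreserving_swap (μ := ν) (ν := μ))
  filter_upwards [hswap.aestronglyMeasurable.prodMk_left,
    (hswap.integrable_norm_pow (by norm_num)).prod_right_ae] with y hmeas hint
  exact (memLp_two_iff_integrable_sq_norm hmeas).2 hint

theorem ae_eq_zero_of_slices {μ : Measure X} {ν : Measure Y} [SFinite μ] [SFinite ν]
    {f : X × Y → ℂ} (hf : MemLp f 2 (μ.prod ν))
    (h : ∀ᵐ y ∂ν, (fun x => f (x, y)) =ᵐ[μ] 0) : f =ᵐ[μ.prod ν] 0 := by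
  have hint := hf.integrable_norm_pow (two_ne_zero)
  have hzero : ∫ z, ‖f z‖ ^ 2 ∂(μ.prod ν) = 0 := by
    rw [integral_prod_symm _ hint]
    refine integral_eq_zero_of_ae (h.mono fun y hy => integral_eq_zero_of_ae ?_)
    exact hy.mono fun x hx => by simp [hx]
  filter_upwards [(integral_eq_zero_iff_of_nonneg (fun z => by positivity) hint).1 hzero] with z hz
  simpa using hz

namespace IsCompleteONS

variable {μ : Measure X} {ν : Measure Y} {b : ι → X → ℂ} {c : κ → Y → ℂ}

theorem orthonormal (hb : IsCompleteONS μ b) :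
    Orthonormal ℂ (fun i => (hb.memLp i).toLp (b i)) := by
  classical
  refine orthonormal_iff_ite.2 fun i j => ?_
  rw [inner_toLp_eq_integral]
  split_ifs with h
  · subst h
    exact hb.coef_self i
  · exact hb.coef_ne i j h

theorem orthogonal_eq_bot (hb : IsCompleteONS μ b) :
    (Submodule.span ℂ (Set.range fun i => (hb.memLp i).toLp (b i)))ᗮ = ⊥ := by
  refine (Submodule.eq_bot_iff _).2 fun f hf => (Lp.eq_zero_iff_ae_eq_zero).2 ?_
  refine hb.complete f (Lp.memLp f) fun i => ?_
  have horth := (Submodule.mem_orthogonal _ _).1 hf _ (Submodule.subset_span ⟨i, rfl⟩)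
  have hinner := inner_toLp_eq_integral (hb.memLp i) (Lp.memLp f)
  rw [Lp.toLp_coeFn] at hinner
  exact hinner.symm.trans horth

/-- The Hilbert basis of `Lp ℂ 2 μ` formed by the classes of the `b i`. -/
def hilbertBasis (hb : IsCompleteONS μ b) : HilbertBasis ι ℂ (Lp ℂ 2 μ) :=
  HilbertBasis.mkOfOrthogonalEqBot hb.orthonormal hb.orthogonal_eq_bot

theorem hilbertBasis_apply (hb : IsCompleteONS μ b) (i : ι) :
    hb.hilbertBasis i = (hb.memLp i).toLp (b i) := by
  rw [hilbertBasis, HilbertBasis.coe_mkOfOrthogonalEqBot]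

theorem hilbertBasis_repr_toLp (hb : IsCompleteONS μ b) {f : X → ℂ} (hf : MemLp f 2 μ) (i : ι) :
    hb.hilbertBasis.repr (hf.toLp f) i = coef μ b f i := by
  rw [HilbertBasis.repr_apply_apply, hilbertBasis_apply, inner_toLp_eq_integral]
  rfl

theorem hasSum_sq (hb : IsCompleteONS μ b) {f : X → ℂ} (hf : MemLp f 2 μ) :
    HasSum (fun i => ‖coef μ b f i‖ ^ 2) (∫ x, ‖f x‖ ^ 2 ∂μ) := by
  have h := hb.hilbertBasis.hasSum_inner_mul_inner (hf.toLp f) (hf.toLp f)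
  rw [inner_toLp_eq_integral] at h
  convert! RCLike.hasSum_re ℂ h using 1
  · ext i
    rw [← inner_conj_symm, ← hb.hilbertBasis.repr_apply_apply, hb.hilbertBasis_repr_toLp,
      RCLike.conj_mul]
    norm_cast
  · rw [← integral_re (integrable_conj_mul hf hf)]
    refine integral_congr_ae (Eventually.of_forall fun x => ?_)
    simp only [RCLike.conj_mul]
    norm_cast

theorem tsum_enorm_sq (hb : IsCompleteONS μ b) {f : X → ℂ} (hf : MemLp f 2 μ) :
    ∑' i, ‖coef μ b f i‖ₑ ^ 2 = eLpNorm f 2 μ ^ 2 := by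
  have h := hb.hasSum_sq hf
  rw [eLpNorm_two_sq_eq_ofReal hf, ← h.tsum_eq,
    ENNReal.ofReal_tsum_of_nonneg (fun _ => by positivity) h.summable]
  refine tsum_congr fun i => ?_
  rw [ENNReal.ofReal_pow (norm_nonneg _), ofReal_norm]

theorem memLp_partialSum (hb : IsCompleteONS μ b) (f : X → ℂ) (S : Finset ι) :
    MemLp (partialSum μ b f S) 2 μ :=
  memLp_finsetSum S fun i _ => (hb.memLp i).const_mul (coef μ b f i)

theorem tendsto_eLpNorm_partialSum_sub (hb : IsCompleteONS μ b) {f : X → ℂ} (hf : MemLp f 2 μ) :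
    Tendsto (fun S => eLpNorm (partialSum μ b f S - f) 2 μ) atTop (𝓝 0) := by
  refine (Lp.tendsto_Lp_iff_tendsto_eLpNorm'' _ (hb.memLp_partialSum f) _ hf).1 ?_
  refine Tendsto.congr (fun S => ?_) (hb.hilbertBasis.hasSum_repr (hf.toLp f))
  induction S using Finset.cons_induction with
  | empty => exact (MemLp.toLp_zero (hb.memLp_partialSum f ∅)).symm
  | cons i S hi ih =>
    rw [Finset.sum_cons, ih, hilbertBasis_apply, hb.hilbertBasis_repr_toLp hf,
      ← MemLp.toLp_const_smul, ← MemLp.toLp_add]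
    refine MemLp.toLp_congr _ _ (Eventually.of_forall fun x => ?_)
    simp only [partialSum, Pi.add_apply, Pi.smul_apply, smul_eq_mul, Finset.sum_cons]

theorem exists_seq_tendsto_ae [Countable ι] (hb : IsCompleteONS μ b) {f : X → ℂ}
    (hf : MemLp f 2 μ) : ∃ S : ℕ → Finset ι, Tendsto S atTop atTop ∧
      ∀ᵐ x ∂μ, Tendsto (fun n => partialSum μ b f (S n) x) atTop (𝓝 (f x)) :=
  (tendstoInMeasure_of_tendsto_eLpNorm two_ne_zero
    (fun S => (hb.memLp_partialSum f S).aestronglyMeasurable) hf.aestronglyMeasurable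
    (hb.tendsto_eLpNorm_partialSum_sub hf)).exists_seq_tendsto_ae'

theorem of_hilbertBasis (B : HilbertBasis ι ℂ (Lp ℂ 2 μ)) (hB : ∀ i, (B i : X → ℂ) =ᵐ[μ] b i) :
    IsCompleteONS μ b := by
  classical
  have hmem : ∀ i, MemLp (b i) 2 μ := fun i => (memLp_congr_ae (hB i)).1 (Lp.memLp (B i))
  have hB' : ∀ i, (hmem i).toLp (b i) = B i := fun i => by
    rw [← Lp.toLp_coeFn (B i) (Lp.memLp (B i))]
    exact MemLp.toLp_congr _ _ (hB i).symm
  have hcoef : ∀ i f (hf : MemLp f 2 μ), coef μ b f i = inner ℂ (B i) (hf.toLp f) :=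
    fun i f hf => by rw [← hB', inner_toLp_eq_integral, coef]
  have hite := orthonormal_iff_ite.1 B.orthonormal
  refine ⟨hmem, fun i => ?_, fun i j hij => ?_, fun f hf h => ?_⟩
  · rw [hcoef i _ (hmem i), hB', hite, if_pos rfl]
  · rw [hcoef i _ (hmem j), hB', hite, if_neg hij]
  · have hrepr : B.repr (hf.toLp f) = 0 := by
      ext i
      rw [HilbertBasis.repr_apply_apply, ← hcoef, h i]
      rfl
    exact hf.coeFn_toLp.symm.trans
      ((Lp.eq_zero_iff_ae_eq_zero).1 (B.repr.map_eq_zero_iff.1 hrepr))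

theorem comp_measurePreserving (hc : IsCompleteONS ν c) (e : X ≃ᵐ Y)
    (he : MeasurePreserving e μ ν) : IsCompleteONS μ (fun i x => c i (e x)) := by
  have hcoef : ∀ (f : Y → ℂ) i, coef μ (fun i x => c i (e x)) (fun x => f (e x)) i
      = coef ν c f i := fun f i =>
    he.integral_comp e.measurableEmbedding (fun y => conj (c i y) * f y)
  refine ⟨fun i => (hc.memLp i).comp_measurePreserving he, fun i => ?_, fun i j hij => ?_,
    fun f hf h => ?_⟩
  · rw [hcoef, hc.coef_self]
  · rw [hcoef, hc.coef_ne i j hij]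
  · have hg : MemLp (fun y => f (e.symm y)) 2 ν := hf.comp_measurePreserving (he.symm e)
    have hzero := hc.complete _ hg fun i => by
      rw [← hcoef]
      simpa using h i
    filter_upwards [he.quasiMeasurePreserving.ae hzero] with x hx
    simpa using hx

theorem memLp_tensor (hb : IsCompleteONS μ b) (hc : IsCompleteONS ν c) (i : ι × κ) :
    MemLp (tensor b c i) 2 (μ.prod ν) := by
  refine (memLp_two_iff_integrable_sq_norm ((hb.memLp i.1).aestronglyMeasurable.comp_fst.mul
    (hc.memLp i.2).aestronglyMeasurable.comp_snd)).2 ?_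
  simpa only [Pi.mul_apply, norm_mul, mul_pow] using
    ((hb.memLp i.1).integrable_norm_pow (by norm_num)).mul_prod
      ((hc.memLp i.2).integrable_norm_pow (by norm_num))

/-- The coefficients of the slices are square integrable because Parseval's identity bounds each of
them by the norm of the slice. -/
theorem memLp_coef_slice [SFinite μ] [SFinite ν] {f : X × Y → ℂ} (hb : IsCompleteONS μ b)
    (hf : MemLp f 2 (μ.prod ν)) (i : ι) :
    MemLp (fun y => coef μ b (fun x => f (x, y)) i) 2 ν := by
  have hswap := hf.comp_measurePreserving (Measure.measurePreserving_swap (μ := ν) (ν := μ))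
  have hmeas : AEStronglyMeasurable (fun y => coef μ b (fun x => f (x, y)) i) ν :=
    ((Complex.continuous_conj.comp_aestronglyMeasurable
      (hb.memLp i).aestronglyMeasurable.comp_snd).mul
        hswap.aestronglyMeasurable).integral_prod_right'
  refine (memLp_two_iff_integrable_sq_norm hmeas).2 <|
    (hswap.integrable_norm_pow (by norm_num)).integral_prod_left.mono' (hmeas.norm.pow 2) ?_
  filter_upwards [ae_memLp_slice hf] with y hy
  rw [Real.norm_of_nonneg (by positivity)]
  exact le_hasSum (hb.hasSum_sq hy) i fun j _ => by positivity

theorem coef_coef_slice [SFinite μ] [SFinite ν] {f : X × Y → ℂ} (hb : IsCompleteONS μ b)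
    (hc : IsCompleteONS ν c) (hf : MemLp f 2 (μ.prod ν)) (i : ι) (j : κ) :
    coef ν c (fun y => coef μ b (fun x => f (x, y)) i) j
      = coef (μ.prod ν) (tensor b c) f (i, j) := by
  rw [coef, coef, integral_prod_symm _ (integrable_conj_mul (hb.memLp_tensor hc (i, j)) hf)]
  simp only [coef, tensor, ← integral_const_mul, map_mul]
  congr 1 with y
  congr 1 with x
  ring

theorem reindex (hb : IsCompleteONS μ b) (e : κ ≃ ι) : IsCompleteONS μ fun k => b (e k) :=
  ⟨fun k => hb.memLp _, fun k => hb.coef_self _,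
    fun j k hjk => hb.coef_ne (e j) (e k) (e.injective.ne hjk),
    fun f hf h => hb.complete f hf fun i => by simpa [coef] using h (e.symm i)⟩

theorem prod [SFinite μ] [SFinite ν] [Countable ι]
    (hb : IsCompleteONS μ b) (hc : IsCompleteONS ν c) :
    IsCompleteONS (μ.prod ν) (tensor b c) := by
  refine ⟨hb.memLp_tensor hc, fun i => ?_, fun i j hij => ?_, fun f hf h => ?_⟩
  · rw [coef_tensor_tensor, hb.coef_self, hc.coef_self, mul_one]
  · rw [coef_tensor_tensor]
    by_cases hfst : i.1 = j.1
    · rw [hc.coef_ne i.2 j.2 fun hsnd => hij (Prod.ext hfst hsnd), mul_zero]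
    · rw [hb.coef_ne i.1 j.1 hfst, zero_mul]
  · have hslice : ∀ i, ∀ᵐ y ∂ν, coef μ b (fun x => f (x, y)) i = 0 := fun i =>
      hc.complete _ (hb.memLp_coef_slice hf i) fun j => by rw [hb.coef_coef_slice hc hf, h]
    refine ae_eq_zero_of_slices hf ?_
    filter_upwards [ae_all_iff.2 hslice, ae_memLp_slice hf] with y hy hmem
    exact hb.complete _ hmem hy

end IsCompleteONS

end CompleteSystems

section Hermite

open scoped Nat
open ProbabilityTheory Polynomial

/-! ### Hermite polynomials and the Gaussian measure -/

/-- The standard Gaussian measure on the line. -/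
abbrev gauss : Measure ℝ := gaussianReal 0 1

theorem derivative_hermite_succ (n : ℕ) :
    derivative (hermite (n + 1)) = ((n : ℤ[X]) + 1) * hermite n := by
  induction n with
  | zero => simp
  | succ n ih =>
    rw [hermite_succ (n + 1), derivative_sub, derivative_mul, ih]
    have h : derivative (((n : ℤ[X]) + 1) * hermite n)
        = ((n : ℤ[X]) + 1) * derivative (hermite n) := by
      rw [derivative_mul]
      simp
    rw [h, hermite_succ n]
    simp only [derivative_X]
    push_cast
    ring

theorem memLp_polynomial_gauss (p : ℝ[X]) (q : ℝ≥0∞) (hq : q ≠ ⊤) :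
    MemLp (fun x => p.eval x) q gauss := by
  have hpow : ∀ n : ℕ, MemLp (fun x : ℝ => x ^ n) q gauss := by
    intro n
    have h := (memLp_id_gaussianReal' (μ := 0) (v := 1) (q * n)
      (ENNReal.mul_ne_top hq (ENNReal.natCast_ne_top n)))
    rcases Nat.eq_zero_or_pos n with rfl | hn
    · simpa using memLp_const (1 : ℝ)
    · have h2 := h.norm_rpow_div (n : ℝ≥0∞)
      rw [ENNReal.mul_div_cancel_right (by exact_mod_cast hn.ne') (ENNReal.natCast_ne_top n)] at h2
      refine h2.congr_norm (by fun_prop) (Filter.Eventually.of_forall fun x => ?_)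
      simp
  induction p using Polynomial.induction_on' with
  | add p r hp hr => simp only [eval_add]; exact hp.add hr
  | monomial n a => simpa only [eval_monomial] using (hpow n).const_mul a

theorem integrable_polynomial_gauss (p : ℝ[X]) : Integrable (fun x => p.eval x) gauss :=
  memLp_one_iff_integrable.1 (memLp_polynomial_gauss p 1 (by simp))

theorem hasDerivAt_gaussianPDFReal (x : ℝ) :
    HasDerivAt (gaussianPDFReal 0 1) (-x * gaussianPDFReal 0 1 x) x := by
  have h : HasDerivAt (fun x : ℝ => (√(2 * Real.pi))⁻¹ * Real.exp (-x ^ 2 / 2))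
      ((√(2 * Real.pi))⁻¹ * (Real.exp (-x ^ 2 / 2) * (-x))) x := by
    refine HasDerivAt.const_mul _ (HasDerivAt.exp ?_)
    convert! ((hasDerivAt_pow 2 x).neg.div_const 2) using 1
    norm_num
    ring
  convert! h using 1
  · ext y; simp [gaussianPDFReal]
  · simp [gaussianPDFReal]; ring

theorem integrable_gaussianPDFReal_mul_polynomial (p : ℝ[X]) :
    Integrable (fun x => gaussianPDFReal 0 1 x * p.eval x) := by
  have h := integrable_polynomial_gauss p
  rw [gauss, gaussianReal_of_var_ne_zero _ one_ne_zero,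
    integrable_withDensity_iff_integrable_smul' (measurable_gaussianPDF _ _)
      (Filter.Eventually.of_forall fun _ => gaussianPDF_lt_top)] at h
  simpa only [toReal_gaussianPDF, smul_eq_mul] using h

theorem integral_gauss_derivative (p : ℝ[X]) :
    ∫ x, (derivative p).eval x ∂gauss = ∫ x, (X * p).eval x ∂gauss := by
  have h := integral_eq_zero_of_hasDerivAt_of_integrable
    (f := fun x => gaussianPDFReal 0 1 x * p.eval x)
    (f' := fun x => gaussianPDFReal 0 1 x * (derivative p - X * p).eval x)
    (fun x => by
      convert! (hasDerivAt_gaussianPDFReal x).mul (p.hasDerivAt x) using 1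
      simp
      ring)
    (integrable_gaussianPDFReal_mul_polynomial _) (integrable_gaussianPDFReal_mul_polynomial _)
  have h2 : ∫ x, (derivative p - X * p).eval x ∂gauss = 0 := by
    rw [integral_gaussianReal_eq_integral_smul one_ne_zero]
    simpa only [smul_eq_mul] using h
  simp only [eval_sub] at h2
  rw [integral_sub (integrable_polynomial_gauss _) (integrable_polynomial_gauss _)] at h2
  linarith

/-- The Hermite polynomial with real coefficients. -/
def hermiteR (n : ℕ) : ℝ[X] := (hermite n).map (Int.castRingHom ℝ)

theorem hermiteR_zero : hermiteR 0 = 1 := by simp [hermiteR]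

theorem hermiteR_succ (n : ℕ) :
    hermiteR (n + 1) = X * hermiteR n - derivative (hermiteR n) := by
  simp [hermiteR, hermite_succ, derivative_map]

theorem derivative_hermiteR_succ (n : ℕ) :
    derivative (hermiteR (n + 1)) = ((n : ℝ[X]) + 1) * hermiteR n := by
  rw [hermiteR, derivative_map, derivative_hermite_succ]
  simp [hermiteR]

theorem integral_hermiteR_succ_mul (n : ℕ) (p : ℝ[X]) :
    ∫ x, (hermiteR (n + 1) * p).eval x ∂gauss = ∫ x, (hermiteR n * derivative p).eval x ∂gauss := by
  have h := integral_gauss_derivative (hermiteR n * p)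
  have h1 : hermiteR (n + 1) * p
      = X * (hermiteR n * p) - derivative (hermiteR n * p) + hermiteR n * derivative p := by
    rw [hermiteR_succ, derivative_mul]
    ring
  rw [h1]
  simp only [eval_add]
  rw [integral_add (integrable_polynomial_gauss _) (integrable_polynomial_gauss _)]
  simp only [eval_sub]
  rw [integral_sub (integrable_polynomial_gauss _)
    (integrable_polynomial_gauss _), h, sub_self, zero_add]

theorem integral_hermiteR_mul_hermiteR (m n : ℕ) :
    ∫ x, (hermiteR m * hermiteR n).eval x ∂gauss = if m = n then (n ! : ℝ) else 0 := by
  induction m generalizing n with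
  | zero =>
    cases n with
    | zero => simp [hermiteR_zero]
    | succ n =>
      rw [mul_comm, integral_hermiteR_succ_mul, hermiteR_zero]
      simp
  | succ m ih =>
    cases n with
    | zero =>
      rw [integral_hermiteR_succ_mul, hermiteR_zero]
      simp
    | succ n =>
      rw [integral_hermiteR_succ_mul, derivative_hermiteR_succ]
      have h : hermiteR m * (((n : ℝ[X]) + 1) * hermiteR n)
          = C ((n : ℝ) + 1) * (hermiteR m * hermiteR n) := by
        simp only [map_add, map_natCast, map_one]
        ring
      simp only [h, eval_mul (p := C _), eval_C]
      rw [integral_const_mul, ih]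
      by_cases hmn : m = n
      · simp [hmn, Nat.factorial_succ]
      · simp [hmn]

/-- The normalized Hermite functions. -/
def herm (n : ℕ) (x : ℝ) : ℝ := (√(n ! : ℝ))⁻¹ * (hermiteR n).eval x

theorem sqrt_factorial_succ (n : ℕ) : √((n + 1)! : ℝ) = √(n + 1) * √(n ! : ℝ) := by
  rw [Nat.factorial_succ]
  push_cast
  rw [Real.sqrt_mul (by positivity)]

theorem sqrt_factorial_pos (n : ℕ) : 0 < √(n ! : ℝ) :=
  Real.sqrt_pos.2 (by exact_mod_cast n.factorial_pos)

theorem sqrt_succ_mul_herm_succ (n : ℕ) (x : ℝ) :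
    √(n + 1) * herm (n + 1) x = (√(n ! : ℝ))⁻¹ * (hermiteR (n + 1)).eval x := by
  have hn : √((n : ℝ) + 1) ≠ 0 := by positivity
  rw [herm, sqrt_factorial_succ, mul_inv, ← mul_assoc, ← mul_assoc, mul_inv_cancel₀ hn, one_mul]

theorem sqrt_mul_herm_pred (n : ℕ) (x : ℝ) :
    √n * herm (n - 1) x = (√(n ! : ℝ))⁻¹ * (derivative (hermiteR n)).eval x := by
  cases n with
  | zero => simp [hermiteR_zero]
  | succ n =>
    have hsq : √((n : ℝ) + 1) * √((n : ℝ) + 1) = n + 1 := Real.mul_self_sqrt (by positivity)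
    have hn : √((n : ℝ) + 1) ≠ 0 := by positivity
    rw [derivative_hermiteR_succ, sqrt_factorial_succ, herm, Nat.add_sub_cancel]
    simp only [eval_mul, eval_add, eval_natCast, eval_one, Nat.cast_add, Nat.cast_one]
    field_simp
    rw [sq, hsq]

theorem hasDerivAt_herm (n : ℕ) (x : ℝ) : HasDerivAt (herm n) (√n * herm (n - 1) x) x := by
  rw [sqrt_mul_herm_pred]
  exact ((hermiteR n).hasDerivAt x).const_mul _

theorem mul_herm (n : ℕ) (x : ℝ) :
    x * herm n x = √(n + 1) * herm (n + 1) x + √n * herm (n - 1) x := by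
  rw [sqrt_mul_herm_pred, sqrt_succ_mul_herm_succ, hermiteR_succ, herm, eval_sub, eval_mul, eval_X]
  ring

theorem hasDerivAt_herm_mul_gaussianPDFReal (n : ℕ) (x : ℝ) :
    HasDerivAt (fun x => herm n x * gaussianPDFReal 0 1 x)
      (-√(n + 1) * herm (n + 1) x * gaussianPDFReal 0 1 x) x := by
  convert! (hasDerivAt_herm n x).mul (hasDerivAt_gaussianPDFReal x) using 1
  linear_combination gaussianPDFReal 0 1 x * mul_herm n x

theorem herm_zero (x : ℝ) : herm 0 x = 1 := by simp [herm, hermiteR_zero]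

theorem contDiff_herm (n : ℕ) : ContDiff ℝ ∞ (herm n) :=
  contDiff_const.mul (by
    simpa only [aeval_def, eval₂_eq_eval_map, Algebra.algebraMap_self, Polynomial.map_id]
      using Polynomial.contDiff_aeval (𝕜 := ℝ) (hermiteR n) ∞)

theorem memLp_herm (n : ℕ) (q : ℝ≥0∞) (hq : q ≠ ⊤) : MemLp (herm n) q gauss :=
  (memLp_polynomial_gauss _ q hq).const_mul _

theorem integrable_exp_mul_I_mul {P : Measure ℝ} {f : ℝ → ℝ} (hf : Integrable f P) (ξ : ℝ) :
    Integrable (fun x : ℝ => Complex.exp (ξ * x * Complex.I) * (f x : ℂ)) P := by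
  refine hf.ofReal.bdd_mul (c := 1) (by fun_prop) (Eventually.of_forall fun x => ?_)
  rw [← Complex.ofReal_mul, Complex.norm_exp_ofReal_mul_I]

theorem charFun_withDensity_ofReal {P : Measure ℝ} {f : ℝ → ℝ} (hf : Integrable f P) (ξ : ℝ) :
    charFun (P.withDensity fun x => ENNReal.ofReal (f x)) ξ
      = ∫ x, Complex.exp (ξ * x * Complex.I) * ((max (f x) 0 : ℝ) : ℂ) ∂P := by
  rw [charFun_apply_real, integral_withDensity_eq_integral_toReal_smul₀
    hf.aestronglyMeasurable.aemeasurable.ennreal_ofReal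
    (Eventually.of_forall fun _ => ENNReal.ofReal_lt_top)]
  simp only [ENNReal.toReal_ofReal', Complex.real_smul, mul_comm]

/-- The positive and negative parts of `g` are the densities of two finite measures with the same
characteristic function. -/
theorem eq_zero_of_integral_exp_eq_zero {P : Measure ℝ} {g : ℝ → ℝ}
    (hg : Integrable g P)
    (h : ∀ ξ : ℝ, ∫ x, Complex.exp (ξ * x * Complex.I) * (g x : ℂ) ∂P = 0) : g =ᵐ[P] 0 := by
  have hn : Integrable (fun x => -g x) P := hg.neg
  have := isFiniteMeasure_withDensity_ofReal hg.2
  have := isFiniteMeasure_withDensity_ofReal hn.2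
  have heq : P.withDensity (fun x => ENNReal.ofReal (g x))
      = P.withDensity fun x => ENNReal.ofReal (-g x) := by
    refine Measure.ext_of_charFun (funext fun ξ => ?_)
    rw [charFun_withDensity_ofReal hg, charFun_withDensity_ofReal hn, ← sub_eq_zero,
      ← integral_sub (integrable_exp_mul_I_mul hg.pos_part ξ)
        (integrable_exp_mul_I_mul hn.pos_part ξ), ← h ξ]
    congr 1 with x
    rw [← mul_sub, ← Complex.ofReal_sub, max_zero_sub_max_neg_zero_eq_self]
  have hae := (withDensity_eq_iff hg.aestronglyMeasurable.aemeasurable.ennreal_ofReal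
    hn.aestronglyMeasurable.aemeasurable.ennreal_ofReal hg.lintegral_lt_top.ne).1 heq
  filter_upwards [hae] with x hx
  have hmax := congrArg ENNReal.toReal hx
  rw [ENNReal.toReal_ofReal', ENNReal.toReal_ofReal'] at hmax
  rw [← max_zero_sub_max_neg_zero_eq_self (g x), hmax, sub_self, Pi.zero_apply]

theorem memLp_exp_abs_gauss (ξ : ℝ) : MemLp (fun x : ℝ => Real.exp |ξ * x|) 2 gauss := by
  refine (memLp_two_iff_integrable_sq (by fun_prop)).2 ?_
  refine ((integrable_exp_mul_gaussianReal (μ := 0) (v := 1) (2 * ξ)).add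
    (integrable_exp_mul_gaussianReal (μ := 0) (v := 1) (-(2 * ξ)))).mono' (by fun_prop)
    (Eventually.of_forall fun x => ?_)
  rw [Real.norm_of_nonneg (by positivity), ← Real.exp_nat_mul, Pi.add_apply,
    show ((2 : ℕ) : ℝ) * |ξ * x| = |2 * ξ * x| by rw [mul_assoc, abs_mul 2]; norm_num,
    neg_mul]
  exact Real.exp_abs_le _

/-- The moments determine the Fourier transform of `f` times the Gaussian, since the exponential
series can be integrated term by term. -/
theorem eq_zero_of_integral_pow_eq_zero {f : ℝ → ℝ} (hf : MemLp f 2 gauss)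
    (h : ∀ n : ℕ, ∫ x, x ^ n * f x ∂gauss = 0) : f =ᵐ[gauss] 0 := by
  refine eq_zero_of_integral_exp_eq_zero (hf.integrable (by norm_num)) fun ξ => ?_
  have hbound : Integrable (fun x => ∑' n : ℕ, |ξ * x| ^ n / n ! * |f x|) gauss := by
    have hexp := memLp_exp_abs_gauss ξ
    simp only [Real.exp_eq_exp_ℝ, NormedSpace.exp_eq_tsum_div] at hexp
    simp only [tsum_mul_right]
    exact MemLp.integrable_mul (p := 2) (q := 2) hexp hf.norm
  have hsum := hasSum_integral_of_dominated_convergence (μ := gauss)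
    (F := fun (n : ℕ) (x : ℝ) => ((ξ * x * Complex.I) ^ n / (n ! : ℂ)) * f x)
    (f := fun x : ℝ => Complex.exp (ξ * x * Complex.I) * f x)
    (fun n x => |ξ * x| ^ n / n ! * |f x|)
    (fun n => Continuous.aestronglyMeasurable (by fun_prop) |>.mul hf.ofReal.aestronglyMeasurable)
    (fun n => Eventually.of_forall fun x => by
      simp only [norm_mul, norm_div, norm_pow, Complex.norm_I, mul_one, Complex.norm_natCast,
        Complex.norm_real, abs_mul, Real.norm_eq_abs, le_refl])
    (Eventually.of_forall fun x => (Real.summable_pow_div_factorial _).mul_right _)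
    hbound
    (Eventually.of_forall fun x => by
      have hexp := NormedSpace.expSeries_div_hasSum_exp (ξ * x * Complex.I : ℂ)
      rw [← Complex.exp_eq_exp_ℂ] at hexp
      exact hexp.mul_right _)
  refine hsum.unique ?_
  convert! hasSum_zero with n
  have hterm : ∀ x : ℝ, ((ξ * x * Complex.I) ^ n / (n ! : ℂ)) * f x
      = ((ξ * Complex.I) ^ n / (n ! : ℂ)) * ((x ^ n * f x : ℝ) : ℂ) := fun x => by
    push_cast; ring
  simp only [hterm]
  rw [integral_const_mul, integral_complex_ofReal, h, Complex.ofReal_zero, mul_zero]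

theorem integrable_polynomial_mul {f : ℝ → ℂ} (hf : MemLp f 2 gauss) (p : ℝ[X]) :
    Integrable (fun x => ((p.eval x : ℝ) : ℂ) * f x) gauss :=
  MemLp.integrable_mul (p := 2) (q := 2) (memLp_polynomial_gauss p 2 (by simp)).ofReal hf

theorem coef_herm (f : ℝ → ℂ) (n : ℕ) :
    coef gauss (fun n x => (herm n x : ℂ)) f n
      = ((√(n ! : ℝ))⁻¹ : ℝ) * ∫ x, (((hermiteR n).eval x : ℝ) : ℂ) * f x ∂gauss := by
  rw [coef, ← integral_const_mul]
  simp only [herm, map_mul, Complex.ofReal_mul, Complex.conj_ofReal, mul_assoc]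

theorem coef_herm_herm (m n : ℕ) :
    coef gauss (fun n x => (herm n x : ℂ)) (fun x => (herm n x : ℂ)) m
      = if m = n then 1 else 0 := by
  have hmul : ∀ x, (((hermiteR m).eval x : ℝ) : ℂ) * herm n x
      = (((√(n ! : ℝ))⁻¹ * (hermiteR m * hermiteR n).eval x : ℝ) : ℂ) := fun x => by
    rw [herm, eval_mul]
    push_cast
    ring
  simp only [coef_herm, hmul]
  rw [integral_complex_ofReal, integral_const_mul, integral_hermiteR_mul_hermiteR]
  split_ifs with hmn
  · have hfact := sqrt_factorial_pos n
    subst hmn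
    norm_cast
    rw [← mul_assoc, ← mul_inv, Real.mul_self_sqrt (by positivity), inv_mul_cancel₀ (by positivity)]
  · simp

/-- By induction on `k`, using `x Heₙ₊₁ = Heₙ₊₂ + (n + 1) Heₙ`. -/
theorem integral_pow_mul_hermiteR_mul_eq_zero {f : ℝ → ℂ} (hf : MemLp f 2 gauss)
    (h : ∀ n, ∫ x, (((hermiteR n).eval x : ℝ) : ℂ) * f x ∂gauss = 0) (k n : ℕ) :
    ∫ x, (((X ^ k * hermiteR n).eval x : ℝ) : ℂ) * f x ∂gauss = 0 := by
  induction k generalizing n with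
  | zero => simpa only [pow_zero, one_mul] using h n
  | succ k ih =>
    cases n with
    | zero =>
      have hX : X ^ (k + 1) * hermiteR 0 = X ^ k * hermiteR 1 := by
        simp [hermiteR_succ, hermiteR_zero, pow_succ]
      rw [hX]
      exact ih 1
    | succ n =>
      have hX : ∀ x, (((X ^ (k + 1) * hermiteR (n + 1)).eval x : ℝ) : ℂ) * f x
          = (((X ^ k * hermiteR (n + 2)).eval x : ℝ) : ℂ) * f x
            + (n + 1) * ((((X ^ k * hermiteR n).eval x : ℝ) : ℂ) * f x) := fun x => by
        rw [hermiteR_succ (n + 1), derivative_hermiteR_succ]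
        simp only [eval_mul, eval_sub, eval_add, eval_pow, eval_X, eval_natCast, eval_one]
        push_cast
        ring
      simp only [hX]
      rw [integral_add (integrable_polynomial_mul hf _)
        ((integrable_polynomial_mul hf _).const_mul _), integral_const_mul, ih, ih, mul_zero,
        add_zero]

theorem isCompleteONS_herm : IsCompleteONS gauss (fun n x => (herm n x : ℂ)) := by
  refine ⟨fun n => (memLp_herm n 2 (by simp)).ofReal, fun n => ?_, fun m n hmn => ?_,
    fun f hf h => ?_⟩
  · rw [coef_herm_herm, if_pos rfl]
  · rw [coef_herm_herm, if_neg hmn]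
  have hherm : ∀ n, ∫ x, (((hermiteR n).eval x : ℝ) : ℂ) * f x ∂gauss = 0 := fun n => by
    have hn := h n
    rw [coef_herm] at hn
    refine (mul_eq_zero.1 hn).resolve_left ?_
    exact_mod_cast (inv_pos.2 (sqrt_factorial_pos n)).ne'
  have hpow : ∀ n : ℕ, ∫ x, ((x ^ n : ℝ) : ℂ) * f x ∂gauss = 0 := fun n => by
    simpa [hermiteR_zero] using integral_pow_mul_hermiteR_mul_eq_zero hf hherm n 0
  have hint : ∀ n : ℕ, Integrable (fun x => ((x ^ n : ℝ) : ℂ) * f x) gauss := fun n => by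
    simpa using integrable_polynomial_mul hf (X ^ n)
  have hre := eq_zero_of_integral_pow_eq_zero hf.re fun n => by
    simpa only [RCLike.re_eq_complex_re, Complex.re_ofReal_mul, Complex.zero_re] using
      (integral_re (hint n)).trans (congrArg RCLike.re (hpow n))
  have him := eq_zero_of_integral_pow_eq_zero hf.im fun n => by
    simpa only [RCLike.im_eq_complex_im, Complex.im_ofReal_mul, Complex.zero_im] using
      (integral_im (hint n)).trans (congrArg RCLike.im (hpow n))
  filter_upwards [hre, him] with x h1 h2
  exact Complex.ext h1 h2

end Hermite

section PhaseBasis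

open ProbabilityTheory

/-! ### The Fourier-Hermite basis of phase space -/

theorem volume_torus_eq :
    (volume : Measure Torus) = Measure.pi fun _ => AddCircle.haarAddCircle := by
  rw [volume_pi]
  congr 1
  ext1 i
  rw [AddCircle.volume_eq_smul_haarAddCircle, ENNReal.ofReal_one, one_smul]

instance isProbabilityMeasure_torus : IsProbabilityMeasure (volume : Measure Torus) := by
  rw [volume_torus_eq]
  infer_instance

theorem isCompleteONS_mFourier :
    IsCompleteONS (volume : Measure Torus) (fun k x => UnitAddTorus.mFourier k x) := by
  rw [volume_torus_eq]
  refine IsCompleteONS.of_hilbertBasis (UnitAddTorus.mFourierBasis (d := Fin 2)) fun k => ?_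
  rw [UnitAddTorus.coe_mFourierBasis]
  exact UnitAddTorus.coeFn_mFourierLp 2 k

theorem norm_mFourier_apply (k : Fin 2 → ℤ) (x : Torus) : ‖UnitAddTorus.mFourier k x‖ = 1 := by
  simp [UnitAddTorus.mFourier, Circle.norm_coe]

theorem mFourier_proj (k : Fin 2 → ℤ) (y : Vel) :
    UnitAddTorus.mFourier k (proj y)
      = Complex.exp (2 * Real.pi * Complex.I * ∑ i, (k i : ℂ) * (y i : ℂ)) := by
  simp only [UnitAddTorus.mFourier, proj, ContinuousMap.coe_mk, fourier_coe_apply,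
    Complex.ofReal_one, div_one]
  rw [← Complex.exp_sum, Finset.mul_sum]
  simp only [mul_assoc]

theorem mFourier_add_single (k : Fin 2 → ℤ) (x : Torus) (i : Fin 2) (s : ℝ) :
    UnitAddTorus.mFourier k (x + Pi.single i (s : UnitAddCircle))
      = UnitAddTorus.mFourier k x * Complex.exp (2 * Real.pi * Complex.I * k i * s) := by
  have h : ∀ j, fourier (k j) (x j + (Pi.single i (s : UnitAddCircle) : Torus) j)
      = fourier (k j) (x j) *
        if j = i then Complex.exp (2 * Real.pi * Complex.I * k i * s) else 1 := by
    intro j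
    by_cases hj : j = i
    · subst hj
      simp only [Pi.single_eq_same, if_true]
      have h2 := fourier_coe_apply (T := (1 : ℝ)) (n := k j) (x := s)
      simp only [Complex.ofReal_one, div_one] at h2
      rw [← h2, fourier_apply, fourier_apply, fourier_apply, smul_add, AddCircle.toCircle_add]
      simp
    · simp [hj]
  simp only [UnitAddTorus.mFourier, ContinuousMap.coe_mk, Pi.add_apply, h,
    Finset.prod_mul_distrib, Finset.prod_ite_eq', Finset.mem_univ, if_true]

/-- The reference measure `dx M(v) dv` on phase space. -/
def nu : Measure Phase :=
  (volume : Measure Phase).withDensity fun z => ENNReal.ofReal (maxwellian z.2)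

/-- Cartesian coordinates on the velocity space. -/
def velEquiv : Vel ≃ᵐ ℝ × ℝ :=
  (MeasurableEquiv.toLp 2 (Fin 2 → ℝ)).symm.trans MeasurableEquiv.finTwoArrow

theorem velEquiv_apply (v : Vel) : velEquiv v = (v 0, v 1) := rfl

theorem measurePreserving_velEquiv : MeasurePreserving velEquiv volume volume :=
  (volume_preserving_finTwoArrow ℝ).comp
    (EuclideanSpace.volume_preserving_symm_measurableEquiv_toLp (Fin 2))

theorem maxwellian_eq_prod (v : Vel) : maxwellian v = ∏ i, gaussianPDFReal 0 1 (v i) := by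
  have hsqrt : √(2 * Real.pi) * √(2 * Real.pi) = 2 * Real.pi := Real.mul_self_sqrt (by positivity)
  simp only [maxwellian, gaussianPDFReal, EuclideanSpace.norm_sq_eq, Fin.prod_univ_two,
    Fin.sum_univ_two, NNReal.coe_one, mul_one, sub_zero, Real.norm_eq_abs, sq_abs]
  rw [mul_mul_mul_comm, ← Real.exp_add, ← mul_inv, hsqrt]
  congr 2
  ring

theorem maxwellian_pos (v : Vel) : 0 < maxwellian v := by
  unfold maxwellian
  positivity

theorem contDiff_maxwellian : ContDiff ℝ ∞ maxwellian := by
  unfold maxwellian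
  exact contDiff_const.mul (((contDiff_norm_sq ℝ).neg.div_const 2).exp)

theorem measurable_maxwellian : Measurable maxwellian :=
  contDiff_maxwellian.continuous.measurable

/-- The Maxwellian probability measure `M(v) dv`. -/
def gauss2 : Measure Vel := volume.withDensity fun v => ENNReal.ofReal (maxwellian v)

theorem measurePreserving_velEquiv_gauss :
    MeasurePreserving velEquiv gauss2 (gauss.prod gauss) := by
  refine ⟨velEquiv.measurable, ?_⟩
  have h : gauss.prod gauss = (volume : Measure (ℝ × ℝ)).withDensity
      fun p => ENNReal.ofReal (gaussianPDFReal 0 1 p.1 * gaussianPDFReal 0 1 p.2) := by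
    rw [gauss, gaussianReal_of_var_ne_zero _ one_ne_zero,
      prod_withDensity (measurable_gaussianPDF _ _) (measurable_gaussianPDF _ _)]
    congr 1
    ext p
    rw [ENNReal.ofReal_mul (gaussianPDFReal_nonneg _ _ _)]
    rfl
  have hm : Measurable fun p : ℝ × ℝ =>
      ENNReal.ofReal (gaussianPDFReal 0 1 p.1 * gaussianPDFReal 0 1 p.2) :=
    (((measurable_gaussianPDFReal 0 1).comp measurable_fst).mul
      ((measurable_gaussianPDFReal 0 1).comp measurable_snd)).ennreal_ofReal
  ext s hs
  rw [Measure.map_apply velEquiv.measurable hs, h, withDensity_apply _ hs, gauss2,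
    withDensity_apply _ (velEquiv.measurable hs),
    ← measurePreserving_velEquiv.setLIntegral_comp_preimage hs hm]
  simp only [maxwellian_eq_prod, velEquiv_apply, Fin.prod_univ_two]

instance isProbabilityMeasure_gauss2 : IsProbabilityMeasure gauss2 := by
  constructor
  have h := measurePreserving_velEquiv_gauss.measure_preimage_equiv univ
  simpa using h

theorem nu_eq_prod : nu = (volume : Measure Torus).prod gauss2 := by
  rw [gauss2, prod_withDensity_right measurable_maxwellian.ennreal_ofReal]
  rfl

instance isProbabilityMeasure_nu : IsProbabilityMeasure nu := by
  rw [nu_eq_prod]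
  infer_instance

/-- Products of normalized Hermite functions. -/
def herm2 (a : Fin 2 → ℕ) (v : Vel) : ℝ := ∏ i, herm (a i) (v i)

/-- The Fourier-Hermite basis of `L²(dx M(v) dv)`. -/
def phaseBasis (i : (Fin 2 → ℤ) × (Fin 2 → ℕ)) (z : Phase) : ℂ :=
  UnitAddTorus.mFourier i.1 z.1 * (herm2 i.2 z.2 : ℂ)

theorem isCompleteONS_herm2 : IsCompleteONS gauss2 fun a v => (herm2 a v : ℂ) := by
  have h := ((isCompleteONS_herm.prod isCompleteONS_herm).comp_measurePreserving velEquiv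
    measurePreserving_velEquiv_gauss).reindex (finTwoArrowEquiv ℕ)
  convert h using 3 with a v
  simp [herm2, tensor, velEquiv_apply, Fin.prod_univ_two]

theorem isCompleteONS_phaseBasis : IsCompleteONS nu phaseBasis := by
  rw [nu_eq_prod]
  exact isCompleteONS_mFourier.prod isCompleteONS_herm2

theorem contDiff_herm2 (a : Fin 2 → ℕ) : ContDiff ℝ ∞ (herm2 a) :=
  contDiff_prod fun i _ => (contDiff_herm (a i)).comp (contDiff_euclidean.1 contDiff_id i)

/-! ### Ladder relations -/

theorem prod_eq_mul_prod_erase {ι R : Type*} [Fintype ι] [DecidableEq ι] [CommMonoid R]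
    {F G : ι → R} {i : ι} (h : ∀ j ≠ i, G j = F j) :
    ∏ j, G j = G i * ∏ j ∈ Finset.univ.erase i, F j := by
  rw [← Finset.mul_prod_erase _ _ (Finset.mem_univ i)]
  exact congrArg (G i * ·) (Finset.prod_congr rfl fun j hj => h j (Finset.ne_of_mem_erase hj))

theorem mul_herm2 (i : Fin 2) (a : Fin 2 → ℕ) (v : Vel) :
    v i * herm2 a v = √(a i + 1) * herm2 (a + Pi.single i 1) v
      + √(a i) * herm2 (a - Pi.single i 1) v := by
  have hprod : ∀ b : Fin 2 → ℕ, (∀ j ≠ i, b j = a j) →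
      herm2 b v = herm (b i) (v i) * ∏ j ∈ Finset.univ.erase i, herm (a j) (v j) := fun b hb =>
    prod_eq_mul_prod_erase fun j hj => by rw [hb j hj]
  rw [hprod a fun _ _ => rfl, hprod (a + Pi.single i 1) fun j hj => by simp [hj],
    hprod (a - Pi.single i 1) fun j hj => by simp [hj]]
  simp only [Pi.add_apply, Pi.sub_apply, Pi.single_eq_same]
  linear_combination (∏ j ∈ Finset.univ.erase i, herm (a j) (v j)) * mul_herm (a i) (v i)

theorem hasDerivAt_herm2_mul_maxwellian (i : Fin 2) (a : Fin 2 → ℕ) (v : Vel) :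
    HasDerivAt (fun s : ℝ => herm2 a (v + s • EuclideanSpace.single i (1 : ℝ))
        * maxwellian (v + s • EuclideanSpace.single i (1 : ℝ)))
      (-√(a i + 1) * herm2 (a + Pi.single i 1) v * maxwellian v) 0 := by
  have hprod : ∀ (b : Fin 2 → ℕ) (w : Vel), (∀ j ≠ i, b j = a j) → (∀ j ≠ i, w j = v j) →
      herm2 b w * maxwellian w = herm (b i) (w i) * gaussianPDFReal 0 1 (w i)
        * ∏ j ∈ Finset.univ.erase i, herm (a j) (v j) * gaussianPDFReal 0 1 (v j) := by
    intro b w hb hw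
    rw [herm2, maxwellian_eq_prod, ← Finset.prod_mul_distrib]
    exact prod_eq_mul_prod_erase fun j hj => by rw [hb j hj, hw j hj]
  have hline := (hasDerivAt_herm_mul_gaussianPDFReal (a i) (v i + 0)).comp_const_add (v i) 0
  rw [add_zero] at hline
  convert! hline.mul_const
    (∏ j ∈ Finset.univ.erase i, herm (a j) (v j) * gaussianPDFReal 0 1 (v j)) using 1
  · ext s
    rw [hprod a _ (fun _ _ => rfl) fun j hj => by simp [hj]]
    simp
  · rw [mul_assoc, hprod (a + Pi.single i 1) v (fun j hj => by simp [hj]) fun _ _ => rfl]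
    simp only [Pi.add_apply, Pi.single_eq_same]
    ring

end PhaseBasis

/-! ### Cutoff functions in velocity -/

/-- A smooth bump function on the velocity space. -/
def velBump : ContDiffBump (0 : Vel) := ⟨1, 2, one_pos, one_lt_two⟩

/-- Smooth cutoffs at velocities of size `n + 1`. -/
def cutoff (n : ℕ) (v : Vel) : ℝ := velBump (((n : ℝ) + 1)⁻¹ • v)

theorem contDiff_cutoff (n : ℕ) : ContDiff ℝ ∞ (cutoff n) :=
  velBump.contDiff.comp (contDiff_const_smul _)

theorem norm_cutoff_le_one (n : ℕ) (v : Vel) : ‖cutoff n v‖ ≤ 1 := by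
  rw [cutoff, Real.norm_of_nonneg velBump.nonneg]
  exact velBump.le_one

theorem cutoff_eq_zero {n : ℕ} {v : Vel} (hv : 2 * ((n : ℝ) + 1) < ‖v‖) : cutoff n v = 0 := by
  refine velBump.zero_of_le_dist ?_
  rw [dist_zero_right, norm_smul, norm_inv, Real.norm_of_nonneg (by positivity)]
  change (2 : ℝ) ≤ _
  rw [inv_mul_eq_div, le_div_iff₀ (by positivity)]
  exact hv.le

theorem tendsto_inv_natCast_add_one : Tendsto (fun n : ℕ => ((n : ℝ) + 1)⁻¹) atTop (𝓝 0) := by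
  simpa only [one_div] using tendsto_one_div_add_atTop_nhds_zero_nat (𝕜 := ℝ)

theorem tendsto_cutoff (v : Vel) : Tendsto (fun n => cutoff n v) atTop (𝓝 1) := by
  have hscale : Tendsto (fun n : ℕ => (((n : ℝ) + 1)⁻¹ • v)) atTop (𝓝 0) := by
    simpa only [zero_smul] using tendsto_inv_natCast_add_one.smul_const v
  have hone : velBump (0 : Vel) = 1 :=
    velBump.one_of_mem_closedBall (Metric.mem_closedBall_self zero_le_one)
  rw [← hone]
  exact (velBump.continuous.tendsto 0).comp hscale

theorem hasDerivAt_cutoff (n : ℕ) (v e : Vel) :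
    HasDerivAt (fun s : ℝ => cutoff n (v + s • e)) (fderiv ℝ (cutoff n) v e) 0 :=
  (((contDiff_cutoff n).differentiable (by simp)) v).hasFDerivAt.hasLineDerivAt e

theorem continuous_fderiv_cutoff (n : ℕ) : Continuous (fderiv ℝ (cutoff n)) :=
  (contDiff_cutoff n).continuous_fderiv (by simp)

theorem exists_norm_fderiv_cutoff_le :
    ∃ C : ℝ, ∀ n v, ‖fderiv ℝ (cutoff n) v‖ ≤ ((n : ℝ) + 1)⁻¹ * C := by
  obtain ⟨C, hC⟩ :=
    ((velBump.contDiff (n := 1)).continuous_fderiv one_ne_zero).bounded_above_of_compact_support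
      (velBump.hasCompactSupport.fderiv (𝕜 := ℝ))
  refine ⟨C, fun n v => ?_⟩
  unfold cutoff
  rw [fderiv_comp_smul, norm_smul, Real.norm_of_nonneg (by positivity)]
  gcongr
  exact hC _

theorem integrable_cutoff_mul {F : Phase → ℝ} (hF : Integrable F) (n : ℕ) :
    Integrable fun z => cutoff n z.2 * F z :=
  hF.bdd_mul ((contDiff_cutoff n).continuous.comp continuous_snd).aestronglyMeasurable
    (Eventually.of_forall fun z => norm_cutoff_le_one n z.2)

theorem tendsto_integral_cutoff_mul {F : Phase → ℝ} (hF : Integrable F) :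
    Tendsto (fun n => ∫ z, cutoff n z.2 * F z) atTop (𝓝 (∫ z, F z)) := by
  refine tendsto_integral_of_dominated_convergence (fun z => ‖F z‖)
    (fun n => (integrable_cutoff_mul hF n).1) hF.norm
    (fun n => Eventually.of_forall fun z => ?_) (Eventually.of_forall fun z => ?_)
  · rw [norm_mul]
    exact mul_le_of_le_one_left (norm_nonneg _) (norm_cutoff_le_one n _)
  · simpa only [one_mul] using (tendsto_cutoff z.2).mul_const (F z)

theorem norm_fderiv_cutoff_apply_le {C : ℝ}
    (hC : ∀ n v, ‖fderiv ℝ (cutoff n) v‖ ≤ ((n : ℝ) + 1)⁻¹ * C) (n : ℕ) (v e : Vel) :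
    ‖fderiv ℝ (cutoff n) v e‖ ≤ ((n : ℝ) + 1)⁻¹ * C * ‖e‖ :=
  (fderiv ℝ (cutoff n) v).le_of_opNorm_le (hC n v) e

theorem integrable_fderiv_cutoff_mul {F : Phase → ℝ} (hF : Integrable F) (n : ℕ) (e : Vel) :
    Integrable fun z => fderiv ℝ (cutoff n) z.2 e * F z := by
  obtain ⟨C, hC⟩ := exists_norm_fderiv_cutoff_le
  exact hF.bdd_mul
    (((continuous_fderiv_cutoff n).comp continuous_snd).clm_apply
      continuous_const).aestronglyMeasurable
    (Eventually.of_forall fun z => norm_fderiv_cutoff_apply_le hC n z.2 e)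

theorem tendsto_integral_fderiv_cutoff_mul {F : Phase → ℝ} (hF : Integrable F) (e : Vel) :
    Tendsto (fun n => ∫ z, fderiv ℝ (cutoff n) z.2 e * F z) atTop (𝓝 0) := by
  obtain ⟨C, hC⟩ := exists_norm_fderiv_cutoff_le
  have hlim : Tendsto (fun n : ℕ => ((n : ℝ) + 1)⁻¹ * C * ‖e‖ * ∫ z, ‖F z‖) atTop (𝓝 0) := by
    simpa only [zero_mul] using
      ((tendsto_inv_natCast_add_one.mul_const C).mul_const ‖e‖).mul_const (∫ z, ‖F z‖)
  refine squeeze_zero_norm (fun n => ?_) hlim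
  rw [← integral_const_mul]
  refine norm_integral_le_of_norm_le (hF.norm.const_mul _) (Eventually.of_forall fun z => ?_)
  rw [norm_mul]
  gcongr
  exact norm_fderiv_cutoff_apply_le hC n z.2 e

/-! ### Weak derivatives against complex test functions without compact support -/

/-- The derivative of `ψ` along the curves `s ↦ (x + c s, v + s e)`, so that `partialX i` and
`partialV i` can be treated at once. -/
def partialAlong (c : ℝ → Torus) (e : Vel) (ψ : Phase → ℝ) (z : Phase) : ℝ :=
  deriv (fun s : ℝ => ψ (z.1 + c s, z.2 + s • e)) 0

theorem partialX_eq_partialAlong (i : Fin 2) :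
    partialX i = partialAlong (fun s => Pi.single i (s : UnitAddCircle)) 0 := by
  ext ψ z
  simp only [partialX, partialAlong, smul_zero, add_zero]

theorem partialV_eq_partialAlong (i : Fin 2) :
    partialV i = partialAlong 0 (EuclideanSpace.single i (1 : ℝ)) := by
  ext ψ z
  simp only [partialV, partialAlong, Pi.zero_apply, add_zero]

theorem isTest_cutoff_mul {ψ : Phase → ℝ}
    (hψ : ContDiff ℝ ∞ fun y : Vel × Vel => ψ (proj y.1, y.2)) (n : ℕ) :
    IsTest fun z => cutoff n z.2 * ψ z := by
  refine ⟨((contDiff_cutoff n).comp contDiff_snd).mul hψ, HasCompactSupport.intro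
    (isCompact_univ.prod (isCompact_closedBall (0 : Vel) (2 * ((n : ℝ) + 1)))) fun z hz => ?_⟩
  have hz' : 2 * ((n : ℝ) + 1) < ‖z.2‖ := by simpa using hz
  rw [cutoff_eq_zero hz', zero_mul]

theorem IsWeakDeriv.integral_mul_eq_neg {c : ℝ → Torus} {e : Vel} {u w ψ ψ' : Phase → ℝ}
    (h : IsWeakDeriv (partialAlong c e) u w)
    (hψ : ContDiff ℝ ∞ fun y : Vel × Vel => ψ (proj y.1, y.2)) (hc : c 0 = 0)
    (hψ' : ∀ z : Phase, HasDerivAt (fun s : ℝ => ψ (z.1 + c s, z.2 + s • e)) (ψ' z) 0)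
    (huψ : Integrable fun z => u z * ψ z) (huψ' : Integrable fun z => u z * ψ' z)
    (hwψ : Integrable fun z => w z * ψ z) :
    ∫ z, u z * ψ' z = -∫ z, w z * ψ z := by
  have hlim := (tendsto_integral_fderiv_cutoff_mul huψ e).add (tendsto_integral_cutoff_mul huψ')
  rw [zero_add] at hlim
  refine tendsto_nhds_unique hlim ?_
  convert! (tendsto_integral_cutoff_mul hwψ).neg using 1
  ext n
  have hderiv : ∀ z, partialAlong c e (fun z => cutoff n z.2 * ψ z) z
      = fderiv ℝ (cutoff n) z.2 e * ψ z + cutoff n z.2 * ψ' z := fun z => by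
    refine ((hasDerivAt_cutoff n z.2 e).mul (hψ' z)).deriv.trans ?_
    simp only [zero_smul, add_zero, hc]
  have htest := h.2.2 _ (isTest_cutoff_mul hψ n)
  simp only [hderiv] at htest
  rw [← integral_add (integrable_fderiv_cutoff_mul huψ n e) (integrable_cutoff_mul huψ' n)]
  convert htest using 3
  · ring
  · ext z; ring

theorem integral_eq_of_forall_clm {α : Type*} [MeasurableSpace α] {μ : Measure α} {F H : α → ℂ}
    (hF : Integrable F μ) (hH : Integrable H μ)
    (h : ∀ L : ℂ →L[ℝ] ℝ, ∫ x, L (F x) ∂μ = ∫ x, L (H x) ∂μ) : ∫ x, F x ∂μ = ∫ x, H x ∂μ := by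
  simp only [ContinuousLinearMap.integral_comp_comm _ hF,
    ContinuousLinearMap.integral_comp_comm _ hH] at h
  exact Complex.ext (h Complex.reCLM) (h Complex.imCLM)

theorem IsWeakDeriv.integral_smul_eq_neg {c : ℝ → Torus} {e : Vel} {u w : Phase → ℝ}
    {ψ ψ' : Phase → ℂ} (h : IsWeakDeriv (partialAlong c e) u w)
    (hψ : ContDiff ℝ ∞ fun y : Vel × Vel => ψ (proj y.1, y.2)) (hc : c 0 = 0)
    (hψ' : ∀ z : Phase, HasDerivAt (fun s : ℝ => ψ (z.1 + c s, z.2 + s • e)) (ψ' z) 0)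
    (huψ : Integrable fun z => u z • ψ z) (huψ' : Integrable fun z => u z • ψ' z)
    (hwψ : Integrable fun z => w z • ψ z) :
    ∫ z, u z • ψ' z = -∫ z, w z • ψ z := by
  rw [← integral_neg]
  refine integral_eq_of_forall_clm huψ' hwψ.neg fun L => ?_
  simp only [map_neg, map_smul, smul_eq_mul, integral_neg]
  exact h.integral_mul_eq_neg (ψ := fun z => L (ψ z)) (L.contDiff.comp hψ) hc
    (fun z => L.hasFDerivAt.comp_hasDerivAt (0 : ℝ) (hψ' z))
    (by simpa only [map_smul, smul_eq_mul] using L.integrable_comp huψ)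
    (by simpa only [map_smul, smul_eq_mul] using L.integrable_comp huψ')
    (by simpa only [map_smul, smul_eq_mul] using L.integrable_comp hwψ)

/-! ### Fourier-Hermite coefficients of weak derivatives -/

theorem contDiff_mFourier_proj (k : Fin 2 → ℤ) :
    ContDiff ℝ ∞ fun y : Vel => UnitAddTorus.mFourier k (proj y) := by
  simp only [mFourier_proj]
  refine ContDiff.cexp (contDiff_const.mul (ContDiff.sum fun i _ => contDiff_const.mul ?_))
  exact Complex.ofRealCLM.contDiff.comp (contDiff_euclidean.1 contDiff_id i)

theorem hasDerivAt_mFourier (k : Fin 2 → ℤ) (i : Fin 2) (x : Torus) :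
    HasDerivAt (fun s : ℝ => UnitAddTorus.mFourier k (x + Pi.single i (s : UnitAddCircle)))
      (2 * Real.pi * Complex.I * k i * UnitAddTorus.mFourier k x) 0 := by
  simp only [mFourier_add_single]
  have hphase : HasDerivAt (fun s : ℝ => (2 * Real.pi * Complex.I * k i * (s : ℂ)))
      (2 * Real.pi * Complex.I * k i) 0 := by
    simpa using (Complex.ofRealCLM.hasDerivAt (x := (0 : ℝ))).const_mul
      (2 * Real.pi * Complex.I * k i : ℂ)
  convert! hphase.cexp.const_mul (UnitAddTorus.mFourier k x) using 1
  simp only [Complex.ofReal_zero, mul_zero, Complex.exp_zero, one_mul]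
  ring

theorem measurable_maxwellian_snd : Measurable fun z : Phase => maxwellian z.2 :=
  measurable_maxwellian.comp measurable_snd

theorem integral_nu {E : Type*} [NormedAddCommGroup E] [NormedSpace ℝ E] (F : Phase → E) :
    ∫ z, F z ∂nu = ∫ z, maxwellian z.2 • F z := by
  rw [nu, integral_withDensity_eq_integral_toReal_smul
    measurable_maxwellian_snd.ennreal_ofReal
    (Eventually.of_forall fun _ => ENNReal.ofReal_lt_top)]
  simp only [ENNReal.toReal_ofReal (maxwellian_pos _).le]

theorem integrable_nu_iff {E : Type*} [NormedAddCommGroup E] [NormedSpace ℝ E] (F : Phase → E) :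
    Integrable F nu ↔ Integrable fun z => maxwellian z.2 • F z := by
  rw [nu, integrable_withDensity_iff_integrable_smul'
    measurable_maxwellian_snd.ennreal_ofReal
    (Eventually.of_forall fun _ => ENNReal.ofReal_lt_top)]
  simp only [ENNReal.toReal_ofReal (maxwellian_pos _).le]

/-- The density, with respect to `dx dv`, of the functional taking the `p`-th Fourier-Hermite
coefficient. -/
def dualBasis (p : (Fin 2 → ℤ) × (Fin 2 → ℕ)) (z : Phase) : ℂ :=
  UnitAddTorus.mFourier (-p.1) z.1 * ((herm2 p.2 z.2 * maxwellian z.2 : ℝ) : ℂ)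

/-- The Fourier-Hermite coefficients of a real function. -/
def fhCoef (u : Phase → ℝ) (p : (Fin 2 → ℤ) × (Fin 2 → ℕ)) : ℂ :=
  coef nu phaseBasis (fun z => (u z : ℂ)) p

theorem maxwellian_smul_conj_phaseBasis_mul (u : Phase → ℝ) (p : (Fin 2 → ℤ) × (Fin 2 → ℕ))
    (z : Phase) :
    maxwellian z.2 • (conj (phaseBasis p z) * (u z : ℂ)) = u z • dualBasis p z := by
  simp only [phaseBasis, dualBasis, UnitAddTorus.mFourier_neg, map_mul, Complex.conj_ofReal,
    Complex.real_smul, Complex.ofReal_mul]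
  ring

theorem integrable_smul_dualBasis {u : Phase → ℝ} (hu : MemLp u 2 nu)
    (p : (Fin 2 → ℤ) × (Fin 2 → ℕ)) : Integrable fun z => u z • dualBasis p z :=
  ((integrable_nu_iff _).1
    (integrable_conj_mul (isCompleteONS_phaseBasis.memLp p) hu.ofReal)).congr
    (Eventually.of_forall (maxwellian_smul_conj_phaseBasis_mul u p))

theorem fhCoef_eq_integral_smul_dualBasis (u : Phase → ℝ) (p : (Fin 2 → ℤ) × (Fin 2 → ℕ)) :
    fhCoef u p = ∫ z, u z • dualBasis p z := by
  simp only [fhCoef, coef, integral_nu, maxwellian_smul_conj_phaseBasis_mul]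

theorem contDiff_dualBasis (p : (Fin 2 → ℤ) × (Fin 2 → ℕ)) :
    ContDiff ℝ ∞ fun y : Vel × Vel => dualBasis p (proj y.1, y.2) :=
  ((contDiff_mFourier_proj _).comp contDiff_fst).mul (Complex.ofRealCLM.contDiff.comp
    (((contDiff_herm2 p.2).mul contDiff_maxwellian).comp contDiff_snd))

theorem IsWeakDeriv.fhCoef_eq {c : ℝ → Torus} {e : Vel} {u w : Phase → ℝ}
    (h : IsWeakDeriv (partialAlong c e) u w) (hc : c 0 = 0) (hu : MemLp u 2 nu)
    (hw : MemLp w 2 nu) {p q : (Fin 2 → ℤ) × (Fin 2 → ℕ)} {r : ℂ}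
    (hderiv : ∀ z : Phase, HasDerivAt (fun s : ℝ => dualBasis p (z.1 + c s, z.2 + s • e))
      (-r * dualBasis q z) 0) : fhCoef w p = r * fhCoef u q := by
  have hsmul : ∀ z, u z • (-r * dualBasis q z) = -r * (u z • dualBasis q z) :=
    fun z => (mul_smul_comm _ _ _).symm
  have hparts := h.integral_smul_eq_neg (contDiff_dualBasis p) hc hderiv
    (integrable_smul_dualBasis hu p)
    (by simpa only [hsmul] using (integrable_smul_dualBasis hu q).const_mul (-r))
    (integrable_smul_dualBasis hw p)
  simp only [hsmul, integral_const_mul] at hparts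
  rw [fhCoef_eq_integral_smul_dualBasis, fhCoef_eq_integral_smul_dualBasis]
  linear_combination hparts

theorem fhCoef_partialX {i : Fin 2} {u w : Phase → ℝ} (h : IsWeakDeriv (partialX i) u w)
    (hu : MemLp u 2 nu) (hw : MemLp w 2 nu) (p : (Fin 2 → ℤ) × (Fin 2 → ℕ)) :
    fhCoef w p = 2 * Real.pi * Complex.I * p.1 i * fhCoef u p := by
  rw [partialX_eq_partialAlong] at h
  refine h.fhCoef_eq (by simp) hu hw fun z => ?_
  simp only [dualBasis, smul_zero, add_zero]
  convert! (hasDerivAt_mFourier (-p.1) i z.1).mul_const _ using 1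
  simp only [Pi.neg_apply, Int.cast_neg]
  ring

/-- Raising the Hermite index in the direction `i`. -/
def raise (i : Fin 2) (p : (Fin 2 → ℤ) × (Fin 2 → ℕ)) : (Fin 2 → ℤ) × (Fin 2 → ℕ) :=
  (p.1, p.2 + Pi.single i 1)

theorem fhCoef_partialV {i : Fin 2} {u w : Phase → ℝ} (h : IsWeakDeriv (partialV i) u w)
    (hu : MemLp u 2 nu) (hw : MemLp w 2 nu) (p : (Fin 2 → ℤ) × (Fin 2 → ℕ)) :
    fhCoef w p = √(p.2 i + 1) * fhCoef u (raise i p) := by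
  rw [partialV_eq_partialAlong] at h
  refine h.fhCoef_eq rfl hu hw fun z => ?_
  simp only [dualBasis, raise, Pi.zero_apply, add_zero]
  convert! ((Complex.ofRealCLM.hasFDerivAt.comp_hasDerivAt (0 : ℝ)
    (hasDerivAt_herm2_mul_maxwellian i p.2 z.2))).const_mul _ using 1
  simp only [Complex.ofRealCLM_apply]
  push_cast
  ring

/-! ### Poincaré and elliptic inequalities for the reference measure -/

theorem tsum_enorm_fhCoef_sq {u : Phase → ℝ} (hu : MemLp u 2 nu) :
    ∑' p, ‖fhCoef u p‖ₑ ^ 2 = eLpNorm u 2 nu ^ 2 := by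
  refine (isCompleteONS_phaseBasis.tsum_enorm_sq (f := fun z => (u z : ℂ)) hu.ofReal).trans ?_
  congr 1
  exact eLpNorm_congr_norm_ae (Eventually.of_forall fun z => Complex.norm_real _)

theorem phaseBasis_zero (z : Phase) : phaseBasis 0 z = 1 := by
  simp [phaseBasis, UnitAddTorus.mFourier_zero, herm2, herm_zero]

theorem fhCoef_sub {u w : Phase → ℝ} (hu : MemLp u 2 nu) (hw : MemLp w 2 nu)
    (p : (Fin 2 → ℤ) × (Fin 2 → ℕ)) :
    fhCoef (fun z => u z - w z) p = fhCoef u p - fhCoef w p := by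
  simp only [fhCoef_eq_integral_smul_dualBasis, sub_smul]
  exact integral_sub (integrable_smul_dualBasis hu p) (integrable_smul_dualBasis hw p)

theorem fhCoef_const (c : ℝ) (p : (Fin 2 → ℤ) × (Fin 2 → ℕ)) :
    fhCoef (fun _ => c) p = if p = 0 then (c : ℂ) else 0 := by
  have hconst : fhCoef (fun _ => c) p = coef nu phaseBasis (phaseBasis 0) p * c := by
    simp only [fhCoef, coef, phaseBasis_zero, mul_one, integral_mul_const]
  rw [hconst]
  split_ifs with hp
  · rw [hp, isCompleteONS_phaseBasis.coef_self, one_mul]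
  · rw [isCompleteONS_phaseBasis.coef_ne _ _ hp, zero_mul]

theorem fhCoef_zero (u : Phase → ℝ) : fhCoef u 0 = ((∫ z, u z ∂nu : ℝ) : ℂ) := by
  simp only [fhCoef, coef, phaseBasis_zero, map_one, one_mul, integral_complex_ofReal]

theorem fhCoef_sub_mean {u : Phase → ℝ} (hu : MemLp u 2 nu) (p : (Fin 2 → ℤ) × (Fin 2 → ℕ)) :
    fhCoef (fun z => u z - ∫ y, u y ∂nu) p = if p = 0 then 0 else fhCoef u p := by
  rw [fhCoef_sub hu (memLp_const _), fhCoef_const]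
  split_ifs with hp
  · rw [hp, fhCoef_zero, sub_self]
  · rw [sub_zero]

theorem enorm_sq_le_of_norm_le {a b : ℂ} (h : ‖a‖ ≤ ‖b‖) : ‖a‖ₑ ^ 2 ≤ ‖b‖ₑ ^ 2 := by
  gcongr
  exact enorm_le_iff_norm_le.2 h

/-- Lowering the Hermite index in the direction `i`; the index `0` is sent to itself. -/
def lower (i : Fin 2) (p : (Fin 2 → ℤ) × (Fin 2 → ℕ)) : (Fin 2 → ℤ) × (Fin 2 → ℕ) :=
  (p.1, p.2 - Pi.single i 1)

theorem raise_injective (i : Fin 2) : Function.Injective (raise i) := fun p q h => by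
  simp only [raise, Prod.mk.injEq, add_left_inj] at h
  exact Prod.ext h.1 h.2

theorem raise_lower {i : Fin 2} {p : (Fin 2 → ℤ) × (Fin 2 → ℕ)} (h : p.2 i ≠ 0) :
    raise i (lower i p) = p := by
  refine Prod.ext rfl (tsub_add_cancel_of_le fun j => ?_)
  by_cases hj : j = i
  · subst hj
    simpa using Nat.one_le_iff_ne_zero.2 h
  · simp [hj]

theorem tsum_indicator_range_raise_le {i : Fin 2} {u w : Phase → ℝ}
    (h : IsWeakDeriv (partialV i) u w) (hu : MemLp u 2 nu) (hw : MemLp w 2 nu) :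
    ∑' p, (range (raise i)).indicator (fun p => ‖fhCoef u p‖ₑ ^ 2) p ≤ eLpNorm w 2 nu ^ 2 := by
  rw [← tsum_subtype, tsum_range (fun p => ‖fhCoef u p‖ₑ ^ 2) (raise_injective i),
    ← tsum_enorm_fhCoef_sq hw]
  refine ENNReal.tsum_le_tsum fun p => enorm_sq_le_of_norm_le ?_
  rw [fhCoef_partialV h hu hw, norm_mul, Complex.norm_real,
    Real.norm_of_nonneg (Real.sqrt_nonneg _)]
  exact le_mul_of_one_le_left (norm_nonneg _) (Real.one_le_sqrt.2 (by simp))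

theorem tsum_indicator_frequency_ne_zero_le {i : Fin 2} {u w : Phase → ℝ}
    (h : IsWeakDeriv (partialX i) u w) (hu : MemLp u 2 nu) (hw : MemLp w 2 nu) :
    ∑' p : (Fin 2 → ℤ) × (Fin 2 → ℕ), {p | p.1 i ≠ 0}.indicator (fun p => ‖fhCoef u p‖ₑ ^ 2) p
      ≤ eLpNorm w 2 nu ^ 2 := by
  rw [← tsum_enorm_fhCoef_sq hw]
  refine ENNReal.tsum_le_tsum (indicator_le fun p hp => enorm_sq_le_of_norm_le ?_)
  rw [fhCoef_partialX h hu hw, norm_mul]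
  refine le_mul_of_one_le_left (norm_nonneg _) ?_
  have hfreq : (1 : ℝ) ≤ |(p.1 i : ℝ)| := by exact_mod_cast Int.one_le_abs hp
  simp only [norm_mul, Complex.norm_I, mul_one, Complex.norm_real, Complex.norm_ofNat,
    Complex.norm_intCast, Real.norm_of_nonneg Real.pi_pos.le]
  nlinarith [Real.pi_gt_three]

theorem exists_mem_range_raise_or_frequency_ne_zero {p : (Fin 2 → ℤ) × (Fin 2 → ℕ)}
    (hp : p ≠ 0) : ∃ i, p ∈ range (raise i) ∨ p.1 i ≠ 0 := by
  by_contra! h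
  refine hp (Prod.ext (funext fun i => (h i).2) (funext fun i => ?_))
  by_contra hi
  exact (h i).1 ⟨_, raise_lower hi⟩

theorem poincare_nu {u : Phase → ℝ} {G F : Fin 2 → Phase → ℝ} (hu : MemLp u 2 nu)
    (hG : ∀ i, IsWeakDeriv (partialV i) u (G i)) (hF : ∀ i, IsWeakDeriv (partialX i) u (F i))
    (hG2 : ∀ i, MemLp (G i) 2 nu) (hF2 : ∀ i, MemLp (F i) 2 nu) :
    eLpNorm (fun z => u z - ∫ y, u y ∂nu) 2 nu ^ 2
      ≤ ∑ i, (eLpNorm (G i) 2 nu ^ 2 + eLpNorm (F i) 2 nu ^ 2) := by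
  set c : (Fin 2 → ℤ) × (Fin 2 → ℕ) → ℝ≥0∞ := fun p => ‖fhCoef u p‖ₑ ^ 2
  have hm : MemLp (fun z => u z - ∫ y, u y ∂nu) 2 nu := hu.sub (memLp_const _)
  calc eLpNorm (fun z => u z - ∫ y, u y ∂nu) 2 nu ^ 2
      = ∑' p, ‖if p = 0 then 0 else fhCoef u p‖ₑ ^ 2 := by
        simp only [← tsum_enorm_fhCoef_sq hm, fhCoef_sub_mean hu]
    _ ≤ ∑' p, ∑ i, ((range (raise i)).indicator c p + {p | p.1 i ≠ 0}.indicator c p) := by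
        refine ENNReal.tsum_le_tsum fun p => ?_
        split_ifs with hp
        · simp
        obtain ⟨i, hi⟩ := exists_mem_range_raise_or_frequency_ne_zero hp
        refine le_trans ?_ (Finset.single_le_sum (fun _ _ => zero_le) (Finset.mem_univ i))
        rcases hi with hi | hi
        · exact (indicator_of_mem hi c).ge.trans le_self_add
        · exact (indicator_of_mem (show p ∈ {p | p.1 i ≠ 0} from hi) c).ge.trans le_add_self
    _ = ∑ i, (∑' p, (range (raise i)).indicator c p + ∑' p, {p | p.1 i ≠ 0}.indicator c p) := by
        rw [Summable.tsum_finsetSum fun _ _ => ENNReal.summable]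
        simp only [ENNReal.tsum_add]
    _ ≤ ∑ i, (eLpNorm (G i) 2 nu ^ 2 + eLpNorm (F i) 2 nu ^ 2) :=
        Finset.sum_le_sum fun i _ => add_le_add
          (tsum_indicator_range_raise_le (hG i) hu (hG2 i))
          (tsum_indicator_frequency_ne_zero_le (hF i) hu (hF2 i))

theorem coord_mul_smul_dualBasis (w : Phase → ℝ) (i : Fin 2) (p : (Fin 2 → ℤ) × (Fin 2 → ℕ))
    (z : Phase) :
    (z.2 i * w z) • dualBasis p z = √(p.2 i + 1) * (w z • dualBasis (raise i p) z)
      + √(p.2 i) * (w z • dualBasis (lower i p) z) := by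
  have h := congrArg (fun r : ℝ => (r : ℂ)) (mul_herm2 i p.2 z.2)
  simp only [dualBasis, raise, lower, Complex.real_smul]
  push_cast at h ⊢
  linear_combination (w z * UnitAddTorus.mFourier (-p.1) z.1 * (maxwellian z.2 : ℂ)) * h

theorem integrable_coord_mul_smul_dualBasis {w : Phase → ℝ} (hw : MemLp w 2 nu) (i : Fin 2)
    (p : (Fin 2 → ℤ) × (Fin 2 → ℕ)) : Integrable fun z => (z.2 i * w z) • dualBasis p z := by
  simp only [coord_mul_smul_dualBasis]
  exact ((integrable_smul_dualBasis hw _).const_mul _).add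
    ((integrable_smul_dualBasis hw _).const_mul _)

theorem fhCoef_coord_mul {w : Phase → ℝ} (hw : MemLp w 2 nu) (i : Fin 2)
    (p : (Fin 2 → ℤ) × (Fin 2 → ℕ)) :
    fhCoef (fun z => z.2 i * w z) p
      = √(p.2 i + 1) * fhCoef w (raise i p) + √(p.2 i) * fhCoef w (lower i p) := by
  simp only [fhCoef_eq_integral_smul_dualBasis, coord_mul_smul_dualBasis]
  rw [integral_add ((integrable_smul_dualBasis hw _).const_mul _)
    ((integrable_smul_dualBasis hw _).const_mul _), integral_const_mul, integral_const_mul]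

theorem sqrt_mul_fhCoef_lower {i : Fin 2} {u w : Phase → ℝ} (h : IsWeakDeriv (partialV i) u w)
    (hu : MemLp u 2 nu) (hw : MemLp w 2 nu) (p : (Fin 2 → ℤ) × (Fin 2 → ℕ)) :
    √(p.2 i) * fhCoef w (lower i p) = p.2 i * fhCoef u p := by
  by_cases hi : p.2 i = 0
  · simp [hi]
  have hcast : (((lower i p).2 i : ℕ) : ℝ) + 1 = p.2 i := by
    simp only [lower, Pi.sub_apply, Pi.single_eq_same]
    exact_mod_cast Nat.sub_add_cancel (Nat.one_le_iff_ne_zero.2 hi)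
  rw [fhCoef_partialV h hu hw, raise_lower hi, hcast, ← mul_assoc, ← Complex.ofReal_mul,
    Real.mul_self_sqrt (by positivity), Complex.ofReal_natCast]

theorem fhCoef_ornsteinUhlenbeck {u : Phase → ℝ} {G H : Fin 2 → Phase → ℝ}
    (hu : MemLp u 2 nu) (hG : ∀ i, IsWeakDeriv (partialV i) u (G i))
    (hH : ∀ i, IsWeakDeriv (partialV i) (G i) (H i)) (hG2 : ∀ i, MemLp (G i) 2 nu)
    (hH2 : ∀ i, MemLp (H i) 2 nu) (p : (Fin 2 → ℤ) × (Fin 2 → ℕ)) :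
    fhCoef (fun z => ∑ i, (z.2 i * G i z - H i z)) p = (∑ i, (p.2 i : ℂ)) * fhCoef u p := by
  have hcoord := fun i => integrable_coord_mul_smul_dualBasis (hG2 i) i p
  have hjac := fun i => integrable_smul_dualBasis (hH2 i) p
  have hdiff : ∀ i, Integrable fun z => (z.2 i * G i z) • dualBasis p z - H i z • dualBasis p z :=
    fun i => (hcoord i).sub (hjac i)
  simp only [fhCoef_eq_integral_smul_dualBasis, Finset.sum_smul, sub_smul]
  rw [integral_finsetSum _ fun i _ => hdiff i, Finset.sum_mul]
  refine Finset.sum_congr rfl fun i _ => ?_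
  rw [integral_sub (hcoord i) (hjac i)]
  simp only [← fhCoef_eq_integral_smul_dualBasis]
  rw [fhCoef_coord_mul (hG2 i), fhCoef_partialV (hH i) (hG2 i) (hH2 i), add_sub_cancel_left,
    sqrt_mul_fhCoef_lower (hG i) hu (hG2 i)]

theorem sqrt_mul_sqrt_le_sum_raise_raise (i j : Fin 2) (p : (Fin 2 → ℤ) × (Fin 2 → ℕ)) :
    √(p.2 i + 1) * √((raise i p).2 j + 1) ≤ ∑ l, ((raise j (raise i p)).2 l : ℝ) := by
  set s : ℝ := ∑ l, ((raise j (raise i p)).2 l : ℝ) with hs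
  have hle : (p.2 i : ℝ) + 1 ≤ s ∧ ((raise i p).2 j : ℝ) + 1 ≤ s := by
    constructor <;> fin_cases i <;> fin_cases j <;> simp [hs, raise] <;> linarith
  calc √(p.2 i + 1) * √((raise i p).2 j + 1) ≤ √s * √s := by
        gcongr
        exacts [hle.1, hle.2]
    _ = s := Real.mul_self_sqrt (by positivity)

theorem hessian_le_nu {u : Phase → ℝ} {G : Fin 2 → Phase → ℝ} {H : Fin 2 → Fin 2 → Phase → ℝ}
    (hu : MemLp u 2 nu) (hG : ∀ i, IsWeakDeriv (partialV i) u (G i))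
    (hH : ∀ i j, IsWeakDeriv (partialV i) (G j) (H i j)) (hG2 : ∀ i, MemLp (G i) 2 nu)
    (hH2 : ∀ i j, MemLp (H i j) 2 nu)
    (hN : MemLp (fun z => ∑ i, (z.2 i * G i z - H i i z)) 2 nu) (i j : Fin 2) :
    eLpNorm (H i j) 2 nu ≤ eLpNorm (fun z => ∑ i, (z.2 i * G i z - H i i z)) 2 nu := by
  refine (ENNReal.pow_le_pow_left_iff two_ne_zero).1 ?_
  rw [← tsum_enorm_fhCoef_sq (hH2 i j), ← tsum_enorm_fhCoef_sq hN]
  refine le_trans (ENNReal.tsum_le_tsum fun p => ?_) (ENNReal.tsum_comp_le_tsum_of_injective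
    ((raise_injective j).comp (raise_injective i)) _)
  refine enorm_sq_le_of_norm_le ?_
  rw [Function.comp_apply, fhCoef_ornsteinUhlenbeck hu hG (fun i => hH i i) hG2 fun i => hH2 i i,
    fhCoef_partialV (hH i j) (hG2 j) (hH2 i j), fhCoef_partialV (hG j) hu (hG2 j), ← mul_assoc,
    norm_mul, norm_mul _ (fhCoef u _)]
  refine mul_le_mul_of_nonneg_right ?_ (norm_nonneg _)
  rw [← Complex.ofReal_mul, Complex.norm_real, Real.norm_of_nonneg (by positivity)]
  refine (sqrt_mul_sqrt_le_sum_raise_raise i j p).trans (le_of_eq ?_)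
  simp only [← Nat.cast_sum, Complex.norm_natCast]

/-! ### The Poisson-Boltzmann equation -/

/-- The Fourier coefficients of a real function on the torus. -/
def tCoef (f : Torus → ℝ) (k : Fin 2 → ℤ) : ℂ :=
  coef volume (fun k x => UnitAddTorus.mFourier k x) (fun x => (f x : ℂ)) k

theorem continuous_mFourier (k : Fin 2 → ℤ) : Continuous fun x => UnitAddTorus.mFourier k x :=
  (UnitAddTorus.mFourier k).continuous

theorem integrable_smul_of_continuous {E : Type*} [NormedAddCommGroup E] [NormedSpace ℝ E]
    [SecondCountableTopology E] {f : Torus → ℝ} (hf : Integrable f) {χ : Torus → E}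
    (hχ : Continuous χ) : Integrable fun x => f x • χ x := by
  obtain ⟨C, hC⟩ := isCompact_univ.exists_bound_of_continuousOn hχ.continuousOn
  exact hf.smul_bdd C hχ.aestronglyMeasurable (Eventually.of_forall fun x => hC x (mem_univ x))

theorem tCoef_eq_integral_smul (f : Torus → ℝ) (k : Fin 2 → ℤ) :
    tCoef f k = ∫ x, f x • UnitAddTorus.mFourier (-k) x := by
  simp only [tCoef, coef, UnitAddTorus.mFourier_neg, Complex.real_smul, mul_comm]

theorem tCoef_zero (f : Torus → ℝ) : tCoef f 0 = ((∫ x, f x : ℝ) : ℂ) := by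
  simp only [tCoef, coef, UnitAddTorus.mFourier_zero, ContinuousMap.one_apply, map_one, one_mul,
    integral_complex_ofReal]

theorem isTestT_clm_mFourier (L : ℂ →L[ℝ] ℝ) (k : Fin 2 → ℤ) :
    IsTestT fun x => L (UnitAddTorus.mFourier k x) :=
  L.contDiff.comp (contDiff_mFourier_proj k)

theorem partialT_clm_mFourier (L : ℂ →L[ℝ] ℝ) (i : Fin 2) (k : Fin 2 → ℤ) (x : Torus) :
    partialT i (fun x => L (UnitAddTorus.mFourier k x)) x
      = L (2 * Real.pi * Complex.I * k i * UnitAddTorus.mFourier k x) :=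
  (L.hasFDerivAt.comp_hasDerivAt (0 : ℝ) (hasDerivAt_mFourier k i x)).deriv

theorem IsGradT.tCoef_eq {u : Torus → ℝ} {G : Torus → Vel} (h : IsGradT u G) (i : Fin 2)
    (k : Fin 2 → ℤ) : tCoef (fun x => G x i) k = 2 * Real.pi * Complex.I * k i * tCoef u k := by
  have hcont := continuous_mFourier (-k)
  have hparts : ∫ x, u x • (2 * Real.pi * Complex.I * (-k) i * UnitAddTorus.mFourier (-k) x)
      = ∫ x, -(G x i • UnitAddTorus.mFourier (-k) x) := by
    refine integral_eq_of_forall_clm (integrable_smul_of_continuous h.1 (hcont.const_mul _))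
      (integrable_smul_of_continuous (h.2 i).1 hcont).neg fun L => ?_
    simpa only [map_neg, map_smul, smul_eq_mul, integral_neg, partialT_clm_mFourier]
      using (h.2 i).2 _ (isTestT_clm_mFourier L (-k))
  simp only [← mul_smul_comm, integral_const_mul, integral_neg, ← tCoef_eq_integral_smul,
    Pi.neg_apply, Int.cast_neg] at hparts
  linear_combination hparts

theorem IsPoissonBoltzmann.tCoef_eq {δ : ℝ} {ρ φ : Torus → ℝ} (h : IsPoissonBoltzmann δ ρ φ)
    (hρ : Integrable ρ) (k : Fin 2 → ℤ) :
    tCoef (fun x => Real.exp (-φ x) - ρ x) k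
      = ((δ ^ 2 * (4 * Real.pi ^ 2 * ∑ i, (k i : ℝ) ^ 2) : ℝ) : ℂ) * tCoef φ k := by
  obtain ⟨-, hexp, G, hG, -, heq⟩ := h
  have hcont := continuous_mFourier (-k)
  have hterm : ∀ i, Integrable fun x =>
      G x i • (2 * Real.pi * Complex.I * (-k) i * UnitAddTorus.mFourier (-k) x) := fun i =>
    integrable_smul_of_continuous (hG.2 i).1 (hcont.const_mul _)
  have hweak : ∫ x, (Real.exp (-φ x) - ρ x) • UnitAddTorus.mFourier (-k) x
      = ∫ x, (δ ^ 2) • ∑ i, G x i •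
        (2 * Real.pi * Complex.I * (-k) i * UnitAddTorus.mFourier (-k) x) := by
    refine integral_eq_of_forall_clm (integrable_smul_of_continuous (hexp.sub hρ) hcont)
      ((integrable_finsetSum _ fun i _ => hterm i).smul (δ ^ 2)) fun L => ?_
    simpa only [map_smul, map_sum, smul_eq_mul, integral_const_mul, partialT_clm_mFourier]
      using (heq _ (isTestT_clm_mFourier L (-k))).symm
  rw [tCoef_eq_integral_smul, hweak, integral_smul, integral_finsetSum _ fun i _ => hterm i]
  simp only [← mul_smul_comm, integral_const_mul, ← tCoef_eq_integral_smul, hG.tCoef_eq]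
  simp only [Complex.real_smul, Finset.mul_sum, Complex.ofReal_sum, Finset.sum_mul, Pi.neg_apply]
  refine Finset.sum_congr rfl fun i _ => ?_
  push_cast
  linear_combination (-4 * (δ : ℂ) ^ 2 * Real.pi ^ 2 * k i ^ 2 * tCoef φ k) * Complex.I_sq

theorem IsPoissonBoltzmann.integral_exp_neg {δ : ℝ} {ρ φ : Torus → ℝ}
    (h : IsPoissonBoltzmann δ ρ φ) (hρ : Integrable ρ) :
    ∫ x, Real.exp (-φ x) = ∫ x, ρ x := by
  have h0 := h.tCoef_eq hρ 0
  rw [tCoef_zero, integral_sub h.2.1 hρ] at h0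
  simpa [sub_eq_zero] using h0

/-- The real part of the partial sum over `S` of the Fourier series of `f`. -/
def fourierSum (f : Torus → ℝ) (S : Finset (Fin 2 → ℤ)) (x : Torus) : ℝ :=
  (partialSum volume (fun k x => UnitAddTorus.mFourier k x) (fun x => (f x : ℂ)) S x).re

theorem fourierSum_eq_sum (f : Torus → ℝ) (S : Finset (Fin 2 → ℤ)) (x : Torus) :
    fourierSum f S x = ∑ k ∈ S, (tCoef f k * UnitAddTorus.mFourier k x).re :=
  Complex.re_sum _ _

theorem continuous_fourierSum (f : Torus → ℝ) (S : Finset (Fin 2 → ℤ)) :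
    Continuous (fourierSum f S) := by
  unfold fourierSum partialSum
  exact Complex.continuous_re.comp
    (continuous_finsetSum _ fun k _ => (continuous_mFourier k).const_mul _)

theorem isTestT_fourierSum (f : Torus → ℝ) (S : Finset (Fin 2 → ℤ)) : IsTestT (fourierSum f S) :=
  Complex.reCLM.contDiff.comp
    (ContDiff.sum fun k _ => contDiff_const.mul (contDiff_mFourier_proj k))

theorem IsGradT.hasDerivAt_fourierSum {u : Torus → ℝ} {G : Torus → Vel} (h : IsGradT u G)
    (S : Finset (Fin 2 → ℤ)) (i : Fin 2) (x : Torus) :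
    HasDerivAt (fun s : ℝ => fourierSum u S (x + Pi.single i (s : UnitAddCircle)))
      (fourierSum (fun x => G x i) S x) 0 := by
  simp only [fourierSum_eq_sum, h.tCoef_eq]
  refine HasDerivAt.fun_sum fun k _ => ?_
  convert! Complex.reCLM.hasFDerivAt.comp_hasDerivAt (0 : ℝ)
    ((hasDerivAt_mFourier k i x).const_mul (tCoef u k)) using 1
  rw [Complex.reCLM_apply]
  congr 1
  ring

theorem tendsto_integral_fourierSum_sub_sq {f : Torus → ℝ} (hf : MemLp f 2) :
    Tendsto (fun S => ∫ x, (fourierSum f S x - f x) ^ 2) atTop (𝓝 0) := by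
  set F : Torus → ℂ := fun x => (f x : ℂ)
  have hF2 : MemLp F 2 := hf.ofReal
  set P := partialSum volume (fun k x => UnitAddTorus.mFourier k x) F
  have hsq : ∀ S, ENNReal.ofReal (∫ x, (fourierSum f S x - f x) ^ 2)
      ≤ eLpNorm (P S - F) 2 volume ^ 2 := fun S => by
    have hmem : MemLp (P S - F) 2 := (isCompleteONS_mFourier.memLp_partialSum F S).sub hF2
    rw [eLpNorm_two_sq_eq_ofReal hmem]
    refine ENNReal.ofReal_le_ofReal (integral_mono_of_nonneg
      (Eventually.of_forall fun x => sq_nonneg _) (hmem.integrable_norm_pow two_ne_zero)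
      (Eventually.of_forall fun x => ?_))
    have hre : |fourierSum f S x - f x| ≤ ‖(P S - F) x‖ := Complex.abs_re_le_norm ((P S - F) x)
    simpa only [sq_abs] using pow_le_pow_left₀ (abs_nonneg _) hre 2
  have hpow : Tendsto (fun S => eLpNorm (P S - F) 2 volume ^ 2) atTop (𝓝 0) := by
    simpa using ENNReal.Tendsto.pow (n := 2)
      (isCompleteONS_mFourier.tendsto_eLpNorm_partialSum_sub hF2)
  have hlim := (ENNReal.tendsto_toReal ENNReal.zero_ne_top).comp
    (tendsto_of_tendsto_of_tendsto_of_le_of_le tendsto_const_nhds hpow (fun _ => zero_le) hsq)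
  exact hlim.congr fun S => ENNReal.toReal_ofReal (integral_nonneg fun x => sq_nonneg _)

theorem exists_seq_fourierSum_tendsto_ae {f : Torus → ℝ} (hf : MemLp f 2) :
    ∃ S : ℕ → Finset (Fin 2 → ℤ), Tendsto S atTop atTop ∧
      ∀ᵐ x, Tendsto (fun n => fourierSum f (S n) x) atTop (𝓝 (f x)) := by
  obtain ⟨S, hS, hlim⟩ :=
    isCompleteONS_mFourier.exists_seq_tendsto_ae (f := fun x => (f x : ℂ)) hf.ofReal
  exact ⟨S, hS, hlim.mono fun x hx => (Complex.continuous_re.tendsto _).comp hx⟩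

theorem IsGradT.partialT_comp_fourierSum {u : Torus → ℝ} {G : Torus → Vel} (h : IsGradT u G)
    {Ψ Ψ' : ℝ → ℝ} (hΨ' : ∀ s, HasDerivAt Ψ (Ψ' s) s) (S : Finset (Fin 2 → ℤ)) (i : Fin 2)
    (x : Torus) :
    partialT i (fun x => Ψ (fourierSum u S x)) x
      = Ψ' (fourierSum u S x) * fourierSum (fun x => G x i) S x := by
  have hbase : x + Pi.single i (((0 : ℝ) : UnitAddCircle)) = x := by simp
  refine HasDerivAt.deriv (HasDerivAt.comp (0 : ℝ) ?_ (h.hasDerivAt_fourierSum S i x))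
  rw [hbase]
  exact hΨ' _

/-- Testing the equation with a nonincreasing function of a Fourier partial sum of the potential:
the energy term has a sign up to the error of replacing the gradient by its own partial sum. -/
theorem integral_mul_comp_fourierSum_le {δ c : ℝ} {ρ φ : Torus → ℝ} {G : Torus → Vel}
    (hG : IsGradT φ G) (hG2 : MemLp G 2)
    (heq : ∀ χ, IsTestT χ →
      δ ^ 2 * ∫ x, ∑ i, G x i * partialT i χ x = ∫ x, (Real.exp (-φ x) - ρ x) * χ x)
    {Ψ Ψ' : ℝ → ℝ} (hΨ : ContDiff ℝ ∞ Ψ) (hΨ' : ∀ s, HasDerivAt Ψ (Ψ' s) s)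
    (hneg : ∀ s, Ψ' s ≤ 0) (hc : ∀ s, -c ≤ Ψ' s) (S : Finset (Fin 2 → ℤ)) :
    ∫ x, (Real.exp (-φ x) - ρ x) * Ψ (fourierSum φ S x)
      ≤ δ ^ 2 * ∑ i, c / 4 * ∫ x, (fourierSum (fun x => G x i) S x - G x i) ^ 2 := by
  have hΨ'c : Continuous Ψ' := by
    rw [← funext fun s => (hΨ' s).deriv]
    exact hΨ.continuous_deriv (by simp)
  have hGi : ∀ i, MemLp (fun x => G x i) 2 := fun i => hG2.eval_piLp i
  have hfourier : ∀ i, MemLp (fun x => fourierSum (fun x => G x i) S x) 2 := fun i => by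
    obtain ⟨C, hC⟩ := isCompact_univ.exists_bound_of_continuousOn
      (continuous_fourierSum (fun x => G x i) S).continuousOn
    exact MemLp.of_bound (continuous_fourierSum _ S).aestronglyMeasurable C
      (Eventually.of_forall fun x => hC x (mem_univ x))
  have hsq : ∀ i, Integrable fun x => c / 4 * (fourierSum (fun x => G x i) S x - G x i) ^ 2 :=
    fun i => ((hfourier i).sub (hGi i)).integrable_sq.const_mul _
  have hpair : ∀ i, Integrable fun x =>
      G x i * (Ψ' (fourierSum φ S x) * fourierSum (fun x => G x i) S x) := fun i =>
    integrable_smul_of_continuous (hG.2 i).1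
      ((hΨ'c.comp (continuous_fourierSum φ S)).mul (continuous_fourierSum _ S))
  have htest : IsTestT fun x => Ψ (fourierSum φ S x) := hΨ.comp (isTestT_fourierSum φ S)
  rw [← heq _ htest]
  simp only [hG.partialT_comp_fourierSum hΨ']
  refine mul_le_mul_of_nonneg_left ?_ (sq_nonneg δ)
  simp_rw [← integral_const_mul]
  rw [← integral_finsetSum _ fun i _ => hsq i]
  refine integral_mono (integrable_finsetSum _ fun i _ => hpair i)
    (integrable_finsetSum _ fun i _ => hsq i) fun x => Finset.sum_le_sum fun i _ => ?_
  set s := fourierSum φ S x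
  set a := fourierSum (fun x => G x i) S x
  -- `-(a - b)² / 4 ≤ a b` with `b = G x i`
  nlinarith [mul_nonneg (neg_nonneg.2 (hneg s)) (sq_nonneg (a + G x i)),
    mul_nonneg (neg_le_iff_add_nonneg.1 (hc s)) (sq_nonneg (a - G x i))]

theorem IsPoissonBoltzmann.integral_mul_comp_nonpos {δ c M : ℝ} {ρ φ : Torus → ℝ}
    (h : IsPoissonBoltzmann δ ρ φ) (hρ : Integrable ρ) {Ψ Ψ' : ℝ → ℝ} (hΨ : ContDiff ℝ ∞ Ψ)
    (hΨ' : ∀ s, HasDerivAt Ψ (Ψ' s) s) (hneg : ∀ s, Ψ' s ≤ 0) (hc : ∀ s, -c ≤ Ψ' s)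
    (hM : ∀ s, |Ψ s| ≤ M) :
    ∫ x, (Real.exp (-φ x) - ρ x) * Ψ (φ x) ≤ 0 := by
  obtain ⟨hφ, hexp, G, hG, hG2, heq⟩ := h
  obtain ⟨S, hS, hSφ⟩ := exists_seq_fourierSum_tendsto_ae hφ
  have hlim : Tendsto (fun n => ∫ x, (Real.exp (-φ x) - ρ x) * Ψ (fourierSum φ (S n) x)) atTop
      (𝓝 (∫ x, (Real.exp (-φ x) - ρ x) * Ψ (φ x))) := by
    refine tendsto_integral_of_dominated_convergence (fun x => ‖Real.exp (-φ x) - ρ x‖ * M)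
      (fun n => (hexp.sub hρ).1.mul
        (hΨ.continuous.comp (continuous_fourierSum φ (S n))).aestronglyMeasurable)
      ((hexp.sub hρ).norm.mul_const M) (fun n => Eventually.of_forall fun x => ?_)
      (hSφ.mono fun x hx => ((hΨ.continuous.tendsto _).comp hx).const_mul _)
    rw [norm_mul]
    exact mul_le_mul_of_nonneg_left (hM _) (norm_nonneg _)
  have herror : Tendsto (fun n => δ ^ 2 * ∑ i, c / 4 *
      ∫ x, (fourierSum (fun x => G x i) (S n) x - G x i) ^ 2) atTop (𝓝 0) := by
    simpa using (tendsto_finsetSum Finset.univ fun i _ =>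
      ((tendsto_integral_fourierSum_sub_sq (hG2.eval_piLp i)).comp hS).const_mul
        (c / 4)).const_mul (δ ^ 2)
  exact le_of_tendsto_of_tendsto' hlim herror fun n =>
    integral_mul_comp_fourierSum_le hG hG2 heq hΨ hΨ' hneg hc (S n)

/-- A bounded smooth nonincreasing approximation of `s ↦ e^{-s}`. -/
def expReg (ε s : ℝ) : ℝ := (Real.exp s + ε)⁻¹

theorem expReg_pos {ε : ℝ} (hε : 0 < ε) (s : ℝ) : 0 < expReg ε s := by
  unfold expReg
  positivity

theorem expReg_le_inv {ε : ℝ} (hε : 0 < ε) (s : ℝ) : expReg ε s ≤ ε⁻¹ :=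
  inv_anti₀ hε (le_add_of_nonneg_left (Real.exp_pos s).le)

theorem expReg_le_exp_neg {ε : ℝ} (hε : 0 < ε) (s : ℝ) : expReg ε s ≤ Real.exp (-s) := by
  rw [Real.exp_neg]
  exact inv_anti₀ (Real.exp_pos s) (le_add_of_nonneg_right hε.le)

theorem contDiff_expReg {ε : ℝ} (hε : 0 < ε) : ContDiff ℝ ∞ (expReg ε) :=
  (Real.contDiff_exp.add contDiff_const).inv fun s => by positivity

theorem hasDerivAt_expReg {ε : ℝ} (hε : 0 < ε) (s : ℝ) :
    HasDerivAt (expReg ε) (-Real.exp s / (Real.exp s + ε) ^ 2) s :=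
  ((Real.hasDerivAt_exp s).add_const ε).inv (by positivity)

theorem tendsto_expReg (s : ℝ) : Tendsto (fun n : ℕ => expReg ((n : ℝ) + 1)⁻¹ s) atTop
    (𝓝 (Real.exp (-s))) := by
  rw [Real.exp_neg]
  simpa only [add_zero, expReg] using
    (tendsto_inv_natCast_add_one.const_add (Real.exp s)).inv₀ (by positivity)

theorem memLp_expReg_comp {ε : ℝ} (hε : 0 < ε) {φ : Torus → ℝ}
    (hφ : AEStronglyMeasurable φ) : MemLp (fun x => expReg ε (φ x)) 2 :=
  MemLp.of_bound ((contDiff_expReg hε).continuous.comp_aestronglyMeasurable hφ) ε⁻¹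
    (Eventually.of_forall fun x => by
      rw [Real.norm_of_nonneg (expReg_pos hε _).le]
      exact expReg_le_inv hε _)

theorem IsPoissonBoltzmann.eLpNorm_expReg_le {δ ε : ℝ} (hε : 0 < ε) {ρ φ : Torus → ℝ}
    (h : IsPoissonBoltzmann δ ρ φ) (hρ : MemLp ρ 2) :
    eLpNorm (fun x => expReg ε (φ x)) 2 volume ≤ eLpNorm ρ 2 volume := by
  have hmem := memLp_expReg_comp hε h.1.1
  have hρi := hρ.integrable one_le_two
  have hderiv : ∀ s, -ε⁻¹ ≤ -Real.exp s / (Real.exp s + ε) ^ 2 := fun s => by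
    rw [neg_div, neg_le_neg_iff, inv_eq_one_div, div_le_div_iff₀ (by positivity) hε]
    nlinarith [Real.exp_pos s]
  have hnonpos := h.integral_mul_comp_nonpos hρi (contDiff_expReg hε) (hasDerivAt_expReg hε)
    (fun s => div_nonpos_of_nonpos_of_nonneg (neg_nonpos.2 (Real.exp_pos s).le) (sq_nonneg _))
    hderiv (fun s => (abs_of_pos (expReg_pos hε s)).trans_le (expReg_le_inv hε s))
  have hint : Integrable fun x => (Real.exp (-φ x) - ρ x) * expReg ε (φ x) :=
    (h.2.1.sub hρi).mul_bdd (c := ε⁻¹) hmem.1 (Eventually.of_forall fun x =>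
      (Real.norm_of_nonneg (expReg_pos hε _).le).trans_le (expReg_le_inv hε _))
  have hmono : ∫ x, (expReg ε (φ x) ^ 2 - ρ x ^ 2)
      ≤ ∫ x, 2 * ((Real.exp (-φ x) - ρ x) * expReg ε (φ x)) := by
    refine integral_mono (hmem.integrable_sq.sub hρ.integrable_sq) (hint.const_mul 2) fun x => ?_
    nlinarith [sq_nonneg (expReg ε (φ x) - ρ x),
      mul_nonneg (expReg_pos hε (φ x)).le (sub_nonneg.2 (expReg_le_exp_neg hε (φ x)))]
  rw [integral_sub hmem.integrable_sq hρ.integrable_sq, integral_const_mul] at hmono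
  refine (ENNReal.pow_le_pow_left_iff two_ne_zero).1 ?_
  rw [eLpNorm_two_sq_eq_ofReal hmem, eLpNorm_two_sq_eq_ofReal hρ]
  simp only [Real.norm_eq_abs, sq_abs]
  exact ENNReal.ofReal_le_ofReal (by linarith)

theorem IsPoissonBoltzmann.eLpNorm_exp_neg_le {δ : ℝ} {ρ φ : Torus → ℝ}
    (h : IsPoissonBoltzmann δ ρ φ) (hρ : MemLp ρ 2) :
    eLpNorm (fun x => Real.exp (-φ x)) 2 volume ≤ eLpNorm ρ 2 volume := by
  refine Lp.eLpNorm_le_of_ae_tendsto ?_ ?_ (Eventually.of_forall fun x => tendsto_expReg (φ x))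
  · exact Eventually.of_forall fun n => h.eLpNorm_expReg_le (by positivity) hρ
  · exact fun n => (memLp_expReg_comp (by positivity) h.1.1).1

theorem IsPoissonBoltzmann.memLp_exp_neg {δ : ℝ} {ρ φ : Torus → ℝ}
    (h : IsPoissonBoltzmann δ ρ φ) (hρ : MemLp ρ 2) : MemLp (fun x => Real.exp (-φ x)) 2 :=
  ⟨h.2.1.1, (h.eLpNorm_exp_neg_le hρ).trans_lt hρ.2⟩

theorem ae_abs_sub_integral_le_tsum {f : Torus → ℝ} (hf : MemLp f 2) {a : (Fin 2 → ℤ) → ℝ}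
    (ha : Summable a) (ha0 : ∀ k, 0 ≤ a k) (hfa : ∀ k ≠ 0, ‖tCoef f k‖ ≤ a k) :
    ∀ᵐ x, |f x - ∫ y, f y| ≤ ∑' k, a k := by
  obtain ⟨S, hS, hlim⟩ :=
    isCompleteONS_mFourier.exists_seq_tendsto_ae (f := fun x => (f x : ℂ)) hf.ofReal
  filter_upwards [hlim] with x hx
  have hmean : ‖((f x - ∫ y, f y : ℝ) : ℂ)‖ ≤ ∑' k, a k := by
    rw [Complex.ofReal_sub, ← tCoef_zero]
    refine le_of_tendsto (hx.sub_const _).norm ?_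
    filter_upwards [hS.eventually_ge_atTop {0}] with n hn
    rw [partialSum, ← Finset.add_sum_erase _ _ (Finset.singleton_subset_iff.1 hn)]
    simp only [UnitAddTorus.mFourier_zero, ContinuousMap.one_apply, mul_one]
    rw [tCoef, add_sub_cancel_left]
    calc _ ≤ ∑ k ∈ (S n).erase 0, a k := norm_sum_le_of_le _ fun k hk => by
          rw [norm_mul, norm_mFourier_apply, mul_one]
          exact hfa k (Finset.ne_of_mem_erase hk)
      _ ≤ ∑' k, a k := ha.sum_le_tsum _ fun k _ => ha0 k
  rwa [Complex.norm_real, Real.norm_eq_abs] at hmean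

theorem sq_norm_le_sum_sq {ι : Type*} [Fintype ι] (k : ι → ℤ) : ‖k‖ ^ 2 ≤ ∑ i, (k i : ℝ) ^ 2 := by
  rw [← Real.le_sqrt (norm_nonneg _) (Finset.sum_nonneg fun i _ => sq_nonneg _),
    pi_norm_le_iff_of_nonneg (Real.sqrt_nonneg _)]
  intro i
  rw [Int.norm_eq_abs]
  refine Real.le_sqrt_of_sq_le ?_
  rw [sq_abs]
  exact Finset.single_le_sum (f := fun i => (k i : ℝ) ^ 2) (fun i _ => sq_nonneg _)
    (Finset.mem_univ i)

theorem IsPoissonBoltzmann.norm_tCoef_le {δ₀ δ : ℝ} (hδ₀ : 0 < δ₀) (hδ : δ₀ < δ)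
    {ρ φ : Torus → ℝ} (h : IsPoissonBoltzmann δ ρ φ) (hρ : Integrable ρ) {k : Fin 2 → ℤ}
    (hk : k ≠ 0) :
    ‖tCoef φ k‖
      ≤ (2 * δ₀ ^ 2)⁻¹ * (‖tCoef (fun x => Real.exp (-φ x) - ρ x) k‖ ^ 2 + ‖k‖ ^ (-4 : ℝ)) := by
  set r := ‖tCoef (fun x => Real.exp (-φ x) - ρ x) k‖
  have hkpos : 0 < ‖k‖ := norm_pos_iff.2 hk
  have hpi : (1 : ℝ) ≤ 4 * Real.pi ^ 2 := by nlinarith [Real.pi_gt_three]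
  have hcoef : δ₀ ^ 2 * ‖k‖ ^ 2 * ‖tCoef φ k‖ ≤ r := by
    have heq : r = δ ^ 2 * (4 * Real.pi ^ 2 * ∑ i, (k i : ℝ) ^ 2) * ‖tCoef φ k‖ := by
      simp only [r]
      rw [h.tCoef_eq hρ, norm_mul, Complex.norm_real, Real.norm_of_nonneg (by positivity)]
    rw [heq]
    gcongr
    exact (sq_norm_le_sum_sq k).trans (le_mul_of_one_le_left (by positivity) hpi)
  have hdiv : ‖tCoef φ k‖ ≤ (δ₀ ^ 2)⁻¹ * (r * (‖k‖ ^ 2)⁻¹) := by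
    rw [← div_eq_mul_inv, inv_mul_eq_div, le_div_iff₀ (by positivity), le_div_iff₀ (by positivity)]
    linarith
  have hrpow : ‖k‖ ^ (-4 : ℝ) = ((‖k‖ ^ 2)⁻¹) ^ 2 := by
    rw [Real.rpow_neg hkpos.le, ← inv_pow, ← pow_mul, inv_pow]
    norm_num
  refine hdiv.trans ?_
  rw [hrpow, mul_inv_rev, mul_assoc]
  refine mul_le_mul_of_nonneg_left ?_ (by positivity)
  linarith [two_mul_le_add_sq r (‖k‖ ^ 2)⁻¹]

theorem IsPoissonBoltzmann.integral_norm_sq_charge_le {δ : ℝ} {ρ φ : Torus → ℝ}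
    (h : IsPoissonBoltzmann δ ρ φ) (hρ : MemLp ρ 2) :
    ∫ x, ‖((Real.exp (-φ x) - ρ x : ℝ) : ℂ)‖ ^ 2 ≤ 4 * ∫ x, ρ x ^ 2 := by
  have hexp := h.memLp_exp_neg hρ
  have hbound : ∫ x, Real.exp (-φ x) ^ 2 ≤ ∫ x, ρ x ^ 2 := by
    have hsq := pow_le_pow_left' (h.eLpNorm_exp_neg_le hρ) 2
    rw [eLpNorm_two_sq_eq_ofReal hexp, eLpNorm_two_sq_eq_ofReal hρ,
      ENNReal.ofReal_le_ofReal_iff (integral_nonneg fun x => sq_nonneg _)] at hsq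
    simpa only [Real.norm_eq_abs, sq_abs] using hsq
  simp only [Complex.norm_real, Real.norm_eq_abs, sq_abs]
  calc ∫ x, (Real.exp (-φ x) - ρ x) ^ 2
      ≤ ∫ x, (2 * Real.exp (-φ x) ^ 2 + 2 * ρ x ^ 2) :=
        integral_mono (hexp.sub hρ).integrable_sq ((hexp.integrable_sq.const_mul _).add
          (hρ.integrable_sq.const_mul _)) fun x => by
            nlinarith [sq_nonneg (Real.exp (-φ x) + ρ x)]
    _ = 2 * (∫ x, Real.exp (-φ x) ^ 2) + 2 * ∫ x, ρ x ^ 2 := by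
        rw [integral_add (hexp.integrable_sq.const_mul _) (hρ.integrable_sq.const_mul _),
          integral_const_mul, integral_const_mul]
    _ ≤ 4 * ∫ x, ρ x ^ 2 := by linarith

/-- The oscillation of the potential is bounded uniformly in `δ > δ₀`, because `|k|⁻⁴` is summable
over the dual lattice in dimension two. -/
theorem exists_ae_abs_sub_integral_le {ρ : Torus → ℝ} (hρ : MemLp ρ 2) {δ₀ : ℝ} (hδ₀ : 0 < δ₀) :
    ∃ b : ℝ, ∀ δ > δ₀, ∀ φ, IsPoissonBoltzmann δ ρ φ → ∀ᵐ x, |φ x - ∫ y, φ y| ≤ b := by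
  have hZ := EisensteinSeries.summable_one_div_norm_rpow (k := 4) (by norm_num)
  refine ⟨(2 * δ₀ ^ 2)⁻¹ * (4 * (∫ x, ρ x ^ 2) + ∑' k : Fin 2 → ℤ, ‖k‖ ^ (-4 : ℝ)),
    fun δ hδ φ h => ?_⟩
  have hcharge : HasSum (fun k => ‖tCoef (fun x => Real.exp (-φ x) - ρ x) k‖ ^ 2) _ :=
    isCompleteONS_mFourier.hasSum_sq ((h.memLp_exp_neg hρ).sub hρ).ofReal
  filter_upwards [ae_abs_sub_integral_le_tsum h.1
    ((hcharge.summable.add hZ).mul_left (2 * δ₀ ^ 2)⁻¹) (fun k => by positivity)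
    fun k hk => h.norm_tCoef_le hδ₀ hδ (hρ.integrable one_le_two) hk] with x hx
  rw [tsum_mul_left, hcharge.summable.tsum_add hZ, hcharge.tsum_eq] at hx
  refine hx.trans ?_
  gcongr
  exact h.integral_norm_sq_charge_le hρ

theorem ae_exp_neg_bounds_of_ae_abs_sub_le {X : Type*} [MeasurableSpace X] {μ : Measure X}
    [IsProbabilityMeasure μ] {φ : X → ℝ} (hφ : Integrable (fun x => Real.exp (-φ x)) μ)
    {m b : ℝ} (h : ∀ᵐ x ∂μ, |φ x - m| ≤ b) :
    ∀ᵐ x ∂μ, Real.exp (-(2 * b)) * ∫ y, Real.exp (-φ y) ∂μ ≤ Real.exp (-φ x) ∧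
      Real.exp (-φ x) ≤ Real.exp (2 * b) * ∫ y, Real.exp (-φ y) ∂μ := by
  have hpw : ∀ᵐ x ∂μ, Real.exp (-m - b) ≤ Real.exp (-φ x) ∧ Real.exp (-φ x) ≤ Real.exp (-m + b) :=
    h.mono fun x hx => by
      rw [abs_le] at hx
      exact ⟨Real.exp_le_exp.2 (by linarith), Real.exp_le_exp.2 (by linarith)⟩
  have hlower : Real.exp (-m - b) ≤ ∫ y, Real.exp (-φ y) ∂μ := by
    simpa using integral_mono_ae (integrable_const _) hφ (hpw.mono fun x hx => hx.1)
  have hupper : ∫ y, Real.exp (-φ y) ∂μ ≤ Real.exp (-m + b) := by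
    simpa using integral_mono_ae hφ (integrable_const _) (hpw.mono fun x hx => hx.2)
  filter_upwards [hpw] with x hx
  constructor
  · calc Real.exp (-(2 * b)) * ∫ y, Real.exp (-φ y) ∂μ
        ≤ Real.exp (-(2 * b)) * Real.exp (-m + b) := by gcongr
      _ = Real.exp (-m - b) := by rw [← Real.exp_add]; ring_nf
      _ ≤ _ := hx.1
  · calc Real.exp (-φ x) ≤ Real.exp (-m + b) := hx.2
      _ = Real.exp (2 * b) * Real.exp (-m - b) := by rw [← Real.exp_add]; ring_nf
      _ ≤ _ := by gcongr

theorem exists_exp_neg_bounds {ρ : Torus → ℝ} (hρ : MemLp ρ 2) {δ₀ : ℝ} (hδ₀ : 0 < δ₀) :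
    ∃ B : ℝ, 0 < B ∧ ∀ δ > δ₀, ∀ φ, IsPoissonBoltzmann δ ρ φ →
      ∀ᵐ x, B⁻¹ ≤ Real.exp (-φ x) ∧ Real.exp (-φ x) ≤ B := by
  obtain ⟨b, hb⟩ := exists_ae_abs_sub_integral_le hρ hδ₀
  set r := ∫ x, ρ x
  refine ⟨Real.exp (2 * b) * max 1 (max r r⁻¹), by positivity, fun δ hδ φ h => ?_⟩
  have hmass : ∫ x, Real.exp (-φ x) = r := h.integral_exp_neg (hρ.integrable one_le_two)
  have hr : 0 < r := hmass ▸ integral_exp_pos h.2.1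
  have hbounds := ae_exp_neg_bounds_of_ae_abs_sub_le h.2.1 (hb δ hδ φ h)
  rw [hmass] at hbounds
  filter_upwards [hbounds] with x hx
  constructor
  · refine le_trans ?_ hx.1
    rw [mul_inv, ← Real.exp_neg]
    gcongr
    exact inv_le_of_inv_le₀ hr ((le_max_right r r⁻¹).trans (le_max_right _ _))
  · refine hx.2.trans ?_
    gcongr
    exact (le_max_left r r⁻¹).trans (le_max_right _ _)

/-! ### Comparison with the reference measure -/

/-- The measure `μ` is comparable, up to the factor `B`, to the measure `M(v) dx dv`. -/
structure IsComparable (B : ℝ) (φ : Torus → ℝ) : Prop where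
  mu_le : mu φ ≤ ENNReal.ofReal B • nu
  nu_le : nu ≤ ENNReal.ofReal B • mu φ

theorem isComparable_of_ae {B : ℝ} (hB : 0 < B) {φ : Torus → ℝ}
    (h : ∀ᵐ x, B⁻¹ ≤ Real.exp (-φ x) ∧ Real.exp (-φ x) ≤ B) : IsComparable B φ := by
  have hphase : ∀ᵐ z : Phase, B⁻¹ ≤ Real.exp (-φ z.1) ∧ Real.exp (-φ z.1) ≤ B :=
    Measure.quasiMeasurePreserving_fst.ae h
  have hpos : ∀ v, 0 < maxwellian v := fun v => by
    unfold maxwellian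
    positivity
  constructor <;> rw [mu, nu, ← withDensity_smul' _ _ ENNReal.ofReal_ne_top] <;>
    refine withDensity_mono ?_ <;> filter_upwards [hphase] with z hz <;>
    rw [Pi.smul_apply, smul_eq_mul, ← ENNReal.ofReal_mul hB.le, finf] <;>
    refine ENNReal.ofReal_le_ofReal ?_
  · rw [mul_comm]
    exact mul_le_mul_of_nonneg_right hz.2 (hpos _).le
  · rw [mul_left_comm]
    exact le_mul_of_one_le_right (hpos _).le ((inv_le_iff_one_le_mul₀' hB).1 hz.1)

theorem exists_isComparable {ρ : Torus → ℝ} (hρ : MemLp ρ 2) {δ₀ : ℝ} (hδ₀ : 0 < δ₀) :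
    ∃ B : ℝ, 0 < B ∧ ∀ δ > δ₀, ∀ φ, IsPoissonBoltzmann δ ρ φ → IsComparable B φ := by
  obtain ⟨B, hB, h⟩ := exists_exp_neg_bounds hρ hδ₀
  exact ⟨B, hB, fun δ hδ φ hφ => isComparable_of_ae hB (h δ hδ φ hφ)⟩

theorem rpow_half_mul_self (D : ℝ≥0∞) : D ^ (1 / 2 : ℝ) * D ^ (1 / 2 : ℝ) = D := by
  rw [← ENNReal.rpow_add_of_nonneg _ _ (by norm_num) (by norm_num), add_halves, ENNReal.rpow_one]

namespace IsComparable

variable {B : ℝ} {φ : Torus → ℝ} {E : Type*} [NormedAddCommGroup E]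

theorem one_le (h : IsComparable B φ) : 1 ≤ B := by
  have hmass : 1 ≤ ENNReal.ofReal B * ENNReal.ofReal B := by
    calc 1 = nu univ := measure_univ.symm
      _ ≤ ENNReal.ofReal B * mu φ univ := h.nu_le univ
      _ ≤ ENNReal.ofReal B * (ENNReal.ofReal B * nu univ) := by
        gcongr
        exact h.mu_le univ
      _ = ENNReal.ofReal B * ENNReal.ofReal B := by rw [measure_univ, mul_one]
  by_contra! hB
  have hlt : ENNReal.ofReal B < 1 := by simpa using hB
  exact (ENNReal.mul_lt_mul hlt hlt).not_ge (by simpa using hmass)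

theorem eLpNorm_mu_le (h : IsComparable B φ) (f : Phase → E) :
    eLpNorm f 2 (mu φ) ≤ ENNReal.ofReal B ^ (1 / 2 : ℝ) * eLpNorm f 2 nu := by
  refine (eLpNorm_mono_measure f h.mu_le).trans_eq ?_
  rw [eLpNorm_smul_measure_of_ne_top ENNReal.ofNat_ne_top]
  simp

theorem eLpNorm_nu_le (h : IsComparable B φ) (f : Phase → E) :
    eLpNorm f 2 nu ≤ ENNReal.ofReal B ^ (1 / 2 : ℝ) * eLpNorm f 2 (mu φ) := by
  refine (eLpNorm_mono_measure f h.nu_le).trans_eq ?_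
  rw [eLpNorm_smul_measure_of_ne_top ENNReal.ofNat_ne_top]
  simp

theorem eLpNorm_nu_lt_top (h : IsComparable B φ) {f : Phase → E} (hf : eLpNorm f 2 (mu φ) < ⊤) :
    eLpNorm f 2 nu < ⊤ :=
  (h.eLpNorm_nu_le f).trans_lt (ENNReal.mul_lt_top
    (ENNReal.rpow_lt_top_of_nonneg (by norm_num) ENNReal.ofReal_ne_top) hf)

theorem isFiniteMeasure (h : IsComparable B φ) : IsFiniteMeasure (mu φ) :=
  ⟨(h.mu_le univ).trans_lt (by simp)⟩

theorem memLp_nu (h : IsComparable B φ) {f : Phase → E} (hf : MemLp f 2 (mu φ)) :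
    MemLp f 2 nu :=
  ⟨hf.1.mono_ac (Measure.absolutelyContinuous_of_le_smul h.nu_le), h.eLpNorm_nu_lt_top hf.2⟩

end IsComparable

theorem IsWeakDeriv.memLp_nu {ι : Type*} [Fintype ι] {d : (Phase → ℝ) → Phase → ℝ} {u : Phase → ℝ}
    {K : Phase → EuclideanSpace ℝ ι} {i : ι} (h : IsWeakDeriv d u fun z => K z i)
    (hK : eLpNorm K 2 nu < ⊤) : MemLp (fun z => K z i) 2 nu :=
  ⟨h.2.1.aestronglyMeasurable.mono_ac (withDensity_absolutelyContinuous _ _),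
    (eLpNorm_mono fun z => PiLp.norm_apply_le (K z) i).trans_lt hK⟩

theorem eLpNorm_le_eLpNorm_sub_const {X : Type*} [MeasurableSpace X] {μ : Measure X}
    [IsFiniteMeasure μ] {g : X → ℝ} (hg : MemLp g 2 μ) (hmean : ∫ x, g x ∂μ = 0) (c : ℝ) :
    eLpNorm g 2 μ ≤ eLpNorm (fun x => g x - c) 2 μ := by
  have hgc : MemLp (fun x => g x - c) 2 μ := hg.sub (memLp_const c)
  have hcross : Integrable (fun x => c ^ 2 - 2 * c * g x) μ :=
    (integrable_const _).sub ((hg.integrable one_le_two).const_mul _)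
  refine (ENNReal.pow_le_pow_left_iff two_ne_zero).1 ?_
  rw [eLpNorm_two_sq_eq_ofReal hg, eLpNorm_two_sq_eq_ofReal hgc]
  refine ENNReal.ofReal_le_ofReal ?_
  simp only [Real.norm_eq_abs, sq_abs]
  calc ∫ x, g x ^ 2 ∂μ ≤ ∫ x, g x ^ 2 ∂μ + ∫ x, (c ^ 2 - 2 * c * g x) ∂μ := by
        rw [integral_sub (integrable_const _) ((hg.integrable one_le_two).const_mul _),
          integral_const_mul, hmean, mul_zero, sub_zero]
        exact le_add_of_nonneg_right (integral_nonneg fun _ => sq_nonneg c)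
    _ = ∫ x, (g x - c) ^ 2 ∂μ := by
        rw [← integral_add hg.integrable_sq hcross]
        exact integral_congr_ae (Eventually.of_forall fun x => by ring)

theorem eLpNorm_sub_mean_nu_le {g : Phase → ℝ} {G F : Phase → Vel} (hg : MemLp g 2 nu)
    (hG : IsGradV g G) (hF : IsGradX g F) (hG2 : eLpNorm G 2 nu < ⊤) (hF2 : eLpNorm F 2 nu < ⊤) :
    eLpNorm (fun z => g z - ∫ y, g y ∂nu) 2 nu ≤ 2 * (eLpNorm G 2 nu + eLpNorm F 2 nu) := by
  have hcomp : ∀ (K : Phase → Vel) i, eLpNorm (fun z => K z i) 2 nu ≤ eLpNorm K 2 nu :=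
    fun K i => eLpNorm_mono fun z => PiLp.norm_apply_le (K z) i
  refine (ENNReal.pow_le_pow_left_iff two_ne_zero).1 ?_
  calc _ ≤ _ := poincare_nu hg hG hF (fun i => (hG i).memLp_nu hG2) fun i => (hF i).memLp_nu hF2
    _ ≤ ∑ _i : Fin 2, (eLpNorm G 2 nu ^ 2 + eLpNorm F 2 nu ^ 2) := by
        gcongr with i
        · exact hcomp G i
        · exact hcomp F i
    _ = 2 * (eLpNorm G 2 nu ^ 2 + eLpNorm F 2 nu ^ 2) := by
        rw [Finset.sum_const, Finset.card_univ, Fintype.card_fin, nsmul_eq_mul, Nat.cast_ofNat]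
    _ ≤ 2 * (eLpNorm G 2 nu ^ 2 + eLpNorm F 2 nu ^ 2) + (2 * (eLpNorm G 2 nu ^ 2
          + eLpNorm F 2 nu ^ 2) + 8 * eLpNorm G 2 nu * eLpNorm F 2 nu) := le_self_add
    _ = _ := by ring

theorem IsComparable.poincare {B : ℝ} {φ : Torus → ℝ} (h : IsComparable B φ) {g : Phase → ℝ}
    (hg : MemH0 φ g) : normH φ g ≤ ENNReal.ofReal (2 * B) * (normA φ g + normC φ g) := by
  have := h.isFiniteMeasure
  have hc0 : ENNReal.ofReal (2 * B) ≠ 0 := by simpa using one_pos.trans_le h.one_le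
  simp only [normA, normC, ENNReal.iInf_add, ENNReal.add_iInf,
    ENNReal.mul_iInf_of_ne hc0 ENNReal.ofReal_ne_top, le_iInf_iff]
  intro F hF G hG
  rcases eq_top_or_lt_top (eLpNorm G 2 (mu φ)) with hG2 | hG2
  · simp only [hG2, top_add, ENNReal.mul_top hc0, le_top]
  rcases eq_top_or_lt_top (eLpNorm F 2 (mu φ)) with hF2 | hF2
  · simp only [hF2, add_top, ENNReal.mul_top hc0, le_top]
  set s := ENNReal.ofReal B ^ (1 / 2 : ℝ)
  calc normH φ g ≤ eLpNorm (fun z => g z - ∫ y, g y ∂nu) 2 (mu φ) :=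
        eLpNorm_le_eLpNorm_sub_const hg.1 hg.2 _
    _ ≤ s * eLpNorm (fun z => g z - ∫ y, g y ∂nu) 2 nu := h.eLpNorm_mu_le _
    _ ≤ s * (2 * (eLpNorm G 2 nu + eLpNorm F 2 nu)) := by
        gcongr
        exact eLpNorm_sub_mean_nu_le (h.memLp_nu hg.1) hG hF (h.eLpNorm_nu_lt_top hG2)
          (h.eLpNorm_nu_lt_top hF2)
    _ ≤ s * (2 * (s * eLpNorm G 2 (mu φ) + s * eLpNorm F 2 (mu φ))) := by
        gcongr
        · exact h.eLpNorm_nu_le G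
        · exact h.eLpNorm_nu_le F
    _ = 2 * (s * s) * (eLpNorm G 2 (mu φ) + eLpNorm F 2 (mu φ)) := by ring
    _ = _ := by rw [rpow_half_mul_self, ENNReal.ofReal_mul zero_le_two, ENNReal.ofReal_ofNat]

theorem eLpNorm_euclidean_le_sum {X ι : Type*} [MeasurableSpace X] {μ : Measure X} [Fintype ι]
    {H : X → EuclideanSpace ℝ ι} (hH : ∀ p, AEStronglyMeasurable (fun z => H z p) μ) :
    eLpNorm H 2 μ ≤ ∑ p, eLpNorm (fun z => H z p) 2 μ := by
  calc eLpNorm H 2 μ ≤ eLpNorm (∑ p, fun z => ‖H z p‖) 2 μ := eLpNorm_mono fun z => by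
        have hsum : 0 ≤ ∑ p, ‖H z p‖ := Finset.sum_nonneg fun _ _ => norm_nonneg _
        rw [Finset.sum_apply, Real.norm_of_nonneg hsum, EuclideanSpace.norm_eq]
        exact Real.sqrt_le_iff.2
          ⟨hsum, Finset.sum_sq_le_sq_sum_of_nonneg fun _ _ => norm_nonneg _⟩
    _ ≤ ∑ p, eLpNorm (fun z => ‖H z p‖) 2 μ :=
        eLpNorm_sum_le (fun p _ => (hH p).norm) one_le_two
    _ = _ := by simp only [eLpNorm_norm]

theorem eLpNorm_hessian_nu_le {u : Phase → ℝ} {G : Phase → Vel} {H : Phase → Mat}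
    (hu : MemLp u 2 nu) (hG : IsGradV u G) (hH : IsJacV G H) (hG2 : eLpNorm G 2 nu < ⊤)
    (hH2 : eLpNorm H 2 nu < ⊤)
    (hN : eLpNorm (fun z => ∑ i, (z.2 i * G z i - H z (i, i))) 2 nu < ⊤) :
    eLpNorm H 2 nu ≤ 4 * eLpNorm (fun z => ∑ i, (z.2 i * G z i - H z (i, i))) 2 nu := by
  have hGi : ∀ i, MemLp (fun z => G z i) 2 nu := fun i => (hG i).memLp_nu hG2
  have hHij : ∀ i j, MemLp (fun z => H z (i, j)) 2 nu := fun i j => (hH i j).memLp_nu hH2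
  have hmeas : AEStronglyMeasurable (fun z : Phase => ∑ i, (z.2 i * G z i - H z (i, i))) nu := by
    refine Finset.aestronglyMeasurable_fun_sum _ fun i _ => ?_
    have hcoord : Continuous fun z : Phase => z.2 i := by fun_prop
    exact (hcoord.aestronglyMeasurable.mul (hGi i).1).sub (hHij i i).1
  calc eLpNorm H 2 nu ≤ ∑ p, eLpNorm (fun z => H z p) 2 nu :=
        eLpNorm_euclidean_le_sum fun p => (hHij p.1 p.2).1
    _ ≤ ∑ _p : Fin 2 × Fin 2, eLpNorm (fun z => ∑ i, (z.2 i * G z i - H z (i, i))) 2 nu :=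
        Finset.sum_le_sum fun p _ => hessian_le_nu hu hG hH hGi hHij ⟨hmeas, hN⟩ p.1 p.2
    _ = _ := by simp [Finset.sum_const, nsmul_eq_mul]

theorem IsComparable.normAA_le {B : ℝ} {φ : Torus → ℝ} (h : IsComparable B φ) {u : Phase → ℝ}
    (hu : MemH φ u) : normAA φ u ≤ ENNReal.ofReal (4 * B) * normAstarA φ u := by
  have hc0 : ENNReal.ofReal (4 * B) ≠ 0 := by simpa using one_pos.trans_le h.one_le
  simp only [normAstarA, ENNReal.mul_iInf_of_ne hc0 ENNReal.ofReal_ne_top, le_iInf_iff]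
  intro G H hG hH hG2 hH2
  set N : Phase → ℝ := fun z => ∑ i, (z.2 i * G z i - H z (i, i))
  rcases eq_top_or_lt_top (eLpNorm N 2 (mu φ)) with hN | hN
  · simp only [hN, ENNReal.mul_top hc0, le_top]
  set s := ENNReal.ofReal B ^ (1 / 2 : ℝ)
  calc normAA φ u ≤ eLpNorm H 2 (mu φ) := iInf₂_le_of_le G H (iInf₂_le hG hH)
    _ ≤ s * eLpNorm H 2 nu := h.eLpNorm_mu_le _
    _ ≤ s * (4 * eLpNorm N 2 nu) := by
        gcongr
        exact eLpNorm_hessian_nu_le (h.memLp_nu hu) hG hH (h.eLpNorm_nu_lt_top hG2.2)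
          (h.eLpNorm_nu_lt_top hH2.2) (h.eLpNorm_nu_lt_top hN)
    _ ≤ s * (4 * (s * eLpNorm N 2 (mu φ))) := by
        gcongr
        exact h.eLpNorm_nu_le N
    _ = 4 * (s * s) * eLpNorm N 2 (mu φ) := by ring
    _ = _ := by rw [rpow_half_mul_self, ENNReal.ofReal_mul zero_le_four, ENNReal.ofReal_ofNat]

/-! ### Energy and dissipation bounds -/

/-- The weight `τ^a m^b`, where `m = min(1, t/τ)` is the time weight. -/
def wgt (τ m a b : ℝ) : ℝ≥0∞ := ENNReal.ofReal (τ ^ a * m ^ b)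

/-- The range of parameters in which the weights `τ^a m^b` are compared: `τ` is bounded below by
`σ ≤ 1`, and `m` is a positive time weight. -/
structure WeightRange (σ τ m : ℝ) : Prop where
  σ_pos : 0 < σ
  σ_le_one : σ ≤ 1
  σ_le : σ ≤ τ
  m_pos : 0 < m
  m_le_one : m ≤ 1

section Weights

variable {τ m : ℝ}

theorem wgt_mul (hτ : 0 < τ) (hm : 0 < m) (a b a' b' : ℝ) :
    wgt τ m a b * wgt τ m a' b' = wgt τ m (a + a') (b + b') := by
  unfold wgt
  rw [← ENNReal.ofReal_mul (by positivity), Real.rpow_add hτ, Real.rpow_add hm, mul_mul_mul_comm]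

theorem wgt_rpow (hτ : 0 < τ) (hm : 0 < m) (a b s : ℝ) :
    wgt τ m a b ^ s = wgt τ m (s * a) (s * b) := by
  unfold wgt
  rw [ENNReal.ofReal_rpow_of_pos (by positivity), Real.mul_rpow (by positivity) (by positivity),
    ← Real.rpow_mul hτ.le, ← Real.rpow_mul hm.le, mul_comm a, mul_comm b]

theorem wgt_zero : wgt τ m 0 0 = 1 := by simp [wgt]

theorem wgt_one_left (a b : ℝ) : wgt τ 1 a b = wgt τ 1 a 0 := by simp [wgt]

theorem ofReal_rpow_mul (a : ℝ) : ENNReal.ofReal (τ ^ a * m) = wgt τ m a 1 := by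
  rw [wgt, Real.rpow_one]

theorem ofReal_rpow_mul_sq (a : ℝ) : ENNReal.ofReal (τ ^ a * m ^ 2) = wgt τ m a 2 := by
  rw [wgt, Real.rpow_ofNat]

theorem ofReal_rpow_mul_cube (a : ℝ) : ENNReal.ofReal (τ ^ a * m ^ 3) = wgt τ m a 3 := by
  rw [wgt, Real.rpow_ofNat]

theorem le_wgt_mul_sqrt (hτ : 0 < τ) (hm : 0 < m) {r c a b : ℝ} (hr : 0 ≤ r) (hc : 1 ≤ r ^ 2 * c)
    {X D : ℝ≥0∞} (h : ENNReal.ofReal (c * (τ ^ (-2 * a) * m ^ (-2 * b))) * X ^ 2 ≤ D) :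
    X ≤ ENNReal.ofReal r * wgt τ m a b * D ^ (1 / 2 : ℝ) := by
  have hsplit : ENNReal.ofReal (r ^ 2 * c) * wgt τ m (-2 * a) (-2 * b)
      = ENNReal.ofReal r ^ 2 * ENNReal.ofReal (c * (τ ^ (-2 * a) * m ^ (-2 * b))) := by
    rw [wgt, ← ENNReal.ofReal_mul (zero_le_one.trans hc), ← ENNReal.ofReal_pow hr,
      ← ENNReal.ofReal_mul (sq_nonneg r), mul_assoc]
  have hcancel : wgt τ m a b ^ 2 * wgt τ m (-2 * a) (-2 * b) = 1 := by
    rw [sq, wgt_mul hτ hm, wgt_mul hτ hm]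
    ring_nf
    exact wgt_zero
  refine (ENNReal.pow_le_pow_left_iff two_ne_zero).1 ?_
  calc X ^ 2 = wgt τ m a b ^ 2 * (1 * wgt τ m (-2 * a) (-2 * b)) * X ^ 2 := by
        rw [one_mul, hcancel, one_mul]
    _ ≤ wgt τ m a b ^ 2 * (ENNReal.ofReal (r ^ 2 * c) * wgt τ m (-2 * a) (-2 * b)) * X ^ 2 := by
        gcongr
        exact ENNReal.one_le_ofReal.2 hc
    _ = ENNReal.ofReal r ^ 2 * wgt τ m a b ^ 2
          * (ENNReal.ofReal (c * (τ ^ (-2 * a) * m ^ (-2 * b))) * X ^ 2) := by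
        rw [hsplit]
        ring
    _ ≤ ENNReal.ofReal r ^ 2 * wgt τ m a b ^ 2 * (D ^ (1 / 2 : ℝ) * D ^ (1 / 2 : ℝ)) := by
        rw [rpow_half_mul_self]
        gcongr
    _ = _ := by ring

theorem rpow_mul_rpow_le_wgt (hτ : 0 < τ) (hm : 0 < m) {L x H C : ℝ≥0∞} {a b a' b' s : ℝ}
    (hs : s ∈ Icc (0 : ℝ) 1) (hH : H ≤ L * wgt τ m a b * x) (hC : C ≤ L * wgt τ m a' b' * x) :
    H ^ (1 - s) * C ^ s ≤ L * wgt τ m ((1 - s) * a + s * a') ((1 - s) * b + s * b') * x := by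
  have hs0 : 0 ≤ s := hs.1
  have hs1 : 0 ≤ 1 - s := sub_nonneg.2 hs.2
  have hpow : ∀ y : ℝ≥0∞, y ^ (1 - s) * y ^ s = y := fun y => by
    rw [← ENNReal.rpow_add_of_nonneg _ _ hs1 hs0, sub_add_cancel, ENNReal.rpow_one]
  calc H ^ (1 - s) * C ^ s
      ≤ (L * wgt τ m a b * x) ^ (1 - s) * (L * wgt τ m a' b' * x) ^ s := by gcongr
    _ = (L ^ (1 - s) * L ^ s) * (wgt τ m a b ^ (1 - s) * wgt τ m a' b' ^ s)
        * (x ^ (1 - s) * x ^ s) := by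
      simp only [ENNReal.mul_rpow_of_nonneg _ _ hs1, ENNReal.mul_rpow_of_nonneg _ _ hs0]
      ring
    _ = _ := by rw [hpow, hpow, wgt_rpow hτ hm, wgt_rpow hτ hm, wgt_mul hτ hm]

end Weights

namespace WeightRange

variable {σ τ m : ℝ}

theorem τ_pos (hw : WeightRange σ τ m) : 0 < τ := hw.σ_pos.trans_le hw.σ_le

theorem wgt_le (hw : WeightRange σ τ m) {N a b a' b' : ℝ} (ha : a ≤ a') (ha' : a' ≤ a + N)
    (hb : b' ≤ b) : wgt τ m a b ≤ ENNReal.ofReal (σ ^ (-N)) * wgt τ m a' b' := by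
  have hσ := hw.σ_pos
  have hτ := hw.τ_pos
  have hm := hw.m_pos
  have hlow : σ ^ N ≤ τ ^ (a' - a) :=
    calc σ ^ N ≤ σ ^ (a' - a) :=
          Real.rpow_le_rpow_of_exponent_ge hσ hw.σ_le_one (by linarith)
      _ ≤ τ ^ (a' - a) := Real.rpow_le_rpow hσ.le hw.σ_le (by linarith)
  have hτa : τ ^ a ≤ σ ^ (-N) * τ ^ a' := by
    rw [Real.rpow_sub hτ, le_div_iff₀ (by positivity)] at hlow
    rwa [Real.rpow_neg hσ.le, inv_mul_eq_div, le_div_iff₀ (by positivity), mul_comm]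
  unfold wgt
  rw [← ENNReal.ofReal_mul (by positivity), ← mul_assoc]
  exact ENNReal.ofReal_le_ofReal (mul_le_mul hτa
    (Real.rpow_le_rpow_of_exponent_ge hm hw.m_le_one hb) (by positivity) (by positivity))

theorem mul_three_le (hw : WeightRange σ τ m) {L X Y Z x y z : ℝ≥0∞}
    {N P a b a₁ b₁ a₂ b₂ a₃ b₃ : ℝ} (hX : X ≤ L * wgt τ m a₁ b₁ * x)
    (hY : Y ≤ L * wgt τ m a₂ b₂ * y) (hZ : Z ≤ L * wgt τ m a₃ b₃ * z)
    (ha : a + a₁ + a₂ + a₃ ≤ P) (hN : P ≤ a + a₁ + a₂ + a₃ + N) (hb : 0 ≤ b + b₁ + b₂ + b₃) :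
    wgt τ m a b * X * Y * Z ≤ L ^ 3 * ENNReal.ofReal (σ ^ (-N) * τ ^ P) * (x * y * z) := by
  have hσ := hw.σ_pos
  calc wgt τ m a b * X * Y * Z
      ≤ wgt τ m a b * (L * wgt τ m a₁ b₁ * x) * (L * wgt τ m a₂ b₂ * y)
        * (L * wgt τ m a₃ b₃ * z) := by gcongr
    _ = L ^ 3 * (wgt τ m a b * wgt τ m a₁ b₁ * wgt τ m a₂ b₂ * wgt τ m a₃ b₃) * (x * y * z) := by
      ring
    _ = L ^ 3 * wgt τ m (a + a₁ + a₂ + a₃) (b + b₁ + b₂ + b₃) * (x * y * z) := by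
      simp only [wgt_mul hw.τ_pos hw.m_pos]
    _ ≤ L ^ 3 * (ENNReal.ofReal (σ ^ (-N)) * wgt τ m P 0) * (x * y * z) := by
      gcongr
      exact hw.wgt_le ha hN hb
    _ = _ := by rw [wgt, Real.rpow_zero, mul_one, ENNReal.ofReal_mul (by positivity)]

end WeightRange

/-- The bounds on the derivatives of `h ∈ 𝓗₀` by `x = D_t(h)^{1/2}`, with constant `L`; here
`m = min(1, t/τ)`. -/
structure DissipationBounds (L : ℝ≥0∞) (τ m : ℝ) (φ : Torus → ℝ) (h : Phase → ℝ) (x : ℝ≥0∞) :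
    Prop where
  A : normA φ h ≤ L * wgt τ m (1 / 2) 0 * x
  AA : normAA φ h ≤ L * wgt τ m (23 / 30) (-1 / 2) * x
  AC : normAC φ h ≤ L * wgt τ m (3 / 10) (-3 / 2) * x
  C : normC φ h ≤ L * wgt τ m (1 / 30) (-1) * x
  H : normH φ h ≤ L * wgt τ m (1 / 2) (-1) * x

/-- The bounds on `k ∈ 𝓗` by `z = 𝓔_t(k)^{1/2}`, with constant `L`; here `m = min(1, t/τ)`. -/
structure EnergyBounds (L : ℝ≥0∞) (τ m : ℝ) (φ : Torus → ℝ) (k : Phase → ℝ) (z : ℝ≥0∞) :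
    Prop where
  H : normH φ k ≤ L * wgt τ m 0 0 * z
  C : normC φ k ≤ L * wgt τ m (-1 / 5) (-3 / 2) * z

theorem wt_pos {τ t : ℝ} (hτ : 0 < τ) (ht : 0 < t) : 0 < wt τ t :=
  lt_min one_pos (div_pos ht hτ)

theorem weightRange_wt {τ₀ τ t : ℝ} (hτ₀ : 0 < τ₀) (hτ : τ₀ < τ) (ht : 0 < t) :
    WeightRange (min 1 τ₀) τ (wt τ t) :=
  ⟨lt_min one_pos hτ₀, min_le_left _ _, (min_le_right _ _).trans hτ.le,
    wt_pos (hτ₀.trans hτ) ht, min_le_left _ _⟩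

section Dissipation

variable {γ : Fin 3 → ℝ} {τ t r : ℝ} {φ : Torus → ℝ} {h : Phase → ℝ}

theorem normA_le_dissipation (hτ : 0 < τ) (ht : 0 < t) (hr : 1 ≤ r) :
    normA φ h ≤ ENNReal.ofReal r * wgt τ (wt τ t) (1 / 2) 0
      * dissipation γ betaColl τ t φ h ^ (1 / 2 : ℝ) := by
  refine le_wgt_mul_sqrt hτ (wt_pos hτ ht) (c := 1) (by linarith)
    (by rw [mul_one]; exact one_le_pow₀ hr) ?_
  have hcoef : 1 * (τ ^ (-2 * (1 / 2) : ℝ) * wt τ t ^ (-2 * 0 : ℝ)) = τ⁻¹ := by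
    norm_num [Real.rpow_neg_one]
  rw [hcoef]
  exact le_self_add.trans (le_self_add.trans le_self_add)

theorem normAstarA_le_dissipation (hτ : 0 < τ) (ht : 0 < t) (hr : 0 ≤ r)
    (hγ : 1 ≤ r ^ 2 * γ 0) :
    normAstarA φ h ≤ ENNReal.ofReal r * wgt τ (wt τ t) (23 / 30) (-1 / 2)
      * dissipation γ betaColl τ t φ h ^ (1 / 2 : ℝ) := by
  refine le_wgt_mul_sqrt hτ (wt_pos hτ ht) hr hγ ?_
  have hτexp : (-2 * (23 / 30) : ℝ) = betaColl 0 - 1 := by norm_num [betaColl]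
  have hmexp : wt τ t ^ (-2 * (-1 / 2) : ℝ) = wt τ t := by norm_num
  rw [hτexp, hmexp, ← mul_assoc]
  exact le_add_self.trans (le_self_add.trans le_self_add)

theorem normAC_le_dissipation (hτ : 0 < τ) (ht : 0 < t) (hr : 0 ≤ r) (hγ : 1 ≤ r ^ 2 * γ 1) :
    normAC φ h ≤ ENNReal.ofReal r * wgt τ (wt τ t) (3 / 10) (-3 / 2)
      * dissipation γ betaColl τ t φ h ^ (1 / 2 : ℝ) := by
  refine le_wgt_mul_sqrt hτ (wt_pos hτ ht) hr hγ ?_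
  have hτexp : (-2 * (3 / 10) : ℝ) = betaColl 1 - 1 := by norm_num [betaColl]
  have hmexp : (-2 * (-3 / 2) : ℝ) = 3 := by norm_num
  rw [hτexp, hmexp, Real.rpow_ofNat, ← mul_assoc]
  exact le_add_self.trans le_self_add

theorem normC_le_dissipation (hτ : 0 < τ) (ht : 0 < t) (hr : 0 ≤ r) (hγ : 1 ≤ r ^ 2 * γ 2) :
    normC φ h ≤ ENNReal.ofReal r * wgt τ (wt τ t) (1 / 30) (-1)
      * dissipation γ betaColl τ t φ h ^ (1 / 2 : ℝ) := by
  refine le_wgt_mul_sqrt hτ (wt_pos hτ ht) hr hγ ?_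
  have hτexp : (-2 * (1 / 30) : ℝ) = betaColl 2 := by
    change _ = (-1 / 15 : ℝ)
    norm_num
  have hmexp : (-2 * -1 : ℝ) = 2 := by norm_num
  rw [hτexp, hmexp, Real.rpow_ofNat, ← mul_assoc]
  exact le_add_self

theorem normH_le_dissipation {B σ N : ℝ} (hB : IsComparable B φ)
    (hw : WeightRange σ τ (wt τ t)) (ht : 0 < t) (hN : 1 / 2 ≤ N) (hr : 1 ≤ r)
    (hγ : 1 ≤ r ^ 2 * γ 2) (hh : MemH0 φ h) :
    normH φ h ≤ ENNReal.ofReal (4 * B * r * σ ^ (-N)) * wgt τ (wt τ t) (1 / 2) (-1)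
      * dissipation γ betaColl τ t φ h ^ (1 / 2 : ℝ) := by
  have hB0 : 0 ≤ B := zero_le_one.trans hB.one_le
  have hr0 : 0 ≤ r := zero_le_one.trans hr
  have hconst : ENNReal.ofReal (4 * B * r * σ ^ (-N))
      = 2 * (ENNReal.ofReal (2 * B) * (ENNReal.ofReal r * ENNReal.ofReal (σ ^ (-N)))) := by
    rw [← ENNReal.ofReal_mul hr0, ← ENNReal.ofReal_mul (by positivity), ← ENNReal.ofReal_ofNat 2,
      ← ENNReal.ofReal_mul zero_le_two]
    ring_nf
  set w := ENNReal.ofReal r * (ENNReal.ofReal (σ ^ (-N)) * wgt τ (wt τ t) (1 / 2) (-1))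
    * dissipation γ betaColl τ t φ h ^ (1 / 2 : ℝ) with hwdef
  have hA : normA φ h ≤ w := by
    refine (normA_le_dissipation (γ := γ) hw.τ_pos ht hr).trans ?_
    rw [hwdef]
    gcongr
    exact hw.wgt_le le_rfl (by linarith) (by norm_num)
  have hC : normC φ h ≤ w := by
    refine (normC_le_dissipation hw.τ_pos ht hr0 hγ).trans ?_
    rw [hwdef]
    gcongr
    exact hw.wgt_le (by norm_num) (by linarith) le_rfl
  calc normH φ h ≤ ENNReal.ofReal (2 * B) * (normA φ h + normC φ h) := hB.poincare hh
    _ ≤ ENNReal.ofReal (2 * B) * (w + w) := by gcongr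
    _ = _ := by
      rw [hconst, hwdef]
      ring

theorem dissipationBounds {B σ N : ℝ} (hB : IsComparable B φ) (hw : WeightRange σ τ (wt τ t))
    (ht : 0 < t) (hN : 1 / 2 ≤ N) (hr : 1 ≤ r) (hγ : ∀ i, 1 ≤ r ^ 2 * γ i) (hh : MemH0 φ h) :
    DissipationBounds (ENNReal.ofReal (4 * B * r * σ ^ (-N))) τ (wt τ t) φ h
      (dissipation γ betaColl τ t φ h ^ (1 / 2 : ℝ)) := by
  have hτ := hw.τ_pos
  have hB1 := hB.one_le
  have hr0 : 0 ≤ r := zero_le_one.trans hr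
  have hR : 1 ≤ σ ^ (-N) :=
    Real.one_le_rpow_of_pos_of_le_one_of_nonpos hw.σ_pos hw.σ_le_one (by linarith)
  have hmono {X w : ℝ≥0∞} {c : ℝ} (hc : c ≤ 4 * B * r)
      (hX : X ≤ ENNReal.ofReal c * w * dissipation γ betaColl τ t φ h ^ (1 / 2 : ℝ)) :
      X ≤ ENNReal.ofReal (4 * B * r * σ ^ (-N)) * w
        * dissipation γ betaColl τ t φ h ^ (1 / 2 : ℝ) :=
    hX.trans (by gcongr; exact hc.trans (le_mul_of_one_le_right (by positivity) hR))
  have hr4 : r ≤ 4 * B * r := le_mul_of_one_le_left hr0 (by linarith)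
  refine ⟨hmono hr4 (normA_le_dissipation hτ ht hr), hmono le_rfl ?_,
    hmono hr4 (normAC_le_dissipation hτ ht hr0 (hγ 1)),
    hmono hr4 (normC_le_dissipation hτ ht hr0 (hγ 2)),
    normH_le_dissipation hB hw ht hN hr (hγ 2) hh⟩
  rw [ENNReal.ofReal_mul (by positivity), mul_assoc, mul_assoc, ← mul_assoc (ENNReal.ofReal r)]
  exact (hB.normAA_le hh.1).trans (mul_le_mul_right (normAstarA_le_dissipation hτ ht hr0 (hγ 0)) _)

end Dissipation

theorem energyBounds {γ : Fin 3 → ℝ} {c₀ r τ δ t : ℝ} {L : ℝ≥0∞} (hτ : 0 < τ) (ht : 0 < t)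
    (hr : 0 ≤ r) (hc₀ : 1 ≤ r ^ 2 * c₀) (hL : ENNReal.ofReal r ≤ L) {φ : Torus → ℝ}
    {k : Phase → ℝ}
    (hk : ENNReal.ofReal c₀ * plainSq betaColl τ t φ k ≤ twistedSq γ betaColl τ t φ k) :
    EnergyBounds L τ (wt τ t) φ k (energy γ betaColl τ δ t φ k ^ (1 / 2 : ℝ)) := by
  have hm := wt_pos hτ ht
  have hc₀' : 0 ≤ c₀ := le_of_not_gt fun h => by nlinarith [sq_nonneg r]
  have henergy : ENNReal.ofReal c₀ * plainSq betaColl τ t φ k ≤ energy γ betaColl τ δ t φ k :=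
    hk.trans le_self_add
  constructor
  · refine (le_wgt_mul_sqrt hτ hm hr hc₀ (le_trans ?_ henergy)).trans (by gcongr)
    simp only [mul_zero, Real.rpow_zero, mul_one]
    exact mul_le_mul_right (le_self_add.trans le_self_add) _
  · refine (le_wgt_mul_sqrt hτ hm hr hc₀ (le_trans ?_ henergy)).trans (by gcongr)
    have hτexp : (-2 * (-1 / 5) : ℝ) = betaColl 1 := by norm_num [betaColl]
    have hmexp : (-2 * (-3 / 2) : ℝ) = 3 := by norm_num
    rw [hτexp, hmexp, Real.rpow_ofNat, ENNReal.ofReal_mul hc₀', mul_assoc]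
    exact mul_le_mul_right le_add_self _

theorem DissipationBounds.mono {L x y : ℝ≥0∞} {τ m : ℝ} {φ : Torus → ℝ} {h : Phase → ℝ}
    (hh : DissipationBounds L τ m φ h x) (hxy : x ≤ y) : DissipationBounds L τ m φ h y where
  A := hh.A.trans (by gcongr)
  AA := hh.AA.trans (by gcongr)
  AC := hh.AC.trans (by gcongr)
  C := hh.C.trans (by gcongr)
  H := hh.H.trans (by gcongr)

theorem DissipationBounds.interp_le {L y : ℝ≥0∞} {τ m s : ℝ} {φ : Torus → ℝ} {g : Phase → ℝ}
    (hg : DissipationBounds L τ m φ g y) (hτ : 0 < τ) (hm : 0 < m) (hs : s ∈ Icc (0 : ℝ) 1) :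
    interp φ g s ≤ L * wgt τ m (1 / 2 - 7 / 15 * s) (-1) * y := by
  convert! rpow_mul_rpow_le_wgt hτ hm hs hg.H hg.C using 3
  congr 1 <;> ring

theorem EnergyBounds.interp_le {L z : ℝ≥0∞} {τ m s : ℝ} {φ : Torus → ℝ} {k : Phase → ℝ}
    (hk : EnergyBounds L τ m φ k z) (hτ : 0 < τ) (hm : 0 < m) (hs : s ∈ Icc (0 : ℝ) 1) :
    interp φ k s ≤ L * wgt τ m (-s / 5) (-3 * s / 2) * z := by
  convert! rpow_mul_rpow_le_wgt hτ hm hs hk.H hk.C using 3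
  congr 1 <;> ring

/-! ### The remainders -/

section Remainders

variable {σ τ δ t N P : ℝ} {L : ℝ≥0∞} {φ : Torus → ℝ}

theorem quadRem_le (hw : WeightRange σ τ (wt τ t)) (hN : 14 / 15 ≤ N) (hL : 1 ≤ L) {D : ℝ≥0∞}
    {h : Phase → ℝ} (hh : DissipationBounds L τ (wt τ t) φ h (D ^ (1 / 2 : ℝ))) :
    quadRem betaColl τ δ t φ h ≤ ENNReal.ofReal (1 / δ ^ 2) *
      (5 * (L ^ 3 * ENNReal.ofReal (σ ^ (-N) * τ ^ (14 / 15 : ℝ)) * D)) := by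
  have hone : (1 : ℝ≥0∞) ≤ L * wgt τ (wt τ t) 0 0 * 1 := by simpa [wgt_zero] using hL
  have hterm {a b a₁ b₁ a₂ b₂ : ℝ} {X Y : ℝ≥0∞}
      (hX : X ≤ L * wgt τ (wt τ t) a₁ b₁ * D ^ (1 / 2 : ℝ))
      (hY : Y ≤ L * wgt τ (wt τ t) a₂ b₂ * D ^ (1 / 2 : ℝ))
      (ha₀ : 0 ≤ a + a₁ + a₂) (ha : a + a₁ + a₂ ≤ 14 / 15) (hb : 0 ≤ b + b₁ + b₂) :
      wgt τ (wt τ t) a b * X * Y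
        ≤ L ^ 3 * ENNReal.ofReal (σ ^ (-N) * τ ^ (14 / 15 : ℝ)) * D := by
    have := hw.mul_three_le (N := N) (P := 14 / 15) (a := a) (b := b) hX hY hone
      (by linarith) (by linarith) (by linarith)
    rwa [mul_one, mul_one, rpow_half_mul_self] at this
  have hAC := hterm (a := 2 / 5) (b := 3) hh.A hh.C (by norm_num) (by norm_num) (by norm_num)
  have hHC := hterm (a := 2 / 5) (b := 3) hh.H hh.C (by norm_num) (by norm_num) (by norm_num)
  have hAA := hterm (a := -1 / 15) (b := 2) hh.A hh.A (by norm_num) (by norm_num) (by norm_num)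
  have hHC' := hterm (a := -1 / 15) (b := 2) hh.H hh.C (by norm_num) (by norm_num) (by norm_num)
  have hHA := hterm (a := -1 / 15) (b := 2) hh.H hh.A (by norm_num) (by norm_num) (by norm_num)
  rw [mul_assoc, ← pow_two] at hAA
  rw [quadRem, ofReal_rpow_mul_sq, ofReal_rpow_mul_cube, show betaColl 1 = 2 / 5 from rfl,
    show betaColl 2 = -1 / 15 from rfl]
  refine mul_le_mul_right ((add_le_add (add_le_add (add_le_add (add_le_add hAC hHC) hAA) hHC')
    hHA).trans_eq ?_) _
  ring

variable {x y z : ℝ≥0∞} {h g k : Phase → ℝ}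

theorem long_time_term_le (hw : WeightRange σ τ (wt τ t)) (htτ : τ ≤ t) (hP : 14 / 15 ≤ P)
    (hN : P ≤ N) (hh : DissipationBounds L τ (wt τ t) φ h x)
    (hg : DissipationBounds L τ (wt τ t) φ g y) (hk : EnergyBounds L τ (wt τ t) φ k z) :
    normA φ h * interp φ g (1 / 4) * normH φ k
      ≤ L ^ 3 * ENNReal.ofReal (σ ^ (-N) * τ ^ P) * (x * y * z) := by
  have hm : wt τ t = 1 := min_eq_left ((one_le_div hw.τ_pos).2 htτ)
  have hinterp : interp φ g (1 / 4)
      ≤ L * wgt τ (wt τ t) (1 / 2 - 7 / 15 * (1 / 4)) 0 * y := by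
    have h := hg.interp_le hw.τ_pos hw.m_pos (s := 1 / 4) (by norm_num)
    rw [hm] at h ⊢
    rwa [wgt_one_left] at h
  have := hw.mul_three_le (a := 0) (b := 0) (P := P) (N := N) hh.A hinterp hk.H
    (by linarith) (by linarith) (by norm_num)
  rwa [wgt_zero, one_mul] at this

theorem normH_le_shortTime (hτ : 0 < τ) (ht : 0 < t) (htτ : t ≤ τ) (hL : 1 ≤ L) :
    normH φ g ≤ L * wgt τ (wt τ t) (1 / 2) (3 / 4) * shortTime (1 / 2) τ t φ g := by
  have hm : 0 < wt τ t := wt_pos hτ ht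
  have hmt : wt τ t = t / τ := min_eq_right ((div_le_one hτ).2 htτ)
  have hshort : shortTime (1 / 2) τ t φ g
      = wgt τ (wt τ t) (-(1 / 2)) (-(3 / 4)) * normH φ g := by
    rw [shortTime, if_pos htτ, ← hmt, ENNReal.ofReal_rpow_of_pos hm,
      ← ENNReal.ofReal_mul (by positivity), wgt]
    norm_num
  rw [hshort, mul_assoc, ← mul_assoc (wgt _ _ _ _), wgt_mul hτ hm, add_neg_cancel, add_neg_cancel,
    wgt_zero, one_mul]
  exact le_mul_of_one_le_left zero_le hL

theorem short_time_term_le (hw : WeightRange σ τ (wt τ t)) (ht : 0 < t) (htτ : t ≤ τ)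
    (hP : 14 / 15 ≤ P) (hN : P ≤ N) (hL : 1 ≤ L) (hh : DissipationBounds L τ (wt τ t) φ h x)
    (hk : EnergyBounds L τ (wt τ t) φ k z) :
    normA φ h * normH φ g * interp φ k (1 / 2)
      ≤ L ^ 3 * ENNReal.ofReal (σ ^ (-N) * τ ^ P) * (x * shortTime (1 / 2) τ t φ g * z) := by
  have := hw.mul_three_le (a := 0) (b := 0) (P := P) (N := N) hh.A
    (normH_le_shortTime (φ := φ) (g := g) hw.τ_pos ht htτ hL)
    (hk.interp_le hw.τ_pos hw.m_pos (s := 1 / 2) (by norm_num))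
    (by linarith) (by linarith) (by norm_num)
  rwa [wgt_zero, one_mul] at this

theorem triRem_le (hw : WeightRange σ τ (wt τ t)) (ht : 0 < t) (hP : 14 / 15 ≤ P) (hN : P ≤ N)
    (hL : 1 ≤ L) (hh : DissipationBounds L τ (wt τ t) φ h x)
    (hg : DissipationBounds L τ (wt τ t) φ g y) (hy : shortTime (1 / 2) τ t φ g ≤ y)
    (hk : EnergyBounds L τ (wt τ t) φ k z) :
    triRem betaColl (fun _ => 1 / 4) (1 / 2) τ δ t φ h g k ≤ ENNReal.ofReal (1 / δ ^ 2) *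
      (10 * (L ^ 3 * ENNReal.ofReal (σ ^ (-N) * τ ^ P) * (x * y * z))) := by
  set U := L ^ 3 * ENNReal.ofReal (σ ^ (-N) * τ ^ P)
  have hterm {X Y Z y' z' : ℝ≥0∞} (a b : ℝ) {a₁ b₁ a₂ b₂ a₃ b₃ : ℝ}
      (hX : X ≤ L * wgt τ (wt τ t) a₁ b₁ * x) (hY : Y ≤ L * wgt τ (wt τ t) a₂ b₂ * y')
      (hZ : Z ≤ L * wgt τ (wt τ t) a₃ b₃ * z') (ha₀ : 0 ≤ a + a₁ + a₂ + a₃)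
      (ha : a + a₁ + a₂ + a₃ ≤ 14 / 15) (hb : 0 ≤ b + b₁ + b₂ + b₃) :
      wgt τ (wt τ t) a b * X * Y * Z ≤ U * (x * y' * z') :=
    hw.mul_three_le hX hY hZ (by linarith) (by linarith) hb
  have hg₁ := hg.interp_le hw.τ_pos hw.m_pos (s := 1 / 4) (by norm_num)
  have hg₂ := hg.interp_le hw.τ_pos hw.m_pos (s := 1 - 1 / 4) (by norm_num)
  have hk₁ := hk.interp_le hw.τ_pos hw.m_pos (s := 1 / 4) (by norm_num)
  have hT₁ : (if τ ≤ t then normA φ h * interp φ g (1 / 4) * normH φ k else 0)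
      ≤ U * (x * y * z) := by
    split_ifs with htτ
    exacts [long_time_term_le hw htτ hP hN hh hg hk, zero_le]
  have hT₁' : (if t ≤ τ then normA φ h * normH φ g * interp φ k (1 / 2) else 0)
      ≤ U * (x * y * z) := by
    split_ifs with htτ
    exacts [(short_time_term_le hw ht htτ hP hN hL hh hk).trans (by gcongr), zero_le]
  have hT₂ := hterm (-8 / 15) 1 hh.A hg₁ hk.H (by norm_num) (by norm_num) (by norm_num)
  have hT₃ := hterm (-8 / 15) 1 hh.AA hk₁ hg.A (by norm_num) (by norm_num) (by norm_num)
  have hT₄ := hterm (2 / 5) 3 hh.AC hg.C hk₁ (by norm_num) (by norm_num) (by norm_num)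
  have hT₅ := hterm (2 / 5) 3 hh.AC hk₁ hg₂ (by norm_num) (by norm_num) (by norm_num)
  have hT₆ := hterm (-1 / 15) 2 hh.AA hk₁ hg.C (by norm_num) (by norm_num) (by norm_num)
  have hT₇ := hterm (-1 / 15) 2 hh.AA hk₁ hg₂ (by norm_num) (by norm_num) (by norm_num)
  have hT₈ := hterm (-1 / 15) 2 hh.C hg₁ hk.H (by norm_num) (by norm_num) (by norm_num)
  have hT₉ := hterm (-1 / 15) 2 hh.AC hk₁ hg.A (by norm_num) (by norm_num) (by norm_num)
  rw [triRem, ← mul_add, ofReal_rpow_mul (m := wt τ t), ofReal_rpow_mul_sq, ofReal_rpow_mul_cube,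
    show betaColl 0 = -8 / 15 from rfl, show betaColl 1 = 2 / 5 from rfl,
    show betaColl 2 = -1 / 15 from rfl]
  refine mul_le_mul_right ((add_le_add (add_le_add hT₁ hT₁') (add_le_add (add_le_add (add_le_add
    (add_le_add (add_le_add (add_le_add (add_le_add hT₂ hT₃) hT₄) hT₅) hT₆) hT₇) hT₈)
    hT₉)).trans_eq ?_) _
  ring

theorem quadRem_zero (h : Phase → ℝ) : quadRem betaColl τ δ 0 φ h = 0 := by
  simp [quadRem, wt]

theorem shortTime_zero (hτ : 0 < τ) (hg : normH φ g ≠ 0) : shortTime (1 / 2) τ 0 φ g = ⊤ := by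
  have hcoef : ENNReal.ofReal (τ ^ (-(1 / 2) : ℝ)) ≠ 0 := by
    simpa using Real.rpow_pos_of_pos hτ _
  rw [shortTime, if_pos hτ.le, zero_div, ENNReal.ofReal_zero,
    ENNReal.zero_rpow_of_neg (by norm_num), ENNReal.mul_top hcoef, ENNReal.top_mul hg]

theorem triRem_zero_le {γ : Fin 3 → ℝ} {K : ℝ} (hτ : 0 < τ) (hK : 0 < K) {η : Fin 9 → ℝ} :
    triRem betaColl η (1 / 2) τ δ 0 φ h g k ≤ ENNReal.ofReal K
      * dissipation γ betaColl τ 0 φ h ^ (1 / 2 : ℝ)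
      * (dissipation γ betaColl τ 0 φ g ^ (1 / 2 : ℝ) + shortTime (1 / 2) τ 0 φ g)
      * energy γ betaColl τ δ 0 φ k ^ (1 / 2 : ℝ) := by
  have hwt : wt τ 0 = 0 := by simp [wt]
  have htri : triRem betaColl η (1 / 2) τ δ 0 φ h g k
      = ENNReal.ofReal (1 / δ ^ 2) * (normA φ h * normH φ g * interp φ k (1 / 2)) := by
    simp [triRem, hwt, hτ.le, hτ.not_ge]
  rw [htri]
  by_cases hh : normA φ h = 0
  · simp [hh]
  by_cases hg : normH φ g = 0
  · simp [hg]
  by_cases hk : normH φ k = 0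
  · rw [interp, hk, ENNReal.zero_rpow_of_pos (by norm_num)]
    simp
  have hD : dissipation γ betaColl τ 0 φ h ^ (1 / 2 : ℝ) ≠ 0 := by
    simp [dissipation, hτ, hh]
  have hE : energy γ betaColl τ δ 0 φ k ^ (1 / 2 : ℝ) ≠ 0 := by
    simp [energy, twistedSq, hk]
  have hKD : ENNReal.ofReal K * dissipation γ betaColl τ 0 φ h ^ (1 / 2 : ℝ) ≠ 0 :=
    mul_ne_zero (by simpa using hK) hD
  rw [shortTime_zero hτ hg, add_top, ENNReal.mul_top hKD, ENNReal.top_mul hE]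
  exact le_top

theorem ofReal_inv_sq_mul {ℓ R : ℝ} (hℓ : 0 ≤ ℓ) {n : ℝ} (hn : 0 ≤ n) :
    ENNReal.ofReal (1 / δ ^ 2) * (ENNReal.ofReal n * (ENNReal.ofReal ℓ ^ 3 * ENNReal.ofReal R))
      = ENNReal.ofReal (n * ℓ ^ 3 * R / δ ^ 2) := by
  rw [← ENNReal.ofReal_pow hℓ, ← ENNReal.ofReal_mul (by positivity),
    ← ENNReal.ofReal_mul hn, ← ENNReal.ofReal_mul (by positivity)]
  ring_nf

end Remainders

section Constants

theorem exists_scale {γ : Fin 3 → ℝ} (hγ : ∀ i, 0 < γ i) {c₀ : ℝ} (hc₀ : 0 < c₀) :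
    ∃ r : ℝ, 1 ≤ r ∧ (∀ i, 1 ≤ r ^ 2 * γ i) ∧ 1 ≤ r ^ 2 * c₀ := by
  have hlarge {c : ℝ} (hc : 0 < c) : ∀ᶠ r : ℝ in atTop, 1 ≤ r ^ 2 * c :=
    ((tendsto_pow_atTop two_ne_zero).atTop_mul_const hc).eventually_ge_atTop 1
  exact ((eventually_ge_atTop 1).and
    ((eventually_all.2 fun i => hlarge (hγ i)).and (hlarge hc₀))).exists

variable {γ : Fin 3 → ℝ} {B r τ₀ c₀ τ δ t : ℝ} {φ : Torus → ℝ} {h g k : Phase → ℝ}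

/-- The common constant in the dissipation and energy bounds for `τ > τ₀`. -/
def boundConst (B r N τ₀ : ℝ) : ℝ := 4 * B * r * min 1 τ₀ ^ (-N)

/-- The constant `K` of the remainder estimates. -/
def remConst (B r N τ₀ : ℝ) : ℝ := 10 * boundConst B r N τ₀ ^ 3 * min 1 τ₀ ^ (-N)

theorem le_boundConst {N : ℝ} (hB : 1 ≤ B) (hr : 1 ≤ r) (hN : 0 ≤ N) (hτ₀ : 0 < τ₀) :
    r ≤ boundConst B r N τ₀ := by
  have hR : 1 ≤ min 1 τ₀ ^ (-N) := Real.one_le_rpow_of_pos_of_le_one_of_nonpos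
    (lt_min one_pos hτ₀) (min_le_left _ _) (by linarith)
  calc r ≤ 4 * B * r := le_mul_of_one_le_left (by linarith) (by linarith)
    _ ≤ _ := le_mul_of_one_le_right (by nlinarith) hR

theorem remConst_pos {N : ℝ} (hB : 0 < B) (hr : 0 < r) (hτ₀ : 0 < τ₀) :
    0 < remConst B r N τ₀ := by
  unfold remConst boundConst
  positivity

theorem quadRem_le_dissipation {N : ℝ} (hB : IsComparable B φ) (hr : 1 ≤ r)
    (hγ : ∀ i, 1 ≤ r ^ 2 * γ i) (hN : 14 / 15 ≤ N) (hτ₀ : 0 < τ₀) (ht : 0 ≤ t) (hτ : τ₀ < τ)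
    (hh : MemH0 φ h) :
    quadRem betaColl τ δ t φ h
      ≤ ENNReal.ofReal (remConst B r N τ₀ * τ ^ (14 / 15 : ℝ) / δ ^ 2)
        * dissipation γ betaColl τ t φ h := by
  rcases ht.eq_or_lt with rfl | ht
  · simp [quadRem_zero]
  have hr' := le_boundConst hB.one_le hr (by linarith : 0 ≤ N) hτ₀
  have hw := weightRange_wt hτ₀ hτ ht
  refine (quadRem_le hw hN (ENNReal.one_le_ofReal.2 (hr.trans hr'))
    (dissipationBounds hB hw ht (by linarith) hr hγ hh)).trans ?_
  rw [remConst, mul_assoc _ _ (τ ^ _), ← ofReal_inv_sq_mul (by linarith) (by norm_num),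
    ENNReal.ofReal_ofNat, boundConst]
  have h5 : (5 : ℝ≥0∞) ≤ 10 := by norm_num
  exact (mul_le_mul_right (mul_le_mul_left h5 _) _).trans_eq (by ring)

theorem triRem_le_dissipation {N : ℝ} (hB : IsComparable B φ) (hr : 1 ≤ r)
    (hγ : ∀ i, 1 ≤ r ^ 2 * γ i) (hc₀ : 1 ≤ r ^ 2 * c₀) (hN : 14 / 15 ≤ N) (hτ₀ : 0 < τ₀)
    (hδ : 0 < δ) (ht : 0 ≤ t) (hτ : τ₀ < τ) (hh : MemH0 φ h) (hg : MemH0 φ g)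
    (hk : ENNReal.ofReal c₀ * plainSq betaColl τ t φ k ≤ twistedSq γ betaColl τ t φ k) :
    triRem betaColl (fun _ => 1 / 4) (1 / 2) τ δ t φ h g k
      ≤ ENNReal.ofReal (remConst B r N τ₀ * τ ^ N / δ ^ 2)
        * dissipation γ betaColl τ t φ h ^ (1 / 2 : ℝ)
        * (dissipation γ betaColl τ t φ g ^ (1 / 2 : ℝ) + shortTime (1 / 2) τ t φ g)
        * energy γ betaColl τ δ t φ k ^ (1 / 2 : ℝ) := by
  have hN0 : 0 ≤ N := by linarith
  have hτ0 : 0 < τ := hτ₀.trans hτ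
  rcases ht.eq_or_lt with rfl | ht
  · have := remConst_pos (N := N) (zero_lt_one.trans_le hB.one_le)
      (zero_lt_one.trans_le hr) hτ₀
    exact triRem_zero_le hτ0 (by positivity)
  have hr' := le_boundConst hB.one_le hr hN0 hτ₀
  have hw := weightRange_wt hτ₀ hτ ht
  have hbounds {f : Phase → ℝ} (hf : MemH0 φ f) :=
    dissipationBounds hB hw ht (by linarith : 1 / 2 ≤ N) hr hγ hf
  refine (triRem_le hw ht hN le_rfl (ENNReal.one_le_ofReal.2 (hr.trans hr')) (hbounds hh)
    ((hbounds hg).mono le_self_add) le_add_self (energyBounds (δ := δ) hτ0 ht (by linarith) hc₀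
      (ENNReal.ofReal_le_ofReal hr') hk)).trans_eq ?_
  rw [remConst, mul_assoc _ _ (τ ^ _), ← ofReal_inv_sq_mul (by linarith) (by norm_num),
    ENNReal.ofReal_ofNat, boundConst]
  ring

end Constants

end VPFP

end

theorem proposition8p2_general (ε τ₀ : ℝ) (hε : 0 ≤ ε) (hτ₀ : 0 < τ₀) (γ : Fin 3 → ℝ)
    (hγ : ∀ i, 0 < γ i) (ρ : VPFP.Torus → ℝ) (hρ : MemLp ρ 2) (δ₀ : ℝ) (hδ₀ : 0 < δ₀)
    (c₀ : ℝ) (hc₀ : 0 < c₀)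
    (hγ' : ∀ δ > δ₀, ∀ φ, VPFP.IsPoissonBoltzmann δ ρ φ → ∀ τ > τ₀, ∀ t ≥ 0, ∀ k, VPFP.MemH φ k →
      ENNReal.ofReal c₀ * VPFP.plainSq VPFP.betaColl τ t φ k
        ≤ VPFP.twistedSq γ VPFP.betaColl τ t φ k) :
    ∃ K : ℝ, 0 < K ∧
      ∀ t ≥ 0, ∀ τ > τ₀, ∀ δ > δ₀, ∀ φ : VPFP.Torus → ℝ, VPFP.IsPoissonBoltzmann δ ρ φ →
      ∀ h g k : VPFP.Phase → ℝ, VPFP.MemH0 φ h → VPFP.MemH0 φ g → VPFP.MemH φ k →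
        VPFP.quadRem VPFP.betaColl τ δ t φ h
          ≤ ENNReal.ofReal (K * τ ^ (14 / 15 : ℝ) / δ ^ 2)
            * VPFP.dissipation γ VPFP.betaColl τ t φ h
        ∧ VPFP.triRem VPFP.betaColl (fun _ => 1 / 4) (1 / 2) τ δ t φ h g k
          ≤ ENNReal.ofReal (K * τ ^ (14 / 15 + ε : ℝ) / δ ^ 2)
            * VPFP.dissipation γ VPFP.betaColl τ t φ h ^ (1 / 2 : ℝ)
            * (VPFP.dissipation γ VPFP.betaColl τ t φ g ^ (1 / 2 : ℝ)
                + VPFP.shortTime (1 / 2) τ t φ g)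
            * VPFP.energy γ VPFP.betaColl τ δ t φ k ^ (1 / 2 : ℝ) := by
  obtain ⟨B, hB₀, hB⟩ := VPFP.exists_isComparable hρ hδ₀
  obtain ⟨r, hr, hrγ, hrc₀⟩ := VPFP.exists_scale hγ hc₀
  have hN : 14 / 15 ≤ 14 / 15 + ε := le_add_of_nonneg_right hε
  refine ⟨VPFP.remConst B r (14 / 15 + ε) τ₀, VPFP.remConst_pos hB₀ (by linarith) hτ₀,
    fun t ht τ hτ δ hδ φ hφ h g k hh hg hk => ⟨?_, ?_⟩⟩
  · exact VPFP.quadRem_le_dissipation (hB δ hδ φ hφ) hr hrγ hN hτ₀ ht hτ hh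
  · exact VPFP.triRem_le_dissipation (hB δ hδ φ hφ) hr hrγ hrc₀ hN hτ₀ (hδ₀.trans hδ) ht hτ hh hg
      (hγ' δ hδ φ hφ τ hτ t ht k hk)

theorem proposition8p2 (ε τ₀ : ℝ) (hε : 0 < ε) (hτ₀ : 0 < τ₀)
    (γ : Fin 3 → ℝ) (hγ : ∀ i, 0 < γ i) (hγ' : VPFP.NormEquivalence γ VPFP.betaColl τ₀)
    (p : ℝ≥0∞) (hp : 2 < p) (ρ : VPFP.Torus → ℝ) (hρ : VPFP.MemW1 p ρ) (hρ' : ∫ x, ρ x = 1)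
    (δ₀ : ℝ) (hδ₀ : 0 < δ₀) :
    ∃ η : Fin 9 → ℝ, (∀ i, η i ∈ Ioo (0 : ℝ) 1) ∧ ∃ η' ∈ Ioo (0 : ℝ) 1, ∃ K : ℝ, 0 < K ∧
      ∀ t ≥ 0, ∀ τ > τ₀, ∀ δ > δ₀, ∀ φ : VPFP.Torus → ℝ, VPFP.IsPoissonBoltzmann δ ρ φ →
      ∀ h g k : VPFP.Phase → ℝ, VPFP.MemH0 φ h → VPFP.MemH0 φ g → VPFP.MemH0 φ k →
        VPFP.quadRem VPFP.betaColl τ δ t φ h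
          ≤ ENNReal.ofReal (K * τ ^ (14 / 15 : ℝ) / δ ^ 2)
            * VPFP.dissipation γ VPFP.betaColl τ t φ h
        ∧ VPFP.triRem VPFP.betaColl η η' τ δ t φ h g k
          ≤ ENNReal.ofReal (K * τ ^ (14 / 15 + ε : ℝ) / δ ^ 2)
            * VPFP.dissipation γ VPFP.betaColl τ t φ h ^ (1 / 2 : ℝ)
            * (VPFP.dissipation γ VPFP.betaColl τ t φ g ^ (1 / 2 : ℝ)
                + VPFP.shortTime η' τ t φ g)
            * VPFP.energy γ VPFP.betaColl τ δ t φ k ^ (1 / 2 : ℝ) := by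
  obtain ⟨c₀, _, hc₀, -, heq⟩ := hγ'
  obtain ⟨K, hK, hrem⟩ := proposition8p2_general ε τ₀ hε.le hτ₀ γ hγ ρ (hρ.1.mono_exponent hp.le)
    δ₀ hδ₀ c₀ hc₀ fun δ hδ φ hφ τ hτ t ht k hk =>
      (heq p ρ hp hρ hρ' δ (hδ₀.trans hδ) φ hφ τ hτ t ht k hk).1
  exact ⟨fun _ => 1 / 4, fun _ => by norm_num, 1 / 2, by norm_num, K, hK,
    fun t ht τ hτ δ hδ φ hφ h g k hh hg hk => hrem t ht τ hτ δ hδ φ hφ h g k hh hg hk.1⟩
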